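/- Let $n:[0,\infty)\to(0,\infty)$ be a refractive index such that $N(x)=n(|x|)$ is smooth on $\mathbb R^2$, and let $(\mathbb R^2,n)$ denote the plane with the Riemannian metric $g=N(x)^2\langle\cdot,\cdot\rangle$. Let $k\ge 1$ and let $\gamma$ be a simple closed curve with a regular $2\pi$-periodic $C^{k+1}$ parametrization $\theta\mapsto\gamma(\theta)$, oriented so that the region $\Omega$ which it bounds (the bounded part of $\mathbb R^2\setminus\gamma$) lies on its left. Suppose that $\Omega\cup\gamma$ is contained in a totally normal neighbourhood $W$ of $(\mathbb R^2,n)$: $W$ is open and there is $\delta>0$ such that for every $q\in W$ the exponential map $\exp_q$ is a diffeomorphism from the ball $B_\delta(0)\subset T_q\mathbb R^2$ onto an open set containing $W$. Suppose also that the geodesic curvature of $\gamma$ with respect to $g$ and the inward normal is strictly positive. For $\theta_0\in\mathbb R/2\pi\mathbb Z$ and $\alpha_0\in(0,\pi)$, follow the unit-speed geodesic of $g$ that leaves $\gamma(\theta_0)$ in the direction making the angle $\alpha_0$ with the tangent $\gamma'(\theta_0)$ (measured towards the inward normal); it travels in $\Omega$ until it hits $\gamma$ again, at $\gamma(\theta_1)$.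 Reflect its velocity there in the tangent line of $\gamma$, and let $\alpha_1$ be the angle between the reflected direction and $\gamma'(\theta_1)$. Then this defines a map $$T:\mathbb R/2\pi\mathbb Z\times(0,\pi)\to\mathbb R/2\pi\mathbb Z\times(0,\pi),\qquad (\theta_0,\alpha_0)\mapsto(\theta_1,\alpha_1)$$ (the convex optical billiard map), which is a $C^k$ diffeomorphism and has the twist property $\partial\theta_1/\partial\alpha_0>0$ everywhere. Moreover, if $\gamma$ is given in standard polar coordinates by $r=\rho(\theta)$, that is $\gamma(\theta)=\rho(\theta)(\cos\theta,\sin\theta)$ with $\rho>0$, then $T$ preserves the measure $$n(\rho(\theta))\,\sqrt{\rho'(\theta)^2+\rho(\theta)^2}\;\sin\alpha\;d\theta\,d\alpha .$$ -/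

import Mathlib

open Real Set Filter Topology MeasureTheory
open scoped ContDiff

namespace OpticalBilliard

/-! The Euclidean plane is modelled by `ℂ` with its real inner product; multiplication by
`Complex.I` is the rotation by a right angle, counterclockwise. -/

/-- The refractive index as a function on the plane: `x ↦ n (|x|)`. The Riemannian manifold
`(ℝ², n)` is the plane with the metric `N(x)² ⟨·,·⟩`, where `N = planeIndex n`. -/
noncomputable def planeIndex (n : ℝ → ℝ) (x : ℂ) : ℝ := n ‖x‖

/-- The covariant acceleration `∇_{c'} c'` of a plane curve `c` for the Levi-Civita connection of
the conformal metric `N² ⟨·,·⟩`, that is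
`c'' + 2 ⟨∇ log N, c'⟩ c' - |c'|² ∇ log N` along `c`, with `∇ log N = N⁻¹ ∇N`. -/
noncomputable def covAccel (N : ℂ → ℝ) (c : ℝ → ℂ) (t : ℝ) : ℂ :=
  deriv (deriv c) t
    + (2 * (inner ℝ (gradient N (c t)) (deriv c t) / N (c t))) • deriv c t
    - (‖deriv c t‖ ^ 2 / N (c t)) • gradient N (c t)

/-- `c` is a geodesic of the metric `N² ⟨·,·⟩` on the (open) set `s` of parameters. -/
def IsGeodesicOn (N : ℂ → ℝ) (c : ℝ → ℂ) (s : Set ℝ) : Prop :=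
  ContDiffOn ℝ 2 c s ∧ ∀ t ∈ s, covAccel N c t = 0

/-- The geodesic curvature, for the metric `N² ⟨·,·⟩`, of a regular curve `c` with respect to its
left unit normal `i c' / (N |c'|)`, namely `g(∇_{c'} c', ν) / g(c', c')`. -/
noncomputable def geodesicCurvature (N : ℂ → ℝ) (c : ℝ → ℂ) (t : ℝ) : ℝ :=
  inner ℝ (covAccel N c t) (Complex.I * deriv c t) / (N (c t) * ‖deriv c t‖ ^ 3)

/-- `exp_q v` is defined and equal to `p`: the geodesic starting at `q` with velocity `v` exists up
to time `1` and reaches `p` at that time. -/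
def ExpMapsTo (N : ℂ → ℝ) (q v p : ℂ) : Prop :=
  ∃ (c : ℝ → ℂ) (s : Set ℝ), IsOpen s ∧ Icc 0 1 ⊆ s ∧ IsGeodesicOn N c s ∧
    c 0 = q ∧ deriv c 0 = v ∧ c 1 = p

/-- `W` is a totally normal neighbourhood: it is open and there is `δ > 0` such that, for each
`q ∈ W`, the exponential map at `q` is a diffeomorphism of the ball of radius `δ` of the tangent
space at `q` (for the metric `N² ⟨·,·⟩`) onto an open set that contains `W`. -/
def IsTotallyNormal (N : ℂ → ℝ) (W : Set ℂ) : Prop :=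
  IsOpen W ∧ ∃ δ : ℝ, 0 < δ ∧ ∀ q ∈ W, ∃ e : OpenPartialHomeomorph ℂ ℂ,
    e.source = {v | N q * ‖v‖ < δ} ∧ (∀ v ∈ e.source, ExpMapsTo N q v (e v)) ∧
    ContDiffOn ℝ ∞ e e.source ∧ ContDiffOn ℝ ∞ e.symm e.target ∧ W ⊆ e.target

/-- The (open) region bounded by a closed curve: the union of the bounded connected components of
the complement of its trace. -/
def region (γ : ℝ → ℂ) : Set ℂ :=
  {p | p ∈ (range γ)ᶜ ∧ Bornology.IsBounded (connectedComponentIn (range γ)ᶜ p)}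

/-- `γ` is a regular parametrization of class `C^m`, with period `2π`, of a simple closed curve,
traversed so that the region which it bounds lies on its left. -/
structure IsSimpleClosedCurve (m : ℕ) (γ : ℝ → ℂ) : Prop where
  contDiff : ContDiff ℝ m γ
  regular : ∀ θ, deriv γ θ ≠ 0
  periodic : Function.Periodic γ (2 * π)
  injOn : InjOn γ (Ico 0 (2 * π))
  positive : ∀ θ, ∀ᶠ ε : ℝ in 𝓝[>] 0, γ θ + ε • (Complex.I * deriv γ θ) ∈ region γ

/-- The direction at `γ θ`, of norm one for the metric `N² ⟨·,·⟩`, which makes the angle `α` with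
the tangent vector `γ' θ`, measured from the tangent towards the left (inward) normal. -/
noncomputable def direction (N : ℂ → ℝ) (γ : ℝ → ℂ) (θ α : ℝ) : ℂ :=
  (N (γ θ) * ‖deriv γ θ‖)⁻¹ • (Complex.exp (α * Complex.I) * deriv γ θ)

/-- From the impact at `γ θ₀` with outgoing angle `α₀` the next impact is at `γ θ₁` with outgoing
angle `α₁`: the geodesic issued from `γ θ₀` with angle `α₀` travels inside the region until it hits
the boundary at `γ θ₁`, and there its velocity, reflected in the tangent line of the curve, makes
the angle `α₁` with the tangent. -/
def NextImpact (N : ℂ → ℝ) (γ : ℝ → ℂ) (θ₀ α₀ θ₁ α₁ : ℝ) : Prop :=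
  ∃ (η : ℝ → ℂ) (t₁ : ℝ) (s : Set ℝ), 0 < t₁ ∧ IsOpen s ∧ Icc 0 t₁ ⊆ s ∧ IsGeodesicOn N η s ∧
    η 0 = γ θ₀ ∧ deriv η 0 = direction N γ θ₀ α₀ ∧
    (∀ t ∈ Ioo 0 t₁, η t ∈ region γ) ∧
    η t₁ = γ θ₁ ∧
    (Submodule.span ℝ {deriv γ θ₁}).reflection (deriv η t₁) = direction N γ θ₁ α₁

/-- The phase space `ℝ/2πℤ × (0, π)`. -/
abbrev Phase : Type := AddCircle (2 * π) × Ioo (0 : ℝ) π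

/-- `T` is the billiard map of `γ`: the graph of `T` is the next-impact relation. -/
def IsBilliardMap (N : ℂ → ℝ) (γ : ℝ → ℂ) (T : Phase → Phase) : Prop :=
  ∀ (θ₀ θ₁ : ℝ) (α₀ α₁ : Ioo (0 : ℝ) π),
    T ((θ₀ : AddCircle (2 * π)), α₀) = ((θ₁ : AddCircle (2 * π)), α₁) ↔
      NextImpact N γ θ₀ α₀ θ₁ α₁

/-- `F` is a lift of `T` to the universal cover `ℝ × (0, π)` (the values of `F` elsewhere are
irrelevant). -/
def IsLift (F : ℝ × ℝ → ℝ × ℝ) (T : Phase → Phase) : Prop :=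
  ∀ (θ : ℝ) (α : Ioo (0 : ℝ) π),
    (((F (θ, α)).1 : AddCircle (2 * π)), (F (θ, α)).2) =
      ((T ((θ : AddCircle (2 * π)), α)).1, ((T ((θ : AddCircle (2 * π)), α)).2 : ℝ))

/-- `T` is of class `C^k` on the cylinder `ℝ/2πℤ × (0, π)`: it has a `C^k` lift. (As the strip
`ℝ × (0, π)` is simply connected, a continuous map of the cylinder always has a continuous lift.) -/
def IsCk (k : ℕ) (T : Phase → Phase) : Prop :=
  ∃ F : ℝ × ℝ → ℝ × ℝ, IsLift F T ∧ ContDiffOn ℝ k F (univ ×ˢ Ioo 0 π)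

/-- `T` is a diffeomorphism of class `C^k` of the phase space. -/
def IsCkDiffeo (k : ℕ) (T : Phase ≃ Phase) : Prop := IsCk k T ∧ IsCk k T.symm

/-- The twist property: `∂θ₁/∂α₀ > 0` at every point of the phase space. -/
def HasTwist (T : Phase → Phase) : Prop :=
  ∃ F : ℝ × ℝ → ℝ × ℝ, IsLift F T ∧ ContDiffOn ℝ 1 F (univ ×ˢ Ioo 0 π) ∧
    ∀ (θ : ℝ), ∀ α ∈ Ioo (0 : ℝ) π, 0 < deriv (fun a => (F (θ, a)).1) α

/-- The measure `n(ρ(θ)) √(ρ'(θ)² + ρ(θ)²) sin α dθ dα` on the phase space, transported from the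
fundamental domain `[0, 2π) × (0, π)`. -/
noncomputable def polarMeasure (n ρ : ℝ → ℝ) : Measure Phase :=
  ((((volume : Measure ℝ).restrict (Ico 0 (2 * π))).prod
      ((volume : Measure ℝ).comap (fun α : Ioo (0 : ℝ) π => (α : ℝ)))).withDensity
    (fun z => ENNReal.ofReal
      (n (ρ z.1) * √(deriv ρ z.1 ^ 2 + ρ z.1 ^ 2) * Real.sin z.2))).map
    (fun z => ((z.1 : AddCircle (2 * π)), z.2))

end OpticalBilliard

/-! In the totally normal neighbourhood a geodesic issued from the curve is the image of a ray under
an exponential map, so a billiard flight is recorded by its two end parameters. A chord is a pair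
`θ₀ < θ₁ < θ₀ + 2π` whose joining geodesic runs inside the region. Its departure angle `A` and
reflected arrival angle `A'` are `C^k` functions of the pair. Every ray pointing inwards must leave
the compact closed region before reaching the radius `δ` (`exists_isChord`), and `θ₀` and `A`
determine the chord, since the shorter of two candidates would end in the interior of the longer
(`chord_unique`). Positive curvature keeps a tangent geodesic out of the region to second order
(`eventually_notMem_region`), so chords meet the curve transversally at both ends and form an open
set (`isOpen_chord`).

For the twist, let `w(θ₁)` be the initial vector of the chord. Differentiating `exp (w(θ₁)) = γ(θ₁)`
shows that the derivative of `exp` sends `w'` to `γ'(θ₁)`, and it sends `w` to the arrival velocity.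
It preserves orientation, so transversality on arrival gives `∂A/∂θ₁ > 0`
(`fderiv_departureAngle_pos`). Hence `(θ₀, θ₁) ↦ (θ₀, A)` is injective with invertible derivative,
and the billiard map lifts to `(θ₁, A')` composed with its inverse. Time reversal provides the
inverse of the billiard map.

The invariant measure comes from the length `ℓ` as a generating function. With `a = N(γ)|γ'|`, the
first variation formula gives `dℓ = -a(θ₀) cos A dθ₀ + a(θ₁) cos A' dθ₁` (`hasFDerivAt_length`).
Equality of mixed second derivatives (`sin_mul_fderiv_eq`) is then the Jacobian identity for the
density `a(θ) sin α`, and the change of variables formula concludes.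

Two foundations are needed: joint smoothness of the exponential map in point and vector, from the
inverse function theorem in a space of continuous paths; and the fact that the region lies locally
on exactly one side of the curve (`notMem_interior`), obtained from connectedness of the plane
without the Jordan curve theorem. -/

namespace OpticalBilliard

/-! ### Smooth dependence of solutions of differential equations on initial values -/

section SmoothDependence

universe u

/-- Pointwise evaluation of a continuous family of linear maps, as a continuous linear map into the
operators between spaces of continuous functions. -/
noncomputable def pointwiseApply (K : Type*) [TopologicalSpace K] [CompactSpace K] (E F : Type u)
    [NormedAddCommGroup E] [NormedSpace ℝ E] [NormedAddCommGroup F] [NormedSpace ℝ F] :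
    C(K, E →L[ℝ] F) →L[ℝ] C(K, E) →L[ℝ] C(K, F) :=
  LinearMap.mkContinuous₂
    (LinearMap.mk₂ ℝ (fun (A : C(K, E →L[ℝ] F)) (h : C(K, E)) => (⟨fun t => A t (h t), by fun_prop⟩ : C(K, F)))
      (fun A B h => by ext t; simp) (fun c A h => by ext t; simp)
      (fun A h h' => by ext t; simp) (fun c A h => by ext t; simp)) 1
    (fun A h => by
      rw [ContinuousMap.norm_le _ (by positivity)]
      intro t
      rw [one_mul]
      exact ((A t).le_opNorm _).trans
        (mul_le_mul (A.norm_coe_le_norm t) (h.norm_coe_le_norm t) (norm_nonneg _) (norm_nonneg A)))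

@[simp]
theorem pointwiseApply_apply {K : Type*} [TopologicalSpace K] [CompactSpace K] {E F : Type u}
    [NormedAddCommGroup E] [NormedSpace ℝ E] [NormedAddCommGroup F] [NormedSpace ℝ F]
    (A : C(K, E →L[ℝ] F)) (h : C(K, E)) (t : K) : pointwiseApply K E F A h t = A t (h t) := rfl

/-- Mean value inequality on each segment from `u t` to `u t + h t`. The bound is uniform in `t`
because `u ↦ f' ∘ u` is continuous for the sup norm. -/
theorem hasFDerivAt_postcomp {K : Type*} [TopologicalSpace K] [CompactSpace K] {E F : Type u}
    [NormedAddCommGroup E] [NormedSpace ℝ E] [NormedAddCommGroup F] [NormedSpace ℝ F]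
    (f : C(E, F)) (f' : C(E, E →L[ℝ] F)) (hf : ∀ x, HasFDerivAt f (f' x) x) (u : C(K, E)) :
    HasFDerivAt (fun u : C(K, E) => f.comp u) (pointwiseApply K E F (f'.comp u)) u := by
  rw [hasFDerivAt_iff_isLittleO_nhds_zero, Asymptotics.isLittleO_iff]
  intro ε hε
  have hc : ContinuousAt (fun u : C(K, E) => f'.comp u) u :=
    (ContinuousMap.continuous_postcomp f').continuousAt
  obtain ⟨δ, hδ, H⟩ := (Metric.continuousAt_iff (α := C(K, E)) (β := C(K, E →L[ℝ] F))).1 hc ε hε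
  filter_upwards [Metric.ball_mem_nhds (0 : C(K, E)) hδ] with h hh
  rw [mem_ball_zero_iff] at hh
  rw [ContinuousMap.norm_le _ (by positivity)]
  intro t
  have key : ∀ y ∈ segment ℝ (u t) (u t + h t), ‖f' y - f' (u t)‖ ≤ ε := by
    intro y hy
    rw [segment_eq_image'] at hy
    obtain ⟨s, hs, rfl⟩ := hy
    have h1 : dist (u + s • h) u < δ := by
      rw [dist_eq_norm, add_sub_cancel_left, norm_smul, Real.norm_of_nonneg hs.1]
      exact lt_of_le_of_lt (mul_le_of_le_one_left (norm_nonneg _) hs.2) hh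
    have h2 := (ContinuousMap.dist_apply_le_dist t).trans (H h1).le
    rw [dist_eq_norm] at h2
    simpa using h2
  have := (convex_segment (u t) (u t + h t)).norm_image_sub_le_of_norm_hasFDerivWithin_le'
    (fun y _ => (hf y).hasFDerivWithinAt) key (left_mem_segment ℝ _ _) (right_mem_segment ℝ _ _)
  rw [add_sub_cancel_left] at this
  refine le_trans ?_ (this.trans (mul_le_mul_of_nonneg_left (h.norm_coe_le_norm t) hε.le))
  simp

/-- The derivative is again a postcomposition, by `fderiv ℝ f`, followed by a continuous linear map,
so induction applies. The target changes from `F` to `E →L[ℝ] F`; hence the spaces are quantified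
inside the induction and share one universe. -/
theorem contDiff_postcomp (K : Type*) [TopologicalSpace K] [CompactSpace K] (n : ℕ) :
    ∀ {E F : Type u} [NormedAddCommGroup E] [NormedSpace ℝ E] [NormedAddCommGroup F]
      [NormedSpace ℝ F] (f : C(E, F)), ContDiff ℝ n f →
      ContDiff ℝ n (fun u : C(K, E) => f.comp u) := by
  induction n with
  | zero =>
    intro E F _ _ _ _ f _
    exact contDiff_zero.2 (ContinuousMap.continuous_postcomp f)
  | succ n ih =>
    intro E F _ _ _ _ f hf
    push_cast at hf ⊢
    obtain ⟨h1, -, h2⟩ := contDiff_succ_iff_fderiv.1 hf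
    set f' : C(E, E →L[ℝ] F) := ⟨fderiv ℝ f, h2.continuous⟩
    have hd := hasFDerivAt_postcomp (K := K) f f' (fun x => (h1 x).hasFDerivAt)
    refine contDiff_succ_iff_fderiv.2 ⟨fun u => (hd u).differentiableAt, by simp, ?_⟩
    have : fderiv ℝ (fun u : C(K, E) => f.comp u)
        = fun u => pointwiseApply K E F (f'.comp u) := funext fun u => (hd u).fderiv
    rw [this]
    exact (pointwiseApply K E F).contDiff.comp (ih f' h2)

/-- Integration from `0`, as an operator on the continuous functions on the unit interval. -/
noncomputable def volterra (E : Type u) [NormedAddCommGroup E] [NormedSpace ℝ E]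
    [CompleteSpace E] : C(Icc (0 : ℝ) 1, E) →L[ℝ] C(Icc (0 : ℝ) 1, E) :=
  LinearMap.mkContinuous
    { toFun := fun u => ⟨fun t => ∫ s in (0 : ℝ)..t, IccExtend zero_le_one u s, by
        have : Continuous (IccExtend (zero_le_one (α := ℝ)) u) := u.continuous.Icc_extend'
        exact (intervalIntegral.continuous_primitive
          (fun a b => this.intervalIntegrable a b) 0).comp continuous_subtype_val⟩
      map_add' := fun u v => by
        ext t
        have hu : Continuous (IccExtend (zero_le_one (α := ℝ)) u) := u.continuous.Icc_extend'
        have hv : Continuous (IccExtend (zero_le_one (α := ℝ)) v) := v.continuous.Icc_extend'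
        simp only [ContinuousMap.coe_mk, ContinuousMap.add_apply]
        rw [← intervalIntegral.integral_add (hu.intervalIntegrable _ _)
          (hv.intervalIntegrable _ _)]
        rfl
      map_smul' := fun c u => by
        ext t
        simp only [ContinuousMap.coe_mk, ContinuousMap.smul_apply, RingHom.id_apply]
        rw [← intervalIntegral.integral_smul]
        rfl } 1
    (fun u => by
      rw [ContinuousMap.norm_le _ (by positivity)]
      intro t
      have := intervalIntegral.norm_integral_le_of_norm_le_const (a := 0) (b := (t : ℝ))
        (C := ‖u‖) (f := IccExtend (zero_le_one (α := ℝ)) u)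
        (fun s _ => u.norm_coe_le_norm _)
      refine this.trans ?_
      rw [one_mul, sub_zero, abs_of_nonneg t.2.1]
      exact mul_le_of_le_one_right (norm_nonneg _) t.2.2)

theorem volterra_apply {E : Type u} [NormedAddCommGroup E] [NormedSpace ℝ E]
    [CompleteSpace E] (u : C(Icc (0 : ℝ) 1, E)) (t : Icc (0 : ℝ) 1) :
    volterra E u t = ∫ s in (0 : ℝ)..t, IccExtend zero_le_one u s := rfl

/-- Each integration from `0` raises the power of `t` and divides by the new exponent, which
produces the factorial. -/
theorem norm_volterra_pow_apply_le {E : Type u} [NormedAddCommGroup E] [NormedSpace ℝ E]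
    [CompleteSpace E] (A : C(Icc (0 : ℝ) 1, E →L[ℝ] E)) (n : ℕ) (h : C(Icc (0 : ℝ) 1, E))
    (t : Icc (0 : ℝ) 1) :
    ‖((volterra E ∘L pointwiseApply _ E E A) ^ n) h t‖ ≤ (‖A‖ * t) ^ n / n.factorial * ‖h‖ := by
  induction n generalizing t with
  | zero => simpa using h.norm_coe_le_norm t
  | succ n ih =>
    rw [pow_succ']
    simp only [ContinuousLinearMap.mul_def, ContinuousLinearMap.comp_apply, volterra_apply]
    have hint : ∫ s in (0 : ℝ)..t, ‖A‖ * ((‖A‖ * s) ^ n / n.factorial * ‖h‖)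
        = (‖A‖ * t) ^ (n + 1) / (n + 1).factorial * ‖h‖ := by
      have : ∀ s : ℝ, ‖A‖ * ((‖A‖ * s) ^ n / n.factorial * ‖h‖)
          = (‖A‖ ^ (n + 1) / n.factorial * ‖h‖) * s ^ n := fun s => by ring
      simp_rw [this]
      rw [intervalIntegral.integral_const_mul, integral_pow, Nat.factorial_succ]
      push_cast
      field_simp
      ring
    rw [← hint]
    refine intervalIntegral.norm_integral_le_of_norm_le t.2.1 (ae_of_all _ fun s hs => ?_)
      (Continuous.intervalIntegrable (by fun_prop) _ _)
    have hs' : s ∈ Icc (0 : ℝ) 1 := ⟨hs.1.le, hs.2.trans t.2.2⟩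
    rw [IccExtend_of_mem _ _ hs', pointwiseApply_apply]
    exact ((A _).le_opNorm _).trans (mul_le_mul (A.norm_coe_le_norm _) (ih ⟨s, hs'⟩)
      (norm_nonneg _) (norm_nonneg A))

/-- The operator `B` need not be a contraction, but the factorial bound makes some power one. Then
`1 - B ^ n` is invertible, and `1 - B` is one of its commuting factors. -/
theorem isUnit_one_sub_volterra {E : Type u} [NormedAddCommGroup E] [NormedSpace ℝ E]
    [CompleteSpace E] (A : C(Icc (0 : ℝ) 1, E →L[ℝ] E)) :
    IsUnit (1 - volterra E ∘L pointwiseApply _ E E A) := by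
  set B := volterra E ∘L pointwiseApply _ E E A with hB
  have hlim := FloorSemiring.tendsto_pow_div_factorial_atTop ‖A‖
  obtain ⟨n, hn⟩ := (hlim.eventually (gt_mem_nhds (zero_lt_one (α := ℝ)))).exists
  have hn' : ‖B ^ n‖ < 1 := by
    refine lt_of_le_of_lt (ContinuousLinearMap.opNorm_le_bound _ (by positivity) fun h => ?_) hn
    rw [ContinuousMap.norm_le _ (by positivity)]
    intro t
    refine (norm_volterra_pow_apply_le A n h t).trans ?_
    gcongr
    · exact mul_nonneg (norm_nonneg A) t.2.1
    · exact mul_le_of_le_one_right (norm_nonneg A) t.2.2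
  have h1 : IsUnit (1 - B ^ n) := isUnit_one_sub_of_norm_lt_one
    (R := C(Icc (0 : ℝ) 1, E) →L[ℝ] C(Icc (0 : ℝ) 1, E)) hn'
  rw [← mul_neg_geom_sum B n] at h1
  refine ((Commute.isUnit_mul_iff ?_).1 h1).1
  show _ * _ = _ * _
  rw [mul_neg_geom_sum, geom_sum_mul_neg]

/-- Smooth dependence of the solution at time `1` of an autonomous differential equation on the
initial value. -/
theorem exists_contDiffAt_solution {E : Type u} [NormedAddCommGroup E] [NormedSpace ℝ E]
    [CompleteSpace E] {f : E → E} (hf : ContDiff ℝ ∞ f) {u₀ : ℝ → E}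
    (hu₀ : ∀ t ∈ Icc (0 : ℝ) 1, HasDerivWithinAt u₀ (f (u₀ t)) (Icc 0 1) t) :
    ∃ g : E → E, ContDiffAt ℝ ∞ g (u₀ 0) ∧ ∀ᶠ x in 𝓝 (u₀ 0), ∃ u : ℝ → E,
      u 0 = x ∧ u 1 = g x ∧
      ∀ t ∈ Icc (0 : ℝ) 1, HasDerivWithinAt u (f (u t)) (Icc 0 1) t := by
  let I := Icc (0 : ℝ) 1
  have hI0 : (0 : ℝ) ∈ Icc (0 : ℝ) 1 := ⟨le_rfl, zero_le_one⟩
  have hI1 : (1 : ℝ) ∈ Icc (0 : ℝ) 1 := ⟨zero_le_one, le_rfl⟩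
  let fc : C(E, E) := ⟨f, hf.continuous⟩
  let f' : C(E, E →L[ℝ] E) := ⟨fderiv ℝ f, hf.continuous_fderiv (by simp)⟩
  let U₀ : C(Icc (0 : ℝ) 1, E) :=
    ⟨fun t => u₀ t, (continuousOn_iff_continuous_domRestrict.1
      (fun t ht => (hu₀ t ht).continuousWithinAt))⟩
  -- The integral equation with initial value `x` reads `Ψ u = const x`. The derivative of `Ψ` is
  -- the identity minus a Volterra operator, hence invertible, so the local inverse of `Ψ` is the
  -- solution operator.
  let Ψ : C(Icc (0 : ℝ) 1, E) → C(Icc (0 : ℝ) 1, E) := fun u => u - volterra E (fc.comp u)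
  have hΨ : ContDiff ℝ ∞ Ψ :=
    contDiff_id.sub ((volterra E).contDiff.comp (contDiff_infty.2 fun n =>
      contDiff_postcomp _ n fc (contDiff_infty.1 hf n)))
  obtain ⟨L, hL⟩ := isUnit_one_sub_volterra (f'.comp U₀)
  let Le : C(Icc (0 : ℝ) 1, E) ≃L[ℝ] C(Icc (0 : ℝ) 1, E) := ContinuousLinearEquiv.ofUnit L
  have hd : HasFDerivAt Ψ (Le : C(Icc (0 : ℝ) 1, E) →L[ℝ] C(Icc (0 : ℝ) 1, E)) U₀ := by
    have h1 : (Le : C(Icc (0 : ℝ) 1, E) →L[ℝ] C(Icc (0 : ℝ) 1, E))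
        = 1 - volterra E ∘L pointwiseApply _ E E (f'.comp U₀) := hL
    rw [h1]
    exact (hasFDerivAt_id U₀).sub ((volterra E).hasFDerivAt.comp U₀
      (hasFDerivAt_postcomp fc f' (fun x => (hf.differentiable (by simp) x).hasFDerivAt) U₀))
  have hΨa : ContDiffAt ℝ ∞ Ψ U₀ := hΨ.contDiffAt
  let G := hΨa.localInverse hd (by simp)
  have hG : ContDiffAt ℝ ∞ G (Ψ U₀) := hΨa.to_localInverse hd (by simp)
  have hGr : ∀ᶠ y in 𝓝 (Ψ U₀), Ψ (G y) = y :=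
    (hΨa.hasStrictFDerivAt' hd (by simp)).eventually_right_inverse
  -- a solution of the integral equation solves the differential equation
  have hsol : ∀ (u : C(Icc (0 : ℝ) 1, E)) (x : E), Ψ u = ContinuousMap.const _ x →
      IccExtend zero_le_one u 0 = x ∧ ∀ t ∈ Icc (0 : ℝ) 1,
        HasDerivWithinAt (IccExtend zero_le_one u) (f (IccExtend zero_le_one u t)) (Icc 0 1) t := by
    intro u x hux
    have hcont : Continuous (IccExtend (zero_le_one (α := ℝ)) (fc.comp u)) :=
      (fc.comp u).continuous.Icc_extend'
    have hval : ∀ t ∈ Icc (0 : ℝ) 1, IccExtend zero_le_one u t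
        = x + ∫ s in (0 : ℝ)..t, IccExtend zero_le_one (fc.comp u) s := by
      intro t ht
      have := DFunLike.congr_fun hux ⟨t, ht⟩
      rw [IccExtend_of_mem _ _ ht]
      have h2 : u ⟨t, ht⟩ - volterra E (fc.comp u) ⟨t, ht⟩ = x := this
      rw [sub_eq_iff_eq_add, volterra_apply] at h2
      exact h2
    refine ⟨by simpa using hval 0 hI0, fun t ht => ?_⟩
    have h1 : HasDerivAt (fun t => x + ∫ s in (0 : ℝ)..t, IccExtend zero_le_one (fc.comp u) s)
        (IccExtend zero_le_one (fc.comp u) t) t :=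
      (intervalIntegral.integral_hasDerivAt_right (hcont.intervalIntegrable _ _)
        (hcont.stronglyMeasurableAtFilter _ _) hcont.continuousAt).const_add x
    exact h1.hasDerivWithinAt.congr hval (hval t ht)
  have hU₀ : Ψ U₀ = ContinuousMap.const _ (u₀ 0) := by
    ext t
    show u₀ t - ∫ s in (0 : ℝ)..t, IccExtend zero_le_one (fc.comp U₀) s = u₀ 0
    have hcont : Continuous (IccExtend (zero_le_one (α := ℝ)) (fc.comp U₀)) :=
      (fc.comp U₀).continuous.Icc_extend'
    have := intervalIntegral.integral_eq_sub_of_hasDeriv_right_of_le t.2.1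
      (f := u₀) (f' := IccExtend zero_le_one (fc.comp U₀))
      (fun s hs => ((hu₀ s ⟨hs.1, hs.2.trans t.2.2⟩).continuousWithinAt).mono
        (Icc_subset_Icc_right t.2.2))
      (fun s hs => by
        have hs' : s ∈ Icc (0 : ℝ) 1 := ⟨hs.1.le, hs.2.le.trans t.2.2⟩
        rw [IccExtend_of_mem _ _ hs']
        exact ((hu₀ s hs').hasDerivAt (Icc_mem_nhds hs.1 (hs.2.trans_le t.2.2))).hasDerivWithinAt)
      (hcont.intervalIntegrable _ _)
    rw [this]
    abel
  have hconst : ContDiff ℝ ∞ (fun x : E => ContinuousMap.const (Icc (0 : ℝ) 1) x) :=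
    (ContinuousLinearMap.const ℝ (Icc (0 : ℝ) 1) : E →L[ℝ] C(Icc (0 : ℝ) 1, E)).contDiff
  rw [hU₀] at hG hGr
  refine ⟨fun x => G (ContinuousMap.const _ x) ⟨1, hI1⟩, ?_, ?_⟩
  · exact ((ContinuousMap.evalCLM ℝ (⟨1, hI1⟩ : Icc (0 : ℝ) 1)).contDiff.contDiffAt).comp (u₀ 0)
      (hG.comp (u₀ 0) hconst.contDiffAt)
  · filter_upwards [hconst.continuous.continuousAt.eventually hGr] with x hx
    obtain ⟨h0, h1⟩ := hsol _ x hx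
    exact ⟨_, h0, IccExtend_of_mem _ _ hI1, h1⟩

/-- A `C^1` field need not be globally Lipschitz, but it is Lipschitz on a closed ball that contains
both compact trajectories, and there Grönwall uniqueness applies. -/
theorem eqOn_of_hasDerivWithinAt {E : Type*} [NormedAddCommGroup E] [NormedSpace ℝ E]
    [FiniteDimensional ℝ E] {f : E → E} (hf : ContDiff ℝ 1 f) {u v : ℝ → E} {T : ℝ}
    (hu : ∀ t ∈ Icc (0 : ℝ) T, HasDerivWithinAt u (f (u t)) (Icc 0 T) t)
    (hv : ∀ t ∈ Icc (0 : ℝ) T, HasDerivWithinAt v (f (v t)) (Icc 0 T) t)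
    (h0 : u 0 = v 0) : EqOn u v (Icc 0 T) := by
  have : ProperSpace E := FiniteDimensional.proper_real E
  have hcu : ContinuousOn u (Icc 0 T) := fun t ht => (hu t ht).continuousWithinAt
  have hcv : ContinuousOn v (Icc 0 T) := fun t ht => (hv t ht).continuousWithinAt
  obtain ⟨R, hR⟩ := ((isCompact_Icc.image_of_continuousOn hcu).union
    (isCompact_Icc.image_of_continuousOn hcv)).isBounded.subset_closedBall 0
  obtain ⟨C, hC⟩ := (isCompact_closedBall (0 : E) R).exists_bound_of_continuousOn
    (hf.continuous_fderiv one_ne_zero).norm.continuousOn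
  have hlip : LipschitzOnWith (Real.toNNReal C) f (Metric.closedBall 0 R) :=
    (convex_closedBall (0 : E) R).lipschitzOnWith_of_nnnorm_fderiv_le
      (fun x _ => hf.differentiable (by simp) x)
      (fun x hx => by
        rw [← NNReal.coe_le_coe, coe_nnnorm]
        have := hC x hx
        rw [norm_norm] at this
        exact this.trans (Real.le_coe_toNNReal C))
  have hw : ∀ {w : ℝ → E}, (∀ t ∈ Icc (0 : ℝ) T, HasDerivWithinAt w (f (w t)) (Icc 0 T) t) →
      ∀ t ∈ Ico (0 : ℝ) T, HasDerivWithinAt w (f (w t)) (Ici t) t := fun hw t ht =>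
    ((hw t ⟨ht.1, ht.2.le⟩).mono (Icc_subset_Icc_left ht.1)).mono_of_mem_nhdsWithin
      (Icc_mem_nhdsGE ht.2)
  exact ODE_solution_unique_of_mem_Icc_right (v := fun _ => f) (s := fun _ => Metric.closedBall 0 R)
    (fun _ _ => hlip) hcu (hw hu) (fun t ht => hR (Or.inl ⟨t, ⟨ht.1, ht.2.le⟩, rfl⟩))
    hcv (hw hv) (fun t ht => hR (Or.inr ⟨t, ⟨ht.1, ht.2.le⟩, rfl⟩)) h0

end SmoothDependence

/-- The inverse of an injective map of class `C^n` with invertible derivatives is `C^n`. -/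
theorem contDiffAt_leftInverse {E F : Type*} [NormedAddCommGroup E] [NormedSpace ℝ E]
    [CompleteSpace E] [NormedAddCommGroup F] [NormedSpace ℝ F] {n : WithTop ℕ∞} (hn : n ≠ 0)
    {f : E → F} {g : F → E} {U : Set E} (hU : IsOpen U) (hgf : ∀ x ∈ U, g (f x) = x) {x : E}
    (hx : x ∈ U) (hf : ContDiffAt ℝ n f x) {L : E ≃L[ℝ] F}
    (hL : HasFDerivAt f (L : E →L[ℝ] F) x) :
    ContDiffAt ℝ n g (f x) ∧ f '' U ∈ 𝓝 (f x) := by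
  have hr : ∀ᶠ y in 𝓝 (f x), f (hf.localInverse hL hn y) = y :=
    (hf.hasStrictFDerivAt' hL hn).eventually_right_inverse
  have hc := (hf.to_localInverse hL hn).continuousAt
  have hx' := hf.localInverse_apply_image hL hn
  have hm : ∀ᶠ y in 𝓝 (f x), hf.localInverse hL hn y ∈ U :=
    hc (by rw [hx']; exact hU.mem_nhds hx)
  refine ⟨(hf.to_localInverse hL hn).congr_of_eventuallyEq ?_, ?_⟩
  · filter_upwards [hr, hm] with y hy hyU
    rw [← hgf _ hyU, hy]
  · filter_upwards [hr, hm] with y hy hyU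
    exact ⟨_, hyU, hy⟩

/-! ### The geodesic equation of the conformal metric -/

section Geodesics

/-- The acceleration of a geodesic at the point `x` with velocity `v`. -/
noncomputable def geodesicAccel (N : ℂ → ℝ) (x v : ℂ) : ℂ :=
  (‖v‖ ^ 2 / N x) • gradient N x - (2 * (inner ℝ (gradient N x) v / N x)) • v

theorem covAccel_eq (N : ℂ → ℝ) (c : ℝ → ℂ) (t : ℝ) :
    covAccel N c t = deriv (deriv c) t - geodesicAccel N (c t) (deriv c t) := by
  rw [covAccel, geodesicAccel]; abel

/-- This quadratic homogeneity is what keeps the geodesic equation invariant under affine changes of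
time, reversal included. -/
theorem geodesicAccel_smul (N : ℂ → ℝ) (x v : ℂ) (a : ℝ) :
    geodesicAccel N x (a • v) = a ^ 2 • geodesicAccel N x v := by
  simp only [geodesicAccel, norm_smul, inner_smul_right, smul_sub, smul_smul, mul_pow,
    Real.norm_eq_abs, sq_abs]
  congr 2 <;> ring

/-- The geodesic vector field on the tangent bundle of the plane. -/
noncomputable def geodesicField (N : ℂ → ℝ) (p : ℂ × ℂ) : ℂ × ℂ := (p.2, geodesicAccel N p.1 p.2)

variable {N : ℂ → ℝ}

theorem contDiff_gradient (hN : ContDiff ℝ ∞ N) : ContDiff ℝ ∞ (gradient N) := by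
  have h : ContDiff ℝ ∞ (fderiv ℝ N) := hN.fderiv_right (by simp)
  exact ((InnerProductSpace.toDual ℝ ℂ).symm.toContinuousLinearEquiv.toContinuousLinearMap
    |>.contDiff).comp h

theorem contDiff_geodesicField (hN : ContDiff ℝ ∞ N) (hpos : ∀ x, 0 < N x) :
    ContDiff ℝ ∞ (geodesicField N) := by
  have hg : ContDiff ℝ ∞ fun p : ℂ × ℂ => gradient N p.1 := (contDiff_gradient hN).comp contDiff_fst
  have hN1 : ContDiff ℝ ∞ fun p : ℂ × ℂ => N p.1 := hN.comp contDiff_fst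
  have h0 : ∀ p : ℂ × ℂ, N p.1 ≠ 0 := fun p => (hpos _).ne'
  have h1 : ContDiff ℝ ∞ fun p : ℂ × ℂ => (‖p.2‖ ^ 2 / N p.1) • gradient N p.1 :=
    ((contDiff_snd.norm_sq ℝ).div hN1 h0).smul hg
  have h2 : ContDiff ℝ ∞ fun p : ℂ × ℂ => (2 * (inner ℝ (gradient N p.1) p.2 / N p.1)) • p.2 :=
    (contDiff_const.mul ((hg.inner ℝ contDiff_snd).div hN1 h0)).smul contDiff_snd
  exact contDiff_snd.prodMk (h1.sub h2)

theorem IsGeodesicOn.contDiffAt {c : ℝ → ℂ} {s : Set ℝ} (hc : IsGeodesicOn N c s) (hs : IsOpen s)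
    {t : ℝ} (ht : t ∈ s) : ContDiffAt ℝ 2 c t := hc.1.contDiffAt (hs.mem_nhds ht)

theorem IsGeodesicOn.hasDerivAt {c : ℝ → ℂ} {s : Set ℝ} (hc : IsGeodesicOn N c s) (hs : IsOpen s)
    {t : ℝ} (ht : t ∈ s) : HasDerivAt c (deriv c t) t :=
  ((hc.contDiffAt hs ht).differentiableAt two_ne_zero).hasDerivAt

theorem IsGeodesicOn.hasDerivAt_deriv {c : ℝ → ℂ} {s : Set ℝ} (hc : IsGeodesicOn N c s)
    (hs : IsOpen s) {t : ℝ} (ht : t ∈ s) :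
    HasDerivAt (deriv c) (geodesicAccel N (c t) (deriv c t)) t := by
  have h1 : ContDiffAt ℝ 1 (deriv c) t := (hc.contDiffAt hs ht).derivWithin (by norm_num)
  have h2 := (h1.differentiableAt one_ne_zero).hasDerivAt
  have h3 := hc.2 t ht
  rw [covAccel_eq, sub_eq_zero] at h3
  rwa [h3] at h2

/-- Affine reparametrizations of geodesics are geodesics. -/
theorem IsGeodesicOn.comp_affine {c : ℝ → ℂ} {s : Set ℝ} (hc : IsGeodesicOn N c s)
    (hs : IsOpen s) (a b : ℝ) :
    IsGeodesicOn N (fun t => c (a * t + b)) ((fun t => a * t + b) ⁻¹' s) ∧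
    ∀ t ∈ (fun t => a * t + b) ⁻¹' s,
      deriv (fun t => c (a * t + b)) t = a • deriv c (a * t + b) := by
  have hl : ∀ t : ℝ, HasDerivAt (fun t => a * t + b) a t := fun t => by
    simpa using ((hasDerivAt_id t).const_mul a).add_const b
  have hd : ∀ t ∈ (fun t => a * t + b) ⁻¹' s,
      deriv (fun t => c (a * t + b)) t = a • deriv c (a * t + b) := fun t ht =>
    ((hc.hasDerivAt hs ht).scomp t (hl t)).deriv
  have hs' : IsOpen ((fun t => a * t + b) ⁻¹' s) := hs.preimage (by fun_prop)
  refine ⟨⟨hc.1.comp (by fun_prop) fun t ht => ht, fun t ht => ?_⟩, hd⟩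
  have h2 : HasDerivAt (fun t => a • deriv c (a * t + b))
      (a • a • geodesicAccel N (c (a * t + b)) (deriv c (a * t + b))) t :=
    ((hc.hasDerivAt_deriv hs ht).scomp t (hl t)).const_smul a
  have h3 : deriv (fun t => c (a * t + b)) =ᶠ[𝓝 t] fun t => a • deriv c (a * t + b) := by
    filter_upwards [hs'.mem_nhds ht] with τ hτ using hd τ hτ
  rw [covAccel_eq, h3.deriv_eq, h2.deriv, hd t ht, geodesicAccel_smul, sq, smul_smul, sub_self]

/-- The rescaled state of a geodesic is an integral curve of the geodesic field. -/
theorem IsGeodesicOn.hasDerivAt_state {c : ℝ → ℂ} {s : Set ℝ} (hc : IsGeodesicOn N c s)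
    (hs : IsOpen s) (a : ℝ) {t : ℝ} (ht : a * t ∈ s) :
    HasDerivAt (fun t => (c (a * t), a • deriv c (a * t)))
      (geodesicField N (c (a * t), a • deriv c (a * t))) t := by
  have hl : HasDerivAt (fun t => a * t) a t := by simpa using (hasDerivAt_id t).const_mul a
  have h1 := (hc.hasDerivAt hs ht).scomp t hl
  have h2 := ((hc.hasDerivAt_deriv hs ht).scomp t hl).const_smul a
  convert! h1.prodMk h2 using 1
  rw [geodesicField, geodesicAccel_smul, sq, smul_smul]

/-- A geodesic has constant speed. -/
theorem IsGeodesicOn.speed_eq (hN : ContDiff ℝ ∞ N) (hpos : ∀ x, 0 < N x) {c : ℝ → ℂ} {s : Set ℝ}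
    (hc : IsGeodesicOn N c s) (hs : IsOpen s) {T : ℝ} (hT : Icc 0 T ⊆ s) {t : ℝ}
    (ht : t ∈ Icc 0 T) : N (c t) * ‖deriv c t‖ = N (c 0) * ‖deriv c 0‖ := by
  -- The squared speed is differentiated: the change of `N` along the curve cancels against the two
  -- terms of the acceleration.
  have hd : ∀ t ∈ s, HasDerivAt (fun t => N (c t) ^ 2 * ‖deriv c t‖ ^ 2) 0 t := by
    intro t ht
    have h1 : HasDerivAt (fun t => N (c t)) (inner ℝ (gradient N (c t)) (deriv c t)) t := by
      rw [inner_gradient_left]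
      exact (hN.differentiable (by simp) (c t)).hasFDerivAt.comp_hasDerivAt t (hc.hasDerivAt hs ht)
    have h2 := (hc.hasDerivAt_deriv hs ht).norm_sq
    convert! (h1.pow 2).mul h2 using 1
    have hne := (hpos (c t)).ne'
    rw [geodesicAccel, inner_sub_right, inner_smul_right, inner_smul_right,
      real_inner_self_eq_norm_sq, real_inner_comm (gradient N (c t))]
    simp only [Nat.cast_ofNat, Nat.add_one_sub_one, pow_one, Pi.pow_apply]
    field_simp
    ring
  have h := constant_of_has_deriv_right_zero
    (f := fun t => N (c t) ^ 2 * ‖deriv c t‖ ^ 2) (a := 0) (b := T)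
    (fun t ht => (hd t (hT ht)).continuousAt.continuousWithinAt)
    (fun t ht => (hd t (hT ⟨ht.1, ht.2.le⟩)).hasDerivWithinAt) t ht
  simp only [← mul_pow] at h
  exact (pow_left_inj₀ (mul_nonneg (hpos _).le (norm_nonneg _))
    (mul_nonneg (hpos _).le (norm_nonneg _)) two_ne_zero).1 h

end Geodesics

/-! ### The exponential map on a totally normal neighbourhood -/

section Exponential

/-- The data of a totally normal neighbourhood for a smooth positive index: the radius `δ` and the
exponential maps `e q`. -/
structure NormalData (N : ℂ → ℝ) (W : Set ℂ) (δ : ℝ) (e : ℂ → OpenPartialHomeomorph ℂ ℂ) :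
    Prop where
  smooth : ContDiff ℝ ∞ N
  pos : ∀ x, 0 < N x
  isOpen : IsOpen W
  radius_pos : 0 < δ
  source : ∀ q ∈ W, (e q).source = {v | N q * ‖v‖ < δ}
  exp : ∀ q ∈ W, ∀ v ∈ (e q).source, ExpMapsTo N q v (e q v)
  contDiffOn : ∀ q ∈ W, ContDiffOn ℝ ∞ (e q) (e q).source
  contDiffOn_symm : ∀ q ∈ W, ContDiffOn ℝ ∞ (e q).symm (e q).target
  subset : ∀ q ∈ W, W ⊆ (e q).target

theorem IsTotallyNormal.exists_normalData {N : ℂ → ℝ} (hN : ContDiff ℝ ∞ N) (hpos : ∀ x, 0 < N x)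
    {W : Set ℂ} (hW : IsTotallyNormal N W) : ∃ δ e, NormalData N W δ e := by
  have : Nonempty (OpenPartialHomeomorph ℂ ℂ) := ⟨OpenPartialHomeomorph.refl ℂ⟩
  obtain ⟨hW, δ, hδ, H⟩ := hW
  choose! e he using H
  exact ⟨δ, e, hN, hpos, hW, hδ, fun q hq => (he q hq).1, fun q hq => (he q hq).2.1,
    fun q hq => (he q hq).2.2.1, fun q hq => (he q hq).2.2.2.1, fun q hq => (he q hq).2.2.2.2⟩

variable {N : ℂ → ℝ} {W : Set ℂ} {δ : ℝ} {e : ℂ → OpenPartialHomeomorph ℂ ℂ}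

namespace NormalData

theorem mem_source (H : NormalData N W δ e) {q v : ℂ} (hq : q ∈ W) :
    v ∈ (e q).source ↔ N q * ‖v‖ < δ := by rw [H.source q hq]; rfl

theorem smul_mem_source (H : NormalData N W δ e) {q v : ℂ} (hq : q ∈ W) (hv : v ∈ (e q).source)
    {t : ℝ} (ht : t ∈ Icc (0 : ℝ) 1) : t • v ∈ (e q).source := by
  rw [H.mem_source hq] at hv ⊢
  rw [norm_smul, Real.norm_of_nonneg ht.1, mul_left_comm]
  exact (mul_le_of_le_one_left (mul_nonneg (H.pos q).le (norm_nonneg _)) ht.2).trans_lt hv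

/-- Geodesics issued from a point of the neighbourhood are images of rays. -/
theorem exp_smul (H : NormalData N W δ e) {q u : ℂ} (hq : q ∈ W) {η : ℝ → ℂ} {s : Set ℝ}
    (hs : IsOpen s) (hη : IsGeodesicOn N η s) (h0 : η 0 = q) (h1 : deriv η 0 = u) {t : ℝ}
    (ht0 : 0 ≤ t) (hts : Icc 0 t ⊆ s) (ht : t • u ∈ (e q).source) : e q (t • u) = η t := by
  obtain ⟨c, r, hr, hIr, hc, hc0, hc1, hc2⟩ := H.exp q hq _ ht
  have hf := (contDiff_geodesicField H.smooth H.pos).of_le (m := 1) (by simp)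
  -- After rescaling `η` by `t`, both geodesics have initial velocity `t • u` and are compared at
  -- time `1`. The factor `1` in the first curve only serves to share the state lemma.
  have key := eqOn_of_hasDerivWithinAt (T := 1) hf
    (u := fun τ => (c (1 * τ), (1 : ℝ) • deriv c (1 * τ)))
    (v := fun τ => (η (t * τ), t • deriv η (t * τ)))
    (fun τ hτ => (hc.hasDerivAt_state hr 1 (by rw [one_mul]; exact hIr hτ)).hasDerivWithinAt)
    (fun τ hτ => (hη.hasDerivAt_state hs t (hts ⟨mul_nonneg ht0 hτ.1,
      mul_le_of_le_one_right ht0 hτ.2⟩)).hasDerivWithinAt)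
    (by simp [hc0, hc1, h0, h1])
  have := congrArg Prod.fst (key (right_mem_Icc.2 zero_le_one))
  simpa [hc2] using this

theorem hasFDerivAt (H : NormalData N W δ e) {q v : ℂ} (hq : q ∈ W) (hv : v ∈ (e q).source) :
    HasFDerivAt (e q) (fderiv ℝ (e q) v) v :=
  (((H.contDiffOn q hq).contDiffAt ((e q).open_source.mem_nhds hv)).differentiableAt
    (by simp)).hasFDerivAt

/-- The velocity of a geodesic in terms of the derivative of the exponential map. -/
theorem deriv_eq (H : NormalData N W δ e) {q u : ℂ} (hq : q ∈ W) {η : ℝ → ℂ} {s : Set ℝ}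
    (hs : IsOpen s) (hη : IsGeodesicOn N η s) (h0 : η 0 = q) (h1 : deriv η 0 = u) {T t : ℝ}
    (hT : 0 < T) (hts : Icc 0 T ⊆ s) (hTu : T • u ∈ (e q).source) (ht : t ∈ Icc 0 T) :
    deriv η t = fderiv ℝ (e q) (t • u) u := by
  have hsrc : ∀ τ ∈ Icc 0 T, τ • u ∈ (e q).source := by
    intro τ hτ
    have := H.smul_mem_source hq hTu (t := τ / T) ⟨div_nonneg hτ.1 hT.le, (div_le_one hT).2 hτ.2⟩
    rwa [smul_smul, div_mul_cancel₀ _ hT.ne'] at this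
  have h2 : HasDerivWithinAt (fun τ : ℝ => e q (τ • u)) (fderiv ℝ (e q) (t • u) u) (Icc 0 T) t := by
    have := (H.hasFDerivAt hq (hsrc t ht)).comp_hasDerivAt t ((hasDerivAt_id t).smul_const u)
    rw [one_smul] at this
    exact this.hasDerivWithinAt
  have h3 : HasDerivWithinAt η (fderiv ℝ (e q) (t • u) u) (Icc 0 T) t :=
    h2.congr (fun τ hτ => (H.exp_smul hq hs hη h0 h1 hτ.1
      ((Icc_subset_Icc_right hτ.2).trans hts) (hsrc τ hτ)).symm)
      (H.exp_smul hq hs hη h0 h1 ht.1 ((Icc_subset_Icc_right ht.2).trans hts) (hsrc t ht)).symm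
  exact UniqueDiffWithinAt.eq_deriv _ (uniqueDiffOn_Icc hT t ht)
    (hη.hasDerivAt hs (hts ht)).hasDerivWithinAt h3

/-- For a vector in the domain of the exponential map there is a geodesic with that initial
velocity, and it is the image of a ray. -/
theorem exists_geodesic (H : NormalData N W δ e) {q v : ℂ} (hq : q ∈ W) (hv : v ∈ (e q).source) :
    ∃ (c : ℝ → ℂ) (s : Set ℝ), IsOpen s ∧ Icc 0 1 ⊆ s ∧ IsGeodesicOn N c s ∧ c 0 = q ∧
      deriv c 0 = v ∧ (∀ t ∈ Icc (0 : ℝ) 1, c t = e q (t • v)) ∧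
      ∀ t ∈ Icc (0 : ℝ) 1, deriv c t = fderiv ℝ (e q) (t • v) v := by
  obtain ⟨c, s, hs, hI, hc, h0, h1, -⟩ := H.exp q hq v hv
  refine ⟨c, s, hs, hI, hc, h0, h1, fun t ht => ?_, fun t ht => ?_⟩
  · exact (H.exp_smul hq hs hc h0 h1 ht.1 ((Icc_subset_Icc_right ht.2).trans hI)
      (H.smul_mem_source hq hv ht)).symm
  · exact H.deriv_eq hq hs hc h0 h1 one_pos hI (by rwa [one_smul]) ht

theorem zero_mem_source (H : NormalData N W δ e) {q : ℂ} (hq : q ∈ W) : (0 : ℂ) ∈ (e q).source := by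
  rw [H.mem_source hq]; simpa using H.radius_pos

theorem exp_zero (H : NormalData N W δ e) {q : ℂ} (hq : q ∈ W) : e q 0 = q := by
  obtain ⟨c, s, -, -, -, h0, -, h, -⟩ := H.exists_geodesic hq (H.zero_mem_source hq)
  have := h 0 (left_mem_Icc.2 zero_le_one)
  rw [h0] at this
  simpa using this.symm

/-- The initial velocity of a geodesic is computed in two ways. An arbitrary vector is first scaled
into the source, and the scalar is cancelled at the end. -/
theorem fderiv_exp_zero (H : NormalData N W δ e) {q : ℂ} (hq : q ∈ W) :
    fderiv ℝ (e q) 0 = ContinuousLinearMap.id ℝ ℂ := by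
  ext1 u
  obtain ⟨r, hr, hru⟩ : ∃ r : ℝ, 0 < r ∧ r • u ∈ (e q).source := by
    have h : ContinuousAt (fun r : ℝ => r • u) 0 := by fun_prop
    have h2 : ∀ᶠ r : ℝ in 𝓝 0, r • u ∈ (e q).source :=
      h ((e q).open_source.mem_nhds (by simpa using H.zero_mem_source hq))
    obtain ⟨r, h3, h4⟩ :=
      ((h2.filter_mono nhdsWithin_le_nhds).and (self_mem_nhdsWithin (s := Ioi 0))).exists
    exact ⟨r, h4, h3⟩
  obtain ⟨c, s, -, -, -, -, h1, -, h⟩ := H.exists_geodesic hq hru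
  have := h 0 (left_mem_Icc.2 zero_le_one)
  rw [h1, zero_smul, map_smul] at this
  exact (smul_right_injective ℂ hr.ne' this).symm

theorem speed_exp (H : NormalData N W δ e) {q v : ℂ} (hq : q ∈ W) (hv : v ∈ (e q).source)
    {t : ℝ} (ht : t ∈ Icc (0 : ℝ) 1) :
    N (e q (t • v)) * ‖fderiv ℝ (e q) (t • v) v‖ = N q * ‖v‖ := by
  obtain ⟨c, s, hs, hI, hc, h0, h1, h2, h3⟩ := H.exists_geodesic hq hv
  rw [← h2 t ht, ← h3 t ht, hc.speed_eq H.smooth H.pos hs hI ht, h0, h1]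

theorem injective_fderiv (H : NormalData N W δ e) {q v : ℂ} (hq : q ∈ W)
    (hv : v ∈ (e q).source) : Function.Injective (fderiv ℝ (e q) v) := by
  have h1 : HasFDerivAt (e q).symm (fderiv ℝ (e q).symm (e q v)) (e q v) :=
    (((H.contDiffOn_symm q hq).contDiffAt ((e q).open_target.mem_nhds
      ((e q).map_source hv))).differentiableAt (by simp)).hasFDerivAt
  have h2 := h1.comp v (H.hasFDerivAt hq hv)
  have h3 : ((e q).symm ∘ e q) =ᶠ[𝓝 v] id := by
    filter_upwards [(e q).open_source.mem_nhds hv] with x hx using (e q).left_inv hx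
  have h4 := (h2.congr_of_eventuallyEq h3.symm).unique (hasFDerivAt_id v)
  exact Function.LeftInverse.injective fun x => DFunLike.congr_fun h4 x

/-- The exponential maps preserve the orientation. -/
theorem det_fderiv_pos (H : NormalData N W δ e) {q v : ℂ} (hq : q ∈ W) (hv : v ∈ (e q).source) :
    0 < (fderiv ℝ (e q) v).det := by
  have hne : ∀ w ∈ (e q).source, (fderiv ℝ (e q) w).det ≠ 0 := fun w hw h =>
    (LinearMap.bot_lt_ker_of_det_eq_zero (f := (fderiv ℝ (e q) w : ℂ →ₗ[ℝ] ℂ)) h).ne'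
      (LinearMap.ker_eq_bot.2 (H.injective_fderiv hq hw))
  have hpre : IsPreconnected (Icc (0 : ℝ) 1) := isPreconnected_Icc
  by_contra hle
  rw [not_lt] at hle
  -- Along the ray to `v` the determinant is continuous, never zero, and equal to `1` at the origin,
  -- so it cannot become negative.
  have hc : ContinuousOn (fun t : ℝ => (fderiv ℝ (e q) (t • v)).det) (Icc 0 1) := by
    refine ContinuousLinearMap.continuous_det.comp_continuousOn ?_
    refine ((H.contDiffOn q hq).continuousOn_fderiv_of_isOpen (e q).open_source (by simp)).comp
      (by fun_prop) fun t ht => H.smul_mem_source hq hv ht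
  obtain ⟨t, ht, h0⟩ := hpre.intermediate_value (right_mem_Icc.2 zero_le_one)
    (left_mem_Icc.2 zero_le_one) hc
    ⟨by simpa using hle, by simp [H.fderiv_exp_zero hq, ContinuousLinearMap.det]⟩
  exact hne _ (H.smul_mem_source hq hv ht) h0

theorem isOpen_domain (H : NormalData N W δ e) :
    IsOpen {p : ℂ × ℂ | p.1 ∈ W ∧ N p.1 * ‖p.2‖ < δ} := by
  have hc := H.smooth.continuous
  exact (H.isOpen.preimage continuous_fst).inter
    (isOpen_lt (f := fun p : ℂ × ℂ => N p.1 * ‖p.2‖) (by fun_prop) continuous_const)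

/-- The exponential map is smooth as a function of the point and the vector. -/
theorem contDiffAt_exp (H : NormalData N W δ e) {q v : ℂ} (hq : q ∈ W) (hv : v ∈ (e q).source) :
    ContDiffAt ℝ ∞ (fun p : ℂ × ℂ => e p.1 p.2) (q, v) := by
  obtain ⟨c, s, hs, hI, hc, h0, h1, -⟩ := H.exp q hq v hv
  have hf := contDiff_geodesicField H.smooth H.pos
  have hst : ∀ {c : ℝ → ℂ} {s : Set ℝ}, IsOpen s → Icc 0 1 ⊆ s → IsGeodesicOn N c s →
      ∀ t ∈ Icc (0 : ℝ) 1, HasDerivWithinAt (fun t => (c (1 * t), (1 : ℝ) • deriv c (1 * t)))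
        (geodesicField N (c (1 * t), (1 : ℝ) • deriv c (1 * t))) (Icc 0 1) t :=
    fun hs hI hc t ht =>
      (hc.hasDerivAt_state hs 1 (by rw [one_mul]; exact hI ht)).hasDerivWithinAt
  -- The smooth time-one map is local and abstract. Uniqueness of solutions identifies its position
  -- component with the given exponential maps at all nearby base points.
  obtain ⟨g, hg, hg'⟩ := exists_contDiffAt_solution hf (hst hs hI hc)
  simp only [mul_zero, one_smul, h0, h1] at hg hg'
  refine (contDiffAt_fst.comp _ hg).congr_of_eventuallyEq ?_
  filter_upwards [hg', H.isOpen_domain.mem_nhds (show (q, v) ∈ {p : ℂ × ℂ | _} from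
    ⟨hq, (H.mem_source hq).1 hv⟩)] with p ⟨u, hu0, hu1, hu⟩ ⟨hpW, hps⟩
  obtain ⟨c', s', hs', hI', hc', h0', h1', h2'⟩ := H.exp p.1 hpW p.2 ((H.mem_source hpW).2 hps)
  have key := eqOn_of_hasDerivWithinAt (T := 1) (hf.of_le (by simp)) hu (hst hs' hI' hc')
    (by simp [hu0, h0', h1']) (right_mem_Icc.2 zero_le_one)
  simp only [hu1, mul_one, h2'] at key
  simp [key]

end NormalData

theorem exists_equiv_of_injective {E : Type*} [NormedAddCommGroup E] [NormedSpace ℝ E]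
    [FiniteDimensional ℝ E] {L : E →L[ℝ] E} (hL : Function.Injective L) :
    ∃ L' : E ≃L[ℝ] E, (L' : E →L[ℝ] E) = L :=
  ⟨(LinearEquiv.ofInjectiveEndo (L : E →ₗ[ℝ] E) hL).toContinuousLinearEquiv, by ext x; rfl⟩

namespace NormalData

/-- The partial derivative of the exponential map with respect to the vector. -/
theorem fderiv_exp_snd (H : NormalData N W δ e) {q v : ℂ} (hq : q ∈ W) (hv : v ∈ (e q).source)
    (b : ℂ) : fderiv ℝ (fun p : ℂ × ℂ => e p.1 p.2) (q, v) (0, b) = fderiv ℝ (e q) v b := by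
  have h1 := ((H.contDiffAt_exp hq hv).differentiableAt (by simp)).hasFDerivAt
  have h2 : HasFDerivAt (fun v : ℂ => (q, v)) (ContinuousLinearMap.inr ℝ ℂ ℂ) v :=
    hasFDerivAt_prodMk_right q v
  have h3 := (h1.comp v h2).unique (H.hasFDerivAt hq hv)
  exact DFunLike.congr_fun h3 b

/-- Each `(e q).symm` is smooth separately. Joint smoothness comes from inverting `(q, v) ↦ (q,
exp_q v)`, whose derivative is block triangular with injective diagonal blocks. -/
theorem contDiffAt_log (H : NormalData N W δ e) {q p : ℂ} (hq : q ∈ W) (hp : p ∈ W) :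
    ContDiffAt ℝ ∞ (fun z : ℂ × ℂ => (e z.1).symm z.2) (q, p) := by
  have hpt := H.subset q hq hp
  set v := (e q).symm p with hv
  have hvs : v ∈ (e q).source := (e q).map_target hpt
  have hev : e q v = p := (e q).right_inv hpt
  have hX := H.contDiffAt_exp hq hvs
  have hd : HasFDerivAt (fun z : ℂ × ℂ => (z.1, e z.1 z.2))
      ((ContinuousLinearMap.fst ℝ ℂ ℂ).prod (fderiv ℝ (fun z : ℂ × ℂ => e z.1 z.2) (q, v)))
      (q, v) := hasFDerivAt_fst.prodMk (hX.differentiableAt (by simp)).hasFDerivAt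
  obtain ⟨L, hL⟩ := exists_equiv_of_injective (L := (ContinuousLinearMap.fst ℝ ℂ ℂ).prod
    (fderiv ℝ (fun z : ℂ × ℂ => e z.1 z.2) (q, v))) (by
      rw [injective_iff_map_eq_zero]
      rintro ⟨a, b⟩ hab
      simp only [ContinuousLinearMap.prod_apply, ContinuousLinearMap.coe_fst', Prod.mk_eq_zero] at hab
      obtain ⟨rfl, hab⟩ := hab
      rw [H.fderiv_exp_snd hq hvs] at hab
      rw [(injective_iff_map_eq_zero _).1 (H.injective_fderiv hq hvs) b hab]
      rfl)
  rw [← hL] at hd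
  have := (contDiffAt_leftInverse (n := ∞) (by simp) H.isOpen_domain
    (f := fun z : ℂ × ℂ => (z.1, e z.1 z.2)) (g := fun z : ℂ × ℂ => (z.1, (e z.1).symm z.2))
    (fun z hz => Prod.ext rfl ((e z.1).left_inv ((H.mem_source hz.1).2 hz.2)))
    (x := (q, v)) ⟨hq, (H.mem_source hq).1 hvs⟩ (contDiffAt_fst.prodMk hX) hd).1
  simp only [hev] at this
  exact contDiffAt_snd.comp _ this

end NormalData

end Exponential

/-! ### The first variation formula -/

section FirstVariation

variable {N : ℂ → ℝ} {W : Set ℂ} {δ : ℝ} {e : ℂ → OpenPartialHomeomorph ℂ ℂ}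

/-- The first variation formula: the exponential map pulls the canonical one-form back to itself,
up to the differential of the energy. -/
theorem NormalData.first_variation (H : NormalData N W δ e) {q v : ℂ} (hq : q ∈ W)
    (hv : v ∈ (e q).source) (a b : ℂ) :
    N (e q v) ^ 2 * inner ℝ (fderiv ℝ (fun z : ℂ × ℂ => e z.1 z.2) (q, v) (a, b))
        (fderiv ℝ (e q) v v) - N q ^ 2 * inner ℝ a v
      = 1 / 2 * fderiv ℝ (fun z : ℂ × ℂ => N z.1 ^ 2 * ‖z.2‖ ^ 2) (q, v) (a, b) := by
  set X : ℂ × ℂ → ℂ := fun z => e z.1 z.2 with hX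
  set E : ℂ × ℂ → ℝ := fun z => N z.1 ^ 2 * ‖z.2‖ ^ 2 with hE
  -- `C (s, t)` is a variation through geodesics: `s` moves the initial state in the direction `(a,
  -- b)`, and `t` is time along the geodesic.
  set m : ℝ × ℝ → ℂ × ℂ := fun p => (q + p.1 • a, p.2 • (v + p.1 • b)) with hm
  set C : ℝ × ℝ → ℂ := fun p => X (m p) with hC
  have hmd : ContDiff ℝ ∞ m := by fun_prop
  have hm0 : ∀ t : ℝ, m (0, t) = (q, t • v) := fun t => by simp [hm]
  have hCd : ∀ t ∈ Icc (0 : ℝ) 1, ContDiffAt ℝ ∞ C (0, t) := fun t ht =>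
    ContDiffAt.comp (g := X) (0, t) (by rw [hm0]; exact H.contDiffAt_exp hq (H.smul_mem_source hq hv ht))
      hmd.contDiffAt
  -- the velocity of the variation
  have hCt : ∀ p : ℝ × ℝ, q + p.1 • a ∈ W → p.2 • (v + p.1 • b) ∈ (e (q + p.1 • a)).source →
      fderiv ℝ C p (0, 1) = fderiv ℝ (e (q + p.1 • a)) (p.2 • (v + p.1 • b)) (v + p.1 • b) := by
    intro p hpW hps
    have h1 : HasDerivAt (fun t : ℝ => m (p.1, t)) (0, v + p.1 • b) p.2 :=
      (hasDerivAt_const p.2 (q + p.1 • a)).prodMk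
        (by simpa only [one_smul, id] using (hasDerivAt_id p.2).smul_const (v + p.1 • b))
    have h2 : HasFDerivAt X (fderiv ℝ X (m p)) (m p) :=
      ((H.contDiffAt_exp hpW hps).differentiableAt (by simp)).hasFDerivAt
    have h3 := h2.comp_hasDerivAt (f := fun t : ℝ => m (p.1, t)) p.2 h1
    rw [hX, hm, H.fderiv_exp_snd hpW hps] at h3
    have h4 : DifferentiableAt ℝ C p :=
      DifferentiableAt.comp p h2.differentiableAt (hmd.differentiable (by simp) p)
    have h5 : HasDerivAt (fun t : ℝ => (p.1, t)) ((0 : ℝ), (1 : ℝ)) p.2 :=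
      (hasDerivAt_const _ _).prodMk (hasDerivAt_id _)
    exact (h4.hasFDerivAt.comp_hasDerivAt p.2 h5).unique h3
  have hCs : ∀ t ∈ Icc (0 : ℝ) 1, fderiv ℝ C (0, t) (1, 0) = fderiv ℝ X (q, t • v) (a, t • b) := by
    intro t ht
    have h1 : HasDerivAt (fun s : ℝ => m (s, t)) (a, t • b) 0 := by
      refine HasDerivAt.prodMk ?_ ?_
      · simpa using ((hasDerivAt_id (0 : ℝ)).smul_const a).const_add q
      · have := (((hasDerivAt_id (0 : ℝ)).smul_const b).const_add v).const_smul t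
        rw [one_smul] at this
        exact this
    have h2 : HasFDerivAt X (fderiv ℝ X (q, t • v)) (m (0, t)) := by
      rw [hm0]
      exact ((H.contDiffAt_exp hq (H.smul_mem_source hq hv ht)).differentiableAt
        (by simp)).hasFDerivAt
    have h3 := h2.comp_hasDerivAt (f := fun s : ℝ => m (s, t)) 0 h1
    have h4 := ((hCd t ht).differentiableAt (by simp)).hasFDerivAt
    have h5 : HasDerivAt (fun s : ℝ => (s, t)) ((1 : ℝ), (0 : ℝ)) 0 :=
      (hasDerivAt_id _).prodMk (hasDerivAt_const _ _)
    exact (h4.comp_hasDerivAt (f := fun s : ℝ => (s, t)) 0 h5).unique h3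
  obtain ⟨c, r, hr, hI, hc, hc0, hc1, hce, hcd⟩ := H.exists_geodesic hq hv
  have hC0 : ∀ t ∈ Icc (0 : ℝ) 1, C (0, t) = c t := fun t ht => by
    rw [hC, hce t ht]; simp only [hm0, hX]
  have hCt0 : ∀ t ∈ Icc (0 : ℝ) 1, fderiv ℝ C (0, t) (0, 1) = deriv c t := fun t ht => by
    have := hCt (0, t) (by simpa using hq) (by simpa using H.smul_mem_source hq hv ht)
    simpa [hcd t ht] using this
  have hND : ∀ x, HasFDerivAt N (fderiv ℝ N x) x := fun x =>
    (H.smooth.differentiable (by simp) x).hasFDerivAt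
  have hEd : HasFDerivAt E (fderiv ℝ E (q, v)) (q, v) := by
    have : ContDiff ℝ ∞ E :=
      ((H.smooth.comp contDiff_fst).pow 2).mul (contDiff_snd.norm_sq ℝ)
    exact (this.differentiable (by simp) _).hasFDerivAt
  -- differentiation of the energy with respect to the parameter of the variation
  have hen : ∀ t ∈ Icc (0 : ℝ) 1,
      2 * N (c t) * inner ℝ (gradient N (c t)) (fderiv ℝ C (0, t) (1, 0)) * ‖deriv c t‖ ^ 2
        + N (c t) ^ 2 * (2 * inner ℝ (deriv c t)
          (fderiv ℝ (fderiv ℝ C) (0, t) (0, 1) (1, 0))) = fderiv ℝ E (q, v) (a, b) := by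
    intro t ht
    have h5 : HasDerivAt (fun s : ℝ => (s, t)) ((1 : ℝ), (0 : ℝ)) 0 :=
      (hasDerivAt_id _).prodMk (hasDerivAt_const _ _)
    have h4 := ((hCd t ht).differentiableAt (by simp)).hasFDerivAt
    have h6 : HasDerivAt (fun s : ℝ => C (s, t)) (fderiv ℝ C (0, t) (1, 0)) 0 :=
      h4.comp_hasDerivAt (f := fun s : ℝ => (s, t)) 0 h5
    have h7 : HasDerivAt (fun s : ℝ => N (C (s, t)))
        (fderiv ℝ N (C (0, t)) (fderiv ℝ C (0, t) (1, 0))) 0 := (hND _).comp_hasDerivAt 0 h6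
    have h8 : HasFDerivAt (fderiv ℝ C) (fderiv ℝ (fderiv ℝ C) (0, t)) (0, t) :=
      (((hCd t ht).fderiv_right (m := ∞) (by simp)).differentiableAt (by simp)).hasFDerivAt
    have h9 : HasDerivAt (fun s : ℝ => fderiv ℝ C (s, t) (0, 1))
        (fderiv ℝ (fderiv ℝ C) (0, t) (1, 0) (0, 1)) 0 := by
      have := (h8.comp_hasDerivAt (f := fun s : ℝ => (s, t)) 0 h5).clm_apply
        (hasDerivAt_const (0 : ℝ) ((0 : ℝ), (1 : ℝ)))
      simpa using this
    have h10 := (h7.pow 2).mul h9.norm_sq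
    have h11 : HasDerivAt (fun s : ℝ => E (q + s • a, v + s • b)) (fderiv ℝ E (q, v) (a, b)) 0 := by
      refine HasFDerivAt.comp_hasDerivAt (f := fun s : ℝ => (q + s • a, v + s • b)) 0
        (by simpa using hEd) (HasDerivAt.prodMk ?_ ?_)
      · simpa using ((hasDerivAt_id (0 : ℝ)).smul_const a).const_add q
      · simpa using ((hasDerivAt_id (0 : ℝ)).smul_const b).const_add v
    have h12 : ∀ᶠ s : ℝ in 𝓝 0, q + s • a ∈ W ∧ N (q + s • a) * ‖v + s • b‖ < δ := by
      have : ContinuousAt (fun s : ℝ => (q + s • a, v + s • b)) 0 := by fun_prop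
      exact this.eventually (H.isOpen_domain.mem_nhds (by
        simpa using ⟨hq, (H.mem_source hq).1 hv⟩))
    -- For small `s` the curve `t ↦ C (s, t)` has constant speed, so its energy at time `t` is the
    -- initial energy `E (q + s • a, v + s • b)`.
    have h13 := h11.congr_of_eventuallyEq (f₁ := fun s : ℝ =>
      N (C (s, t)) ^ 2 * ‖fderiv ℝ C (s, t) (0, 1)‖ ^ 2) (by
        filter_upwards [h12] with s ⟨hs1, hs2⟩
        have hs3 := (H.mem_source hs1).2 hs2
        rw [hCt (s, t) hs1 (H.smul_mem_source hs1 hs3 ht), ← mul_pow, hE]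
        simp only [← mul_pow]
        rw [← H.speed_exp hs1 hs3 ht])
    have h14 := h10.unique h13
    -- Equality of mixed derivatives replaces the variation of the velocity by the time derivative
    -- of the variation field, the term that appears in the integration along `t`.
    have hsymm : fderiv ℝ (fderiv ℝ C) (0, t) (1, 0) (0, 1)
        = fderiv ℝ (fderiv ℝ C) (0, t) (0, 1) (1, 0) :=
      (hCd t ht).isSymmSndFDerivAt (by
        rw [minSmoothness_of_isRCLikeNormedField]; exact WithTop.coe_le_coe.2 (le_top : (2 : ℕ∞) ≤ ⊤)) _ _
    rw [← h14, hsymm, inner_gradient_left]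
    simp only [hC0 t ht, hCt0 t ht, Pi.pow_apply]
    ring
  -- integration along the geodesic
  have hh : ∀ t ∈ Icc (0 : ℝ) 1, HasDerivAt (fun t => N (c t) ^ 2 *
      inner ℝ (fderiv ℝ C (0, t) (1, 0)) (deriv c t) - t * (1 / 2 * fderiv ℝ E (q, v) (a, b)))
      0 t := by
    intro t ht
    have h5 : HasDerivAt (fun t : ℝ => ((0 : ℝ), t)) ((0 : ℝ), (1 : ℝ)) t :=
      (hasDerivAt_const _ _).prodMk (hasDerivAt_id _)
    have h7 : HasDerivAt (fun t => N (c t)) (inner ℝ (gradient N (c t)) (deriv c t)) t := by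
      rw [inner_gradient_left]
      exact (hND _).comp_hasDerivAt t (hc.hasDerivAt hr (hI ht))
    have h8 : HasFDerivAt (fderiv ℝ C) (fderiv ℝ (fderiv ℝ C) (0, t)) (0, t) :=
      (((hCd t ht).fderiv_right (m := ∞) (by simp)).differentiableAt (by simp)).hasFDerivAt
    have h9 : HasDerivAt (fun t : ℝ => fderiv ℝ C (0, t) (1, 0))
        (fderiv ℝ (fderiv ℝ C) (0, t) (0, 1) (1, 0)) t := by
      have := (h8.comp_hasDerivAt (f := fun t : ℝ => ((0 : ℝ), t)) t h5).clm_apply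
        (hasDerivAt_const t ((1 : ℝ), (0 : ℝ)))
      simpa using this
    have h10 := ((h7.pow 2).mul (h9.inner ℝ (hc.hasDerivAt_deriv hr (hI ht)))).sub
      ((hasDerivAt_id t).mul_const (1 / 2 * fderiv ℝ E (q, v) (a, b)))
    convert! h10 using 1
    have hne := (H.pos (c t)).ne'
    rw [← hen t ht, geodesicAccel, inner_sub_right, inner_smul_right, inner_smul_right,
      real_inner_comm (gradient N (c t)) (fderiv ℝ C (0, t) (1, 0)),
      real_inner_comm (deriv c t) (fderiv ℝ (fderiv ℝ C) (0, t) (0, 1) (1, 0))]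
    simp only [Nat.cast_ofNat, Nat.add_one_sub_one, pow_one, Pi.pow_apply]
    field_simp
    ring
  have hfin := constant_of_has_deriv_right_zero
    (fun t ht => (hh t ht).continuousAt.continuousWithinAt)
    (fun t ht => (hh t ⟨ht.1, ht.2.le⟩).hasDerivWithinAt) 1 (right_mem_Icc.2 zero_le_one)
  have h01 := hCs 1 (right_mem_Icc.2 zero_le_one)
  have h00 := hCs 0 (left_mem_Icc.2 zero_le_one)
  have hX0 : fderiv ℝ X (q, (0 : ℂ)) (a, 0) = a := by
    have h1 : HasFDerivAt X (fderiv ℝ X (q, 0)) (q, 0) :=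
      ((H.contDiffAt_exp hq (H.zero_mem_source hq)).differentiableAt (by simp)).hasFDerivAt
    have h2 := h1.comp (f := fun q : ℂ => (q, (0 : ℂ))) q (hasFDerivAt_prodMk_left q (0 : ℂ))
    have h3 := (hasFDerivAt_id (𝕜 := ℝ) q).congr_of_eventuallyEq (f₁ := X ∘ fun q => (q, (0 : ℂ))) (by
      filter_upwards [H.isOpen.mem_nhds hq] with x hx using H.exp_zero hx)
    exact DFunLike.congr_fun (h2.unique h3) a
  simp only [zero_smul, one_smul] at h01 h00
  rw [hX0] at h00
  rw [h01, h00, hcd 1 (right_mem_Icc.2 zero_le_one), hce 1 (right_mem_Icc.2 zero_le_one),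
    hc0, hc1] at hfin
  simp only [one_smul] at hfin
  linarith

end FirstVariation

/-! ### Topology of the region near the curve -/

section Region

variable {m : ℕ} {γ : ℝ → ℂ}

namespace IsSimpleClosedCurve

theorem eq_iff (hγ : IsSimpleClosedCurve m γ) {a b : ℝ} :
    γ a = γ b ↔ ∃ j : ℤ, a = b + j • (2 * π) := by
  refine ⟨fun h => ?_, fun ⟨j, hj⟩ => by rw [hj, hγ.periodic.zsmul j b]⟩
  have hp : ∀ x, γ (toIcoMod two_pi_pos 0 x) = γ x := fun x => by
    rw [toIcoMod, hγ.periodic.sub_zsmul_eq]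
  have hmem : ∀ x, toIcoMod two_pi_pos 0 x ∈ Ico 0 (2 * π) := fun x => by
    simpa using toIcoMod_mem_Ico two_pi_pos 0 x
  have := hγ.injOn (hmem a) (hmem b) (by rw [hp, hp, h])
  refine ⟨toIcoDiv two_pi_pos 0 a - toIcoDiv two_pi_pos 0 b, ?_⟩
  rw [toIcoMod, toIcoMod] at this
  rw [sub_smul]
  linarith

theorem eq_of_abs_sub_lt (hγ : IsSimpleClosedCurve m γ) {a b : ℝ} (h : γ a = γ b)
    (hab : |a - b| < 2 * π) : a = b := by
  obtain ⟨j, rfl⟩ := hγ.eq_iff.1 h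
  rw [add_sub_cancel_left, zsmul_eq_mul, abs_mul, abs_of_pos two_pi_pos] at hab
  have h1 : |(j : ℝ)| < 1 := by
    by_contra hj
    rw [not_lt] at hj
    nlinarith [two_pi_pos]
  have h2 : j = 0 := Int.abs_lt_one_iff.1 (by exact_mod_cast h1)
  simp [h2]

theorem isCompact_range (hγ : IsSimpleClosedCurve m γ) : IsCompact (range γ) := by
  rw [← hγ.periodic.image_Icc two_pi_pos 0]
  exact isCompact_Icc.image hγ.contDiff.continuous

theorem isOpen_compl_range (hγ : IsSimpleClosedCurve m γ) : IsOpen (range γ)ᶜ :=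
  hγ.isCompact_range.isClosed.isOpen_compl

end IsSimpleClosedCurve

/-- The region is a union of whole components of the complement, so a connected set missing the
curve cannot be split by it. -/
theorem subset_region {S : Set ℂ} (hS : IsPreconnected S) (hSγ : S ⊆ (range γ)ᶜ) {p : ℂ}
    (hp : p ∈ S) (hpr : p ∈ region γ) : S ⊆ region γ := by
  intro x hx
  refine ⟨hSγ hx, ?_⟩
  rw [← connectedComponentIn_eq (hS.subset_connectedComponentIn hp hSγ hx)]
  exact hpr.2

namespace IsSimpleClosedCurve

theorem isOpen_region (hγ : IsSimpleClosedCurve m γ) : IsOpen (region γ) := by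
  rw [isOpen_iff_mem_nhds]
  intro p hp
  refine mem_of_superset (hγ.isOpen_compl_range.connectedComponentIn.mem_nhds
    (mem_connectedComponentIn hp.1)) ?_
  exact subset_region isPreconnected_connectedComponentIn (connectedComponentIn_subset _ _)
    (mem_connectedComponentIn hp.1) hp

theorem isClosed_region_union (hγ : IsSimpleClosedCurve m γ) :
    IsClosed (region γ ∪ range γ) := by
  rw [← isOpen_compl_iff, isOpen_iff_mem_nhds]
  intro p hp
  rw [mem_compl_iff, mem_union, not_or] at hp
  refine mem_of_superset (hγ.isOpen_compl_range.connectedComponentIn.mem_nhds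
    (mem_connectedComponentIn hp.2)) ?_
  rintro x hx (hxr | hxγ)
  · exact hp.1 (subset_region isPreconnected_connectedComponentIn
      (connectedComponentIn_subset _ _) hx hxr (mem_connectedComponentIn hp.2))
  · exact connectedComponentIn_subset _ _ hx hxγ

/-- The outside of a disc containing the curve is connected (an image under polar coordinates) and
unbounded, so it cannot meet a bounded component. -/
theorem isBounded_region (hγ : IsSimpleClosedCurve m γ) :
    Bornology.IsBounded (region γ) := by
  obtain ⟨R, hR0, hR⟩ := hγ.isCompact_range.isBounded.subset_ball_lt 0 0
  set S : Set ℂ := {x | R ≤ ‖x‖} with hS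
  have hSγ : S ⊆ (range γ)ᶜ := fun x hx hxγ => by
    have := hR hxγ
    rw [mem_ball_zero_iff] at this
    exact absurd hx (not_le.2 this)
  have hpre : IsPreconnected S := by
    have h1 : S = (fun z : ℝ × ℝ => (z.1 : ℂ) * Complex.exp (z.2 * Complex.I)) ''
        (Ici R ×ˢ univ) := by
      ext x
      constructor
      · intro hx
        exact ⟨(‖x‖, x.arg), ⟨hx, mem_univ _⟩, Complex.norm_mul_exp_arg_mul_I x⟩
      · rintro ⟨⟨r, t⟩, ⟨hr, -⟩, rfl⟩
        have hr' : R ≤ r := hr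
        simp only [hS, mem_ofPred_eq, norm_mul, Complex.norm_exp_ofReal_mul_I, mul_one,
          Complex.norm_real, Real.norm_eq_abs]
        exact hr'.trans (le_abs_self r)
    rw [h1]
    exact (((convex_Ici R).isPreconnected).prod isPreconnected_univ).image _
      (Continuous.continuousOn (by fun_prop))
  refine (Metric.isBounded_ball (x := (0 : ℂ)) (r := R)).subset ?_
  intro p hp
  rw [mem_ball_zero_iff]
  by_contra hpR
  rw [not_lt] at hpR
  obtain ⟨R', hR'⟩ := (hp.2.subset
    (hpre.subset_connectedComponentIn hpR hSγ)).subset_closedBall (0 : ℂ)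
  have h2 : ((max R (R' + 1) : ℝ) : ℂ) ∈ S := by
    simp only [hS, mem_ofPred_eq, Complex.norm_real, Real.norm_eq_abs]
    exact (le_max_left _ _).trans (le_abs_self _)
  have h3 := hR' h2
  rw [mem_closedBall_zero_iff, Complex.norm_real, Real.norm_eq_abs] at h3
  have h4 := (le_max_right R (R' + 1)).trans (le_abs_self _)
  linarith

theorem isCompact_region_union (hγ : IsSimpleClosedCurve m γ) :
    IsCompact (region γ ∪ range γ) :=
  Metric.isCompact_of_isClosed_isBounded hγ.isClosed_region_union
    (hγ.isBounded_region.union hγ.isCompact_range.isBounded)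

/-- A local coordinate transversal to the curve. -/
theorem exists_transversal_coordinate (hγ : IsSimpleClosedCurve m γ) (hm : m ≠ 0) (θ₀ : ℝ) :
    ∃ φ : ℂ → ℝ, ContDiffAt ℝ m φ (γ θ₀) ∧
      (∀ w, fderiv ℝ φ (γ θ₀) w = (w / deriv γ θ₀).im) ∧
      (∀ᶠ p in 𝓝 (γ θ₀), p ∈ range γ ↔ φ p = 0) ∧
      (∀ᶠ p in 𝓝 (γ θ₀), 0 < φ p → p ∈ region γ) ∧
      ((∀ᶠ p in 𝓝 (γ θ₀), φ p < 0 → p ∈ region γ) ∨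
        (∀ᶠ p in 𝓝 (γ θ₀), φ p < 0 → p ∉ region γ)) := by
  have hm' : (m : WithTop ℕ∞) ≠ 0 := by exact_mod_cast hm
  set d := deriv γ θ₀ with hd
  have hd0 : d ≠ 0 := hγ.regular θ₀
  -- The real coordinate runs along the curve and the imaginary one along the fixed normal at `θ₀`.
  -- The derivative at `0` is multiplication by `γ' θ₀`, and `φ` is the imaginary part of the local
  -- inverse.
  set Φ : ℂ → ℂ := fun z => γ (θ₀ + z.re) + z.im • (Complex.I * d) with hΦ
  have hΦ0 : Φ 0 = γ θ₀ := by simp [hΦ]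
  have hre : ContDiff ℝ m fun z : ℂ => θ₀ + z.re :=
    contDiff_const.add Complex.reCLM.contDiff
  have hΦc : ContDiff ℝ m Φ :=
    (hγ.contDiff.comp hre).add (Complex.imCLM.contDiff.smul contDiff_const)
  obtain ⟨L, hL⟩ := exists_equiv_of_injective (L := ContinuousLinearMap.mul ℝ ℂ d)
    (fun a b h => mul_left_cancel₀ hd0 h)
  have hLs : ∀ w, L.symm w = w / d := fun w => by
    rw [ContinuousLinearEquiv.symm_apply_eq]
    have := DFunLike.congr_fun hL (w / d)
    simp only [ContinuousLinearEquiv.coe_coe, ContinuousLinearMap.mul_apply'] at this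
    rw [this, mul_div_cancel₀ _ hd0]
  have hΦd : HasFDerivAt Φ (L : ℂ →L[ℝ] ℂ) 0 := by
    have h1 : HasFDerivAt (fun z : ℂ => θ₀ + z.re) Complex.reCLM 0 :=
      Complex.reCLM.hasFDerivAt.const_add θ₀
    have h2 : HasDerivAt γ d (θ₀ + (0 : ℂ).re) := by
      rw [Complex.zero_re, add_zero]
      exact (hγ.contDiff.differentiable hm' θ₀).hasDerivAt
    have h3 := (h2.hasFDerivAt.comp (0 : ℂ) h1).add
      (Complex.imCLM.hasFDerivAt.smul_const (Complex.I * d))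
    convert! h3 using 1
    rw [hL]
    ext w
    simp only [ContinuousLinearMap.mul_apply', _root_.add_apply,
      ContinuousLinearMap.comp_apply, Complex.reCLM_apply, ContinuousLinearMap.smulRight_apply,
      Complex.imCLM_apply, Complex.real_smul, ContinuousLinearMap.toSpanSingleton_apply]
    nth_rewrite 1 [← Complex.re_add_im w]
    ring
  have hΦa : ContDiffAt ℝ m Φ 0 := hΦc.contDiffAt
  set P := hΦa.toOpenPartialHomeomorph Φ hΦd hm' with hP
  have hPs : (0 : ℂ) ∈ P.source := hΦa.mem_toOpenPartialHomeomorph_source hΦd hm'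
  have hPc : ∀ z, P z = Φ z := fun z => rfl
  have hsm : ContDiffAt ℝ m P.symm (γ θ₀) := by
    have := hΦa.to_localInverse hΦd hm'
    rwa [hΦ0] at this
  have hsd : HasFDerivAt P.symm (L.symm : ℂ →L[ℝ] ℂ) (γ θ₀) := by
    have := ((hΦa.hasStrictFDerivAt' hΦd hm').to_localInverse).hasFDerivAt
    rwa [hΦ0] at this
  -- away from `θ₀` the curve does not come back
  obtain ⟨r₀, hr₀, hball⟩ := Metric.isOpen_iff.1 P.open_source 0 hPs
  set A : Set ℂ := γ '' (Icc (θ₀ - π) (θ₀ + π) ∩ {θ | r₀ ≤ |θ - θ₀|}) with hA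
  have hAc : IsClosed A := by
    refine ((isCompact_Icc.inter_right ?_).image hγ.contDiff.continuous).isClosed
    exact isClosed_le continuous_const (by fun_prop)
  have hA0 : Φ 0 ∉ A := by
    rintro ⟨θ, ⟨hθ1, hθ2⟩, hθ⟩
    have h1 : |θ - θ₀| ≤ π := abs_le.2 ⟨by linarith [hθ1.1], by linarith [hθ1.2]⟩
    have h2 := hγ.eq_of_abs_sub_lt (hθ.trans hΦ0) (by linarith [pi_pos])
    rw [h2] at hθ2
    simp only [sub_self, abs_zero, mem_ofPred_eq] at hθ2
    linarith
  obtain ⟨r, hr, hrA⟩ := Metric.mem_nhds_iff.1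
    (hΦc.continuous.continuousAt.eventually (hAc.isOpen_compl.mem_nhds hA0))
  set B := Metric.ball (0 : ℂ) (min r r₀) with hB
  have hB0 : (0 : ℂ) ∈ B := Metric.mem_ball_self (lt_min hr hr₀)
  have hBs : B ⊆ P.source := (Metric.ball_subset_ball (min_le_right _ _)).trans hball
  have hzero : ∀ z ∈ B, Φ z ∈ range γ ↔ z.im = 0 := by
    intro z hz
    constructor
    · intro hzγ
      obtain ⟨θ', hθ'⟩ := hzγ
      obtain ⟨θ, hθ, hθe⟩ := hγ.periodic.exists_mem_Ico two_pi_pos θ' (θ₀ - π)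
      have h1 : |θ - θ₀| < r₀ := by
        by_contra h
        rw [not_lt] at h
        refine hrA (Metric.ball_subset_ball (min_le_left _ _) hz)
          ⟨θ, ⟨⟨hθ.1, by linarith [hθ.2]⟩, h⟩, by rw [← hθe, hθ']⟩
      have h2 : ((θ - θ₀ : ℝ) : ℂ) ∈ P.source := hball (by
        rw [mem_ball_zero_iff, Complex.norm_real, Real.norm_eq_abs]; exact h1)
      have h3 : P z = P ((θ - θ₀ : ℝ) : ℂ) := by
        rw [hPc, hPc, ← hθ', hθe, hΦ]
        simp only [Complex.ofReal_re, Complex.ofReal_im, zero_smul, add_zero]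
        congr 1; ring
      rw [P.injOn (hBs hz) h2 h3, Complex.ofReal_im]
    · intro h
      exact ⟨θ₀ + z.re, by simp [hΦ, h]⟩
  have hO : Φ '' B ∈ 𝓝 (γ θ₀) := by
    have := (P.isOpen_image_of_subset_source Metric.isOpen_ball hBs).mem_nhds
      (mem_image_of_mem P hB0)
    rw [hPc, hΦ0] at this
    exact this
  -- Applied to the two open half-planes: each half of the chart is connected and misses the curve,
  -- so it meets the region entirely or not at all. The orientation hypothesis decides the upper
  -- half only.
  have hconn : ∀ H : Set ℂ, Convex ℝ H → IsPreconnected (Φ '' (B ∩ H)) := fun H hH =>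
    (((convex_ball _ _).inter hH).isPreconnected).image _ hΦc.continuous.continuousOn
  have hinv : ∀ z ∈ B, P.symm (Φ z) = z := fun z hz => P.left_inv (hBs hz)
  refine ⟨fun p => (P.symm p).im, Complex.imCLM.contDiff.contDiffAt.comp _ hsm, fun w => ?_,
    ?_, ?_, ?_⟩
  · have : HasFDerivAt (fun p => (P.symm p).im)
        (Complex.imCLM ∘L (L.symm : ℂ →L[ℝ] ℂ)) (γ θ₀) :=
      Complex.imCLM.hasFDerivAt.comp _ hsd
    rw [this.fderiv]
    simp [hLs]
  · filter_upwards [hO] with p ⟨z, hz, hzp⟩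
    rw [← hzp, hinv z hz, hzero z hz]
  · have hup : Φ '' (B ∩ {z | 0 < z.im}) ⊆ region γ := by
      obtain ⟨ε, ⟨hε1, hε2⟩, hε3⟩ : ∃ ε : ℝ, (γ θ₀ + ε • (Complex.I * d) ∈ region γ ∧
          (ε : ℂ) * Complex.I ∈ B) ∧ 0 < ε := by
        have h1 : ∀ᶠ ε : ℝ in 𝓝[>] 0, (ε : ℂ) * Complex.I ∈ B := by
          have : ContinuousAt (fun ε : ℝ => (ε : ℂ) * Complex.I) 0 := by fun_prop
          exact (this.eventually (Metric.isOpen_ball.mem_nhds (by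
            simpa using ⟨hr, hr₀⟩))).filter_mono
            nhdsWithin_le_nhds
        exact (((hγ.positive θ₀).and h1).and self_mem_nhdsWithin).exists
      refine subset_region (hconn _ (convex_halfSpace_im_gt 0)) ?_
        (mem_image_of_mem Φ ⟨hε2, by simpa using hε3⟩) (by simpa [hΦ] using hε1)
      rintro _ ⟨z, ⟨hz, hz'⟩, rfl⟩ h
      exact (ne_of_gt hz') ((hzero z hz).1 h)
    filter_upwards [hO] with p ⟨z, hz, hzp⟩ hpos
    rw [← hzp, hinv z hz] at hpos
    exact hup ⟨z, ⟨hz, hpos⟩, hzp⟩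
  · by_cases hex : ∃ p ∈ Φ '' (B ∩ {z | z.im < 0}), p ∈ region γ
    · left
      obtain ⟨p₀, hp₀, hp₀r⟩ := hex
      have hlow : Φ '' (B ∩ {z | z.im < 0}) ⊆ region γ := by
        refine subset_region (hconn _ (convex_halfSpace_im_lt 0)) ?_ hp₀ hp₀r
        rintro _ ⟨z, ⟨hz, hz'⟩, rfl⟩ h
        exact (ne_of_lt hz') ((hzero z hz).1 h)
      filter_upwards [hO] with p ⟨z, hz, hzp⟩ hneg
      rw [← hzp, hinv z hz] at hneg
      exact hlow ⟨z, ⟨hz, hneg⟩, hzp⟩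
    · right
      push Not at hex
      filter_upwards [hO] with p ⟨z, hz, hzp⟩ hneg
      rw [← hzp, hinv z hz] at hneg
      exact hex p ⟨z, ⟨hz, hneg⟩, hzp⟩

/-- The parameters at which the region fills both sides form a clopen subset of the line. Were it
everything, the closed region would be open, closed, nonempty and bounded in the plane. -/
theorem notMem_interior (hγ : IsSimpleClosedCurve m γ) (hm : m ≠ 0) (θ : ℝ) :
    γ θ ∉ interior (region γ ∪ range γ) := by
  set K := region γ ∪ range γ with hK
  have hm' : (1 : WithTop ℕ∞) ≤ m := by exact_mod_cast Nat.one_le_iff_ne_zero.2 hm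
  have hclopen : IsClopen {θ | γ θ ∈ interior K} := by
    refine ⟨?_, isOpen_interior.preimage hγ.contDiff.continuous⟩
    rw [← isOpen_compl_iff, isOpen_iff_mem_nhds]
    intro θ₀ hθ₀
    obtain ⟨φ, hφ, hφd, hφ0, hφ1, hφ2⟩ := hγ.exists_transversal_coordinate hm θ₀
    have hφ2' : ∀ᶠ p in 𝓝 (γ θ₀), φ p < 0 → p ∉ region γ := by
      refine hφ2.resolve_left fun h => hθ₀ (mem_interior_iff_mem_nhds.2 ?_)
      filter_upwards [hφ0, hφ1, h] with p h0 h1 h2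
      rcases lt_trichotomy (φ p) 0 with h | h | h
      exacts [Or.inl (h2 h), Or.inr (h0.2 h), Or.inl (h1 h)]
    have hge : ∀ᶠ p in 𝓝 (γ θ₀), p ∈ K → 0 ≤ φ p := by
      filter_upwards [hφ0, hφ2'] with p h0 h2 hpK
      rcases hpK with h | h
      · exact not_lt.1 fun hlt => h2 hlt h
      · exact (h0.1 h).ge
    have hder : ∀ᶠ p in 𝓝 (γ θ₀), fderiv ℝ φ p ≠ 0 := by
      have hc : ContinuousAt (fderiv ℝ φ) (γ θ₀) :=
        ((hφ.of_le hm').fderiv_right (m := 0) (by simp)).continuousAt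
      refine hc.eventually_ne fun h => ?_
      have := hφd (Complex.I * deriv γ θ₀)
      rw [h, mul_div_cancel_right₀ _ (hγ.regular θ₀)] at this
      simp at this
    filter_upwards [hγ.contDiff.continuous.continuousAt.eventually
      ((hge.eventually_nhds.and hder).and hφ0)] with θ' ⟨⟨h1, h2⟩, h3⟩ hmem
    -- Near `γ θ₀` the coordinate `φ` is nonnegative on the closed region. An interior point on the
    -- curve would be a local minimum of `φ`, although its derivative is nonzero there.
    refine h2 (IsLocalMin.fderiv_eq_zero ?_)
    filter_upwards [h1, mem_interior_iff_mem_nhds.1 hmem] with p hp hpK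
    rw [h3.1 (mem_range_self θ')]
    exact hp hpK
  rcases isClopen_iff.1 hclopen with h | h
  · intro hθ
    have : θ ∈ {θ | γ θ ∈ interior K} := hθ
    rw [h] at this
    exact this
  · exfalso
    have hKo : IsOpen K := by
      rw [← subset_interior_iff_isOpen]
      rintro p (hp | ⟨θ, rfl⟩)
      · exact interior_mono subset_union_left (by rwa [hγ.isOpen_region.interior_eq])
      · exact (eq_univ_iff_forall.1 h) θ
    rcases isClopen_iff.1 (⟨hγ.isClosed_region_union, hKo⟩ : IsClopen K) with h0 | h0
    · have : γ 0 ∈ K := Or.inr (mem_range_self 0)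
      rw [h0] at this
      exact this
    · exact noncompact_univ ℂ (h0 ▸ hγ.isCompact_region_union)

/-- A local defining function of the region. -/
theorem exists_defining_function (hγ : IsSimpleClosedCurve m γ) (hm : m ≠ 0) (θ₀ : ℝ) :
    ∃ φ : ℂ → ℝ, ContDiffAt ℝ m φ (γ θ₀) ∧
      (∀ w, fderiv ℝ φ (γ θ₀) w = (w / deriv γ θ₀).im) ∧
      (∀ᶠ p in 𝓝 (γ θ₀), p ∈ range γ ↔ φ p = 0) ∧
      (∀ᶠ p in 𝓝 (γ θ₀), p ∈ region γ ↔ 0 < φ p) := by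
  obtain ⟨φ, hφ, hφd, hφ0, hφ1, hφ2⟩ := hγ.exists_transversal_coordinate hm θ₀
  refine ⟨φ, hφ, hφd, hφ0, ?_⟩
  have hφ2' : ∀ᶠ p in 𝓝 (γ θ₀), φ p < 0 → p ∉ region γ := by
    refine hφ2.resolve_left fun h => hγ.notMem_interior hm θ₀ (mem_interior_iff_mem_nhds.2 ?_)
    filter_upwards [hφ0, hφ1, h] with p h0 h1 h2
    rcases lt_trichotomy (φ p) 0 with h | h | h
    exacts [Or.inl (h2 h), Or.inr (h0.2 h), Or.inl (h1 h)]
  filter_upwards [hφ0, hφ1, hφ2'] with p h0 h1 h2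
  refine ⟨fun hp => ?_, h1⟩
  rcases lt_trichotomy (φ p) 0 with h | h | h
  exacts [absurd hp (h2 h), absurd (h0.2 h) hp.1, h]

end IsSimpleClosedCurve

end Region

/-! ### Transversality forced by positive curvature -/

section Tangency

variable {m : ℕ} {γ : ℝ → ℂ} {N : ℂ → ℝ}

theorem eventually_pos_of_hasDerivAt {f : ℝ → ℝ} {f' t : ℝ} (hf : HasDerivAt f f' t)
    (h0 : f t = 0) (hf' : 0 < f') :
    (∀ᶠ x in 𝓝[>] t, 0 < f x) ∧ ∀ᶠ x in 𝓝[<] t, f x < 0 := by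
  have h := (hasDerivAt_iff_tendsto_slope.1 hf).eventually (lt_mem_nhds hf')
  constructor
  · filter_upwards [h.filter_mono (nhdsWithin_mono t fun x hx => ne_of_gt hx),
      self_mem_nhdsWithin] with x hx hxt
    rw [slope_def_field, h0, sub_zero] at hx
    exact (div_pos_iff_of_pos_right (sub_pos.2 hxt)).1 hx
  · filter_upwards [h.filter_mono (nhdsWithin_mono t fun x hx => ne_of_lt hx),
      self_mem_nhdsWithin] with x hx hxt
    rw [slope_def_field, h0, sub_zero] at hx
    have h1 : x - t < 0 := sub_neg.2 hxt
    by_contra hle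
    exact absurd hx (not_lt.2 (div_nonpos_of_nonneg_of_nonpos (not_lt.1 hle) h1.le))

theorem deriv_deriv_comp {φ : ℂ → ℝ} {c : ℝ → ℂ} {t : ℝ} (hφ : ContDiffAt ℝ 2 φ (c t))
    (hc : ContDiffAt ℝ 2 c t) :
    deriv (deriv fun t => φ (c t)) t = fderiv ℝ (fderiv ℝ φ) (c t) (deriv c t) (deriv c t)
      + fderiv ℝ φ (c t) (deriv (deriv c) t) := by
  have h1 : ∀ᶠ s in 𝓝 t, ContDiffAt ℝ 2 φ (c s) :=
    hc.continuousAt.eventually (hφ.eventually (by simp))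
  have h2 : ∀ᶠ s in 𝓝 t, ContDiffAt ℝ 2 c s := hc.eventually (by simp)
  have h3 : deriv (fun t => φ (c t)) =ᶠ[𝓝 t] fun s => fderiv ℝ φ (c s) (deriv c s) := by
    filter_upwards [h1, h2] with s hs1 hs2
    exact ((hs1.differentiableAt (by simp)).hasFDerivAt.comp_hasDerivAt s
      (hs2.differentiableAt (by simp)).hasDerivAt).deriv
  have h4 : HasFDerivAt (fderiv ℝ φ) (fderiv ℝ (fderiv ℝ φ) (c t)) (c t) :=
    ((hφ.fderiv_right (m := 1) (by norm_num)).differentiableAt (by simp)).hasFDerivAt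
  have h5 : HasDerivAt (deriv c) (deriv (deriv c) t) t :=
    ((hc.derivWithin (m := 1) (by norm_num)).differentiableAt (by simp)).hasDerivAt
  have h6 := (h4.comp_hasDerivAt t (hc.differentiableAt (by simp)).hasDerivAt).clm_apply h5
  rw [h3.deriv_eq]
  exact h6.deriv

/-- This fixes the sign convention used from here on: `w` points inwards at `γ θ` exactly when `w /
γ' θ` has positive imaginary part. -/
theorem inner_I_mul (a b : ℂ) (hb : b ≠ 0) :
    inner ℝ a (Complex.I * b) = ‖b‖ ^ 2 * (a / b).im := by
  have h1 : ‖b‖ ^ 2 ≠ 0 := pow_ne_zero _ (norm_ne_zero_iff.2 hb)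
  have h2 : ‖b‖ ^ 2 = b.re * b.re + b.im * b.im := by
    rw [← Complex.normSq_eq_norm_sq, Complex.normSq_apply]
  rw [Complex.div_im, Complex.normSq_eq_norm_sq, Complex.inner]
  field_simp
  simp
  ring

namespace IsSimpleClosedCurve

theorem im_covAccel_pos (hγ : IsSimpleClosedCurve m γ) (hpos : ∀ x, 0 < N x)
    (hcurv : ∀ θ, 0 < geodesicCurvature N γ θ) (θ : ℝ) :
    0 < (covAccel N γ θ / deriv γ θ).im := by
  have h := hcurv θ
  have h1 : 0 < ‖deriv γ θ‖ := norm_pos_iff.2 (hγ.regular θ)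
  rw [geodesicCurvature, inner_I_mul _ _ (hγ.regular θ)] at h
  have h2 := (div_pos_iff_of_pos_right (mul_pos (hpos _) (pow_pos h1 3))).1 h
  exact (mul_pos_iff_of_pos_left (pow_pos h1 2)).1 h2

/-- A geodesic which is tangent to a curve of positive geodesic curvature does not enter the
region near the point of tangency. -/
theorem eventually_notMem_region (hγ : IsSimpleClosedCurve m γ) (hm : 2 ≤ m)
    (hpos : ∀ x, 0 < N x) (hcurv : ∀ θ, 0 < geodesicCurvature N γ θ) {c : ℝ → ℂ} {s : Set ℝ}
    (hs : IsOpen s) (hc : IsGeodesicOn N c s) {t θ : ℝ} (ht : t ∈ s) (hcθ : c t = γ θ)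
    (hne : deriv c t ≠ 0) (htan : (deriv c t / deriv γ θ).im = 0) :
    ∀ᶠ τ in 𝓝 t, c τ ∉ region γ := by
  obtain ⟨φ, hφ, hφd, hφ0, hφr⟩ := hγ.exists_defining_function (by omega) θ
  have hm' : (2 : WithTop ℕ∞) ≤ m := by exact_mod_cast hm
  have hφ2 : ContDiffAt ℝ 2 φ (γ θ) := hφ.of_le hm'
  have hγ2 : ContDiffAt ℝ 2 γ θ := (hγ.contDiff.of_le hm').contDiffAt
  have hc2 := hc.contDiffAt hs ht
  obtain ⟨μ, hμ⟩ : ∃ μ : ℝ, deriv c t = μ • deriv γ θ :=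
    ⟨(deriv c t / deriv γ θ).re, by
      rw [Complex.real_smul, ← div_eq_iff (hγ.regular θ)]
      exact Complex.ext (by simp) (by simp [htan])⟩
  have hμ0 : μ ≠ 0 := by
    rintro rfl
    exact hne (by rw [hμ, zero_smul])
  have hval : φ (c t) = 0 := by
    rw [hcθ]; exact hφ0.self_of_nhds.1 (mem_range_self θ)
  have h1 : deriv (deriv fun τ => φ (γ τ)) θ = 0 := by
    have : (fun τ => φ (γ τ)) =ᶠ[𝓝 θ] fun _ => 0 := by
      filter_upwards [hγ2.continuousAt.eventually hφ0] with τ hτ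
      exact hτ.1 (mem_range_self τ)
    rw [(this.deriv).deriv_eq]
    simp
  rw [deriv_deriv_comp hφ2 hγ2] at h1
  -- The Hessian and geodesic acceleration terms match `μ ^ 2` times those of `φ ∘ γ`, whose second
  -- derivative is zero. What remains is `-μ ^ 2` times the inward part of the covariant
  -- acceleration of `γ`, so `φ ∘ c` has a local maximum with value zero.
  have h2 : deriv (deriv fun τ => φ (c τ)) t < 0 := by
    rw [deriv_deriv_comp (by rwa [hcθ]) hc2, (hc.hasDerivAt_deriv hs ht).deriv, hcθ, hμ,
      geodesicAccel_smul]
    have h3 : deriv (deriv γ) θ = covAccel N γ θ + geodesicAccel N (γ θ) (deriv γ θ) := by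
      rw [covAccel_eq]; abel
    rw [h3, map_add, hφd] at h1
    have h4 := hγ.im_covAccel_pos hpos hcurv θ
    simp only [map_smul, _root_.smul_apply, smul_eq_mul]
    have h5 : 0 < μ ^ 2 := by positivity
    nlinarith
  have h3 : deriv (fun τ => φ (c τ)) t = 0 := by
    have h4 : HasFDerivAt φ (fderiv ℝ φ (γ θ)) (c t) := by
      rw [hcθ]; exact (hφ2.differentiableAt (by simp)).hasFDerivAt
    have := (h4.comp_hasDerivAt t (hc.hasDerivAt hs ht)).deriv
    rw [hφd, htan] at this
    exact this
  have h4 : ContinuousAt (fun τ => φ (c τ)) t :=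
    ContinuousAt.comp (by rw [hcθ]; exact hφ2.continuousAt) hc2.continuousAt
  have h5 := isLocalMax_of_deriv_deriv_neg h2 h3 h4
  have h6 : ∀ᶠ τ in 𝓝 t, c τ ∈ region γ ↔ 0 < φ (c τ) :=
    hc2.continuousAt.eventually (by rwa [hcθ])
  filter_upwards [h5, h6] with τ hτ1 hτ2 hτ
  rw [hval] at hτ1
  exact absurd (hτ2.1 hτ) (not_lt.2 hτ1)

theorem eventually_mem_region (hγ : IsSimpleClosedCurve m γ) (hm : m ≠ 0) {c : ℝ → ℂ} {c' : ℂ}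
    {t θ : ℝ} (hc : HasDerivAt c c' t) (hcθ : c t = γ θ) (him : 0 < (c' / deriv γ θ).im) :
    (∀ᶠ τ in 𝓝[>] t, c τ ∈ region γ) ∧ ∀ᶠ τ in 𝓝[<] t, c τ ∉ region γ := by
  obtain ⟨φ, hφ, hφd, hφ0, hφr⟩ := hγ.exists_defining_function hm θ
  have hm' : (m : WithTop ℕ∞) ≠ 0 := by exact_mod_cast hm
  have h4 : HasFDerivAt φ (fderiv ℝ φ (γ θ)) (c t) := by
    rw [hcθ]; exact (hφ.differentiableAt hm').hasFDerivAt
  have h5 := h4.comp_hasDerivAt t hc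
  rw [hφd] at h5
  have hval : φ (c t) = 0 := by
    rw [hcθ]; exact hφ0.self_of_nhds.1 (mem_range_self θ)
  obtain ⟨h7, h8⟩ := eventually_pos_of_hasDerivAt h5 hval him
  have h6 : ∀ᶠ τ in 𝓝 t, c τ ∈ region γ ↔ 0 < φ (c τ) :=
    hc.continuousAt.eventually (by rwa [hcθ])
  constructor
  · filter_upwards [h6.filter_mono nhdsWithin_le_nhds, h7] with τ h1 h2 using h1.2 h2
  · filter_upwards [h6.filter_mono nhdsWithin_le_nhds, h8] with τ h1 h2 h3
    exact absurd (h1.1 h3) (not_lt.2 (le_of_lt h2))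

/-- A geodesic that enters the region does so transversally. -/
theorem im_pos_of_eventually_mem (hγ : IsSimpleClosedCurve m γ) (hm : 2 ≤ m)
    (hpos : ∀ x, 0 < N x) (hcurv : ∀ θ, 0 < geodesicCurvature N γ θ) {c : ℝ → ℂ} {s : Set ℝ}
    (hs : IsOpen s) (hc : IsGeodesicOn N c s) {t θ : ℝ} (ht : t ∈ s) (hcθ : c t = γ θ)
    (hne : deriv c t ≠ 0) (hin : ∀ᶠ τ in 𝓝[>] t, c τ ∈ region γ) :
    0 < (deriv c t / deriv γ θ).im := by
  rcases lt_trichotomy (deriv c t / deriv γ θ).im 0 with h | h | h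
  · exfalso
    -- Reflecting time about `t` turns an outward velocity into an inward one, so the statement
    -- about the past of an entering curve applies to the future of `c`.
    have hd : HasDerivAt (fun τ => c (2 * t - τ)) (-deriv c t) t := by
      have h1 : HasDerivAt (fun τ : ℝ => 2 * t - τ) (-1) t := by
        simpa using (hasDerivAt_id t).const_sub (2 * t)
      have h2 : HasDerivAt c (deriv c t) (2 * t - t) := by
        rw [show 2 * t - t = t by ring]; exact hc.hasDerivAt hs ht
      have h3 := h2.scomp t h1
      rw [neg_one_smul] at h3
      exact h3
    have h3 := (hγ.eventually_mem_region (by omega) hd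
      (by rw [← hcθ]; congr 1; ring) (by rw [neg_div, Complex.neg_im]; linarith)).2
    have h4 : Tendsto (fun τ : ℝ => 2 * t - τ) (𝓝[>] t) (𝓝[<] t) := by
      refine tendsto_nhdsWithin_iff.2 ⟨?_, ?_⟩
      · have : ContinuousAt (fun τ : ℝ => 2 * t - τ) t := by fun_prop
        have h := this.tendsto
        rw [show 2 * t - t = t by ring] at h
        exact h.mono_left nhdsWithin_le_nhds
      · filter_upwards [self_mem_nhdsWithin] with τ hτ
        have : t < τ := hτ
        show 2 * t - τ < t
        linarith
    obtain ⟨τ, h5, h6⟩ := ((h4.eventually h3).and hin).exists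
    rw [show 2 * t - (2 * t - τ) = τ by ring] at h5
    exact h5 h6
  · exfalso
    have h3 := hγ.eventually_notMem_region hm hpos hcurv hs hc ht hcθ hne h
    obtain ⟨τ, h5, h6⟩ := ((h3.filter_mono nhdsWithin_le_nhds).and hin).exists
    exact h5 h6
  · exact h

/-- A geodesic that leaves the region does so transversally. -/
theorem im_neg_of_eventually_mem (hγ : IsSimpleClosedCurve m γ) (hm : 2 ≤ m)
    (hpos : ∀ x, 0 < N x) (hcurv : ∀ θ, 0 < geodesicCurvature N γ θ) {c : ℝ → ℂ} {s : Set ℝ}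
    (hs : IsOpen s) (hc : IsGeodesicOn N c s) {t θ : ℝ} (ht : t ∈ s) (hcθ : c t = γ θ)
    (hne : deriv c t ≠ 0) (hin : ∀ᶠ τ in 𝓝[<] t, c τ ∈ region γ) :
    (deriv c t / deriv γ θ).im < 0 := by
  rcases lt_trichotomy (deriv c t / deriv γ θ).im 0 with h | h | h
  · exact h
  · exfalso
    have h3 := hγ.eventually_notMem_region hm hpos hcurv hs hc ht hcθ hne h
    obtain ⟨τ, h5, h6⟩ := ((h3.filter_mono nhdsWithin_le_nhds).and hin).exists
    exact h5 h6
  · exfalso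
    have h3 := (hγ.eventually_mem_region (by omega) (hc.hasDerivAt hs ht) hcθ h).2
    obtain ⟨τ, h5, h6⟩ := (h3.and hin).exists
    exact h5 h6

end IsSimpleClosedCurve

end Tangency

/-! ### Directions, angles and time reversal -/

section Direction

variable {m : ℕ} {γ : ℝ → ℂ} {N : ℂ → ℝ}

theorem reflection_smul_direction (γ : ℝ → ℂ) (N : ℂ → ℝ) (θ α : ℝ) (h : deriv γ θ ≠ 0) :
    (Submodule.span ℝ {deriv γ θ}).reflection (direction N γ θ α) = direction N γ θ (-α) := by
  rw [Submodule.reflection_singleton_apply, direction, direction]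
  set d := deriv γ θ
  have hd : ‖d‖ ^ 2 ≠ 0 := pow_ne_zero _ (norm_ne_zero_iff.2 h)
  have h1 : inner ℝ d (Complex.exp (α * Complex.I) * d) = ‖d‖ ^ 2 * Real.cos α := by
    rw [← Complex.normSq_eq_norm_sq, Complex.normSq_apply, Complex.inner]
    simp [Complex.exp_ofReal_mul_I_re, Complex.exp_ofReal_mul_I_im]
    ring
  rw [inner_smul_right, h1]
  have h2 : Complex.exp (α * Complex.I) = Real.cos α + Real.sin α * Complex.I := by
    rw [Complex.exp_mul_I, Complex.ofReal_cos, Complex.ofReal_sin]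
  have h3 : Complex.exp ((-α : ℝ) * Complex.I) = Real.cos α - Real.sin α * Complex.I := by
    rw [Complex.exp_mul_I, ← Complex.ofReal_cos, ← Complex.ofReal_sin, Real.cos_neg, Real.sin_neg]
    push_cast
    ring
  rw [h2, h3]
  simp only [RCLike.ofReal_real_eq_id, id]
  rw [mul_div_assoc, mul_div_cancel_left₀ _ hd]
  simp only [Complex.real_smul, two_smul]
  push_cast
  ring

theorem direction_add_pi (γ : ℝ → ℂ) (N : ℂ → ℝ) (θ α : ℝ) :
    direction N γ θ (π + α) = -direction N γ θ α := by
  rw [direction, direction, Complex.ofReal_add, add_mul, Complex.exp_add, Complex.exp_pi_mul_I]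
  simp

theorem norm_direction (γ : ℝ → ℂ) {N : ℂ → ℝ} (hpos : ∀ x, 0 < N x) (θ α : ℝ)
    (h : deriv γ θ ≠ 0) : N (γ θ) * ‖direction N γ θ α‖ = 1 := by
  have h1 : 0 < ‖deriv γ θ‖ := norm_pos_iff.2 h
  have h2 := hpos (γ θ)
  rw [direction, norm_smul, norm_mul, Complex.norm_exp_ofReal_mul_I, Real.norm_of_nonneg
    (by positivity)]
  field_simp

theorem direction_div (γ : ℝ → ℂ) (N : ℂ → ℝ) (θ α : ℝ) (h : deriv γ θ ≠ 0) :
    direction N γ θ α / deriv γ θ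
      = ((N (γ θ) * ‖deriv γ θ‖)⁻¹ : ℝ) * Complex.exp (α * Complex.I) := by
  rw [direction, Complex.real_smul, ← mul_assoc, mul_div_cancel_right₀ _ h]

theorem smul_direction_arg (γ : ℝ → ℂ) {N : ℂ → ℝ} (hpos : ∀ x, 0 < N x) (θ : ℝ)
    (h : deriv γ θ ≠ 0) (w : ℂ) :
    (N (γ θ) * ‖w‖) • direction N γ θ (w / deriv γ θ).arg = w := by
  have h1 : ‖deriv γ θ‖ ≠ 0 := norm_ne_zero_iff.2 h
  have h2 := (hpos (γ θ)).ne'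
  have h3 : w = ((‖w‖ / ‖deriv γ θ‖ : ℝ) : ℂ) *
      Complex.exp ((w / deriv γ θ).arg * Complex.I) * deriv γ θ := by
    rw [← norm_div, Complex.norm_mul_exp_arg_mul_I, div_mul_cancel₀ _ h]
  conv_rhs => rw [h3]
  have h4 : N (γ θ) * ‖w‖ * (N (γ θ) * ‖deriv γ θ‖)⁻¹ = ‖w‖ / ‖deriv γ θ‖ := by field_simp
  rw [direction, smul_smul, h4, Complex.real_smul, ← mul_assoc]

theorem arg_smul_direction_div (γ : ℝ → ℂ) {N : ℂ → ℝ} (hpos : ∀ x, 0 < N x) {θ α L : ℝ}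
    (h : deriv γ θ ≠ 0) (hL : 0 < L) (hα : α ∈ Ioc (-π) π) :
    ((L • direction N γ θ α) / deriv γ θ).arg = α := by
  have h1 : 0 < ‖deriv γ θ‖ := norm_pos_iff.2 h
  have h2 := hpos (γ θ)
  rw [smul_div_assoc, direction_div _ _ _ _ h, Complex.real_smul, ← mul_assoc,
    ← Complex.ofReal_mul, Complex.arg_real_mul _ (by positivity), Complex.arg_exp_mul_I]
  exact (toIocMod_eq_self _).2 (by rwa [show -π + 2 * π = π by ring])

theorem im_direction_div_pos (γ : ℝ → ℂ) {N : ℂ → ℝ} (hpos : ∀ x, 0 < N x) {θ α : ℝ}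
    (h : deriv γ θ ≠ 0) (hα : α ∈ Ioo 0 π) : 0 < (direction N γ θ α / deriv γ θ).im := by
  have h1 : 0 < ‖deriv γ θ‖ := norm_pos_iff.2 h
  have h2 := hpos (γ θ)
  rw [direction_div _ _ _ _ h, Complex.im_ofReal_mul, Complex.exp_ofReal_mul_I_im]
  have := Real.sin_pos_of_mem_Ioo hα
  positivity

theorem arg_mem_Ioo {z : ℂ} (h : 0 < z.im) : z.arg ∈ Ioo 0 π := by
  refine ⟨lt_of_le_of_ne (Complex.arg_nonneg_iff.2 h.le) fun h0 => ?_,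
    Complex.arg_lt_pi_iff.2 (Or.inr h.ne')⟩
  exact h.ne' (Complex.arg_eq_zero_iff.1 h0.symm).2

theorem neg_arg_mem_Ioo {z : ℂ} (h : z.im < 0) : -z.arg ∈ Ioo 0 π := by
  have h1 := Complex.arg_neg_iff.2 h
  have h2 := Complex.neg_pi_lt_arg z
  constructor <;> linarith

theorem periodic_deriv (hγ : IsSimpleClosedCurve m γ) : Function.Periodic (deriv γ) (2 * π) := by
  intro θ
  have : (fun x => γ (x + 2 * π)) = γ := funext hγ.periodic
  rw [← deriv_comp_add_const, this]

theorem IsSimpleClosedCurve.direction_add_zsmul (hγ : IsSimpleClosedCurve m γ) (θ α : ℝ) (j : ℤ) :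
    direction N γ (θ + j • (2 * π)) α = direction N γ θ α := by
  rw [direction, direction, hγ.periodic.zsmul j, (periodic_deriv hγ).zsmul j]

theorem IsSimpleClosedCurve.nextImpact_add_zsmul (hγ : IsSimpleClosedCurve m γ)
    {θ₀ α₀ θ₁ α₁ : ℝ} (i j : ℤ) :
    NextImpact N γ (θ₀ + i • (2 * π)) α₀ (θ₁ + j • (2 * π)) α₁ ↔ NextImpact N γ θ₀ α₀ θ₁ α₁ := by
  simp only [NextImpact, hγ.periodic.zsmul i _, hγ.periodic.zsmul j _, hγ.direction_add_zsmul,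
    (periodic_deriv hγ).zsmul j _]

/-- Reversal of the direction of time. -/
theorem NextImpact.reverse (hreg : ∀ θ, deriv γ θ ≠ 0) {θ₀ α₀ θ₁ α₁ : ℝ}
    (h : NextImpact N γ θ₀ α₀ θ₁ α₁) : NextImpact N γ θ₁ (π - α₁) θ₀ (π - α₀) := by
  obtain ⟨η, t₁, s, ht₁, hs, hI, hη, h0, h1, hin, h2, h3⟩ := h
  obtain ⟨hg, hd⟩ := hη.comp_affine hs (-1) t₁
  have hm : ∀ t ∈ Icc 0 t₁, -1 * t + t₁ ∈ Icc 0 t₁ := fun t ht =>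
    ⟨by linarith [ht.2], by linarith [ht.1]⟩
  have hsub : Icc 0 t₁ ⊆ (fun t => -1 * t + t₁) ⁻¹' s := fun t ht => hI (hm t ht)
  refine ⟨fun t => η (-1 * t + t₁), t₁, _, ht₁, hs.preimage (by fun_prop), hsub, hg, ?_, ?_, ?_,
    ?_, ?_⟩
  · simpa using h2
  · have h4 : deriv η t₁ = direction N γ θ₁ (-α₁) := by
      rw [← Submodule.reflection_reflection (Submodule.span ℝ {deriv γ θ₁}) (deriv η t₁), h3,
        reflection_smul_direction _ _ _ _ (hreg _)]
    rw [hd 0 (hsub ⟨le_rfl, ht₁.le⟩), mul_zero, zero_add, h4, sub_eq_add_neg, direction_add_pi,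
      neg_one_smul]
  · intro t ht
    exact hin _ ⟨by linarith [ht.2], by linarith [ht.1]⟩
  · simpa using h0
  · rw [hd t₁ (hsub ⟨ht₁.le, le_rfl⟩), neg_one_mul, neg_add_cancel, h1, neg_one_smul, map_neg,
      reflection_smul_direction _ _ _ _ (hreg _), sub_eq_add_neg, direction_add_pi]

end Direction

/-! ### Chords and their correspondence with impacts -/

section Chords

/-- A billiard table: a curve of positive geodesic curvature that lies, together with the region
it bounds, in a totally normal neighbourhood. -/
structure BilliardTable (N : ℂ → ℝ) (W : Set ℂ) (δ : ℝ) (e : ℂ → OpenPartialHomeomorph ℂ ℂ)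
    (m : ℕ) (γ : ℝ → ℂ) : Prop where
  normal : NormalData N W δ e
  curve : IsSimpleClosedCurve m γ
  two_le : 2 ≤ m
  subset : region γ ∪ range γ ⊆ W
  curvature_pos : ∀ θ, 0 < geodesicCurvature N γ θ

/-- The initial velocity of the geodesic that joins two points of the curve in unit time. -/
noncomputable def chordVec (e : ℂ → OpenPartialHomeomorph ℂ ℂ) (γ : ℝ → ℂ) (θ₀ θ₁ : ℝ) : ℂ :=
  (e (γ θ₀)).symm (γ θ₁)

/-- The final velocity of the geodesic that joins two points of the curve in unit time. -/
noncomputable def arrivalVec (e : ℂ → OpenPartialHomeomorph ℂ ℂ) (γ : ℝ → ℂ) (θ₀ θ₁ : ℝ) : ℂ :=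
  fderiv ℝ (e (γ θ₀)) (chordVec e γ θ₀ θ₁) (chordVec e γ θ₀ θ₁)

/-- The angle of departure of a chord. -/
noncomputable def departureAngle (e : ℂ → OpenPartialHomeomorph ℂ ℂ) (γ : ℝ → ℂ) (θ₀ θ₁ : ℝ) : ℝ :=
  (chordVec e γ θ₀ θ₁ / deriv γ θ₀).arg

/-- The angle of reflection at the end of a chord. -/
noncomputable def arrivalAngle (e : ℂ → OpenPartialHomeomorph ℂ ℂ) (γ : ℝ → ℂ) (θ₀ θ₁ : ℝ) : ℝ :=
  -(arrivalVec e γ θ₀ θ₁ / deriv γ θ₁).arg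

/-- The geodesic from `γ θ₀` to `γ θ₁` runs inside the region. -/
structure IsChord (e : ℂ → OpenPartialHomeomorph ℂ ℂ) (γ : ℝ → ℂ) (θ₀ θ₁ : ℝ) : Prop where
  lt : θ₀ < θ₁
  lt_add : θ₁ < θ₀ + 2 * π
  mem_region : ∀ t ∈ Ioo (0 : ℝ) 1, e (γ θ₀) (t • chordVec e γ θ₀ θ₁) ∈ region γ

variable {N : ℂ → ℝ} {W : Set ℂ} {δ : ℝ} {e : ℂ → OpenPartialHomeomorph ℂ ℂ} {m : ℕ} {γ : ℝ → ℂ}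
  {θ₀ θ₁ : ℝ}

namespace BilliardTable

theorem mem (B : BilliardTable N W δ e m γ) (θ : ℝ) : γ θ ∈ W :=
  B.subset (Or.inr (mem_range_self θ))

theorem chordVec_mem (B : BilliardTable N W δ e m γ) (θ₀ θ₁ : ℝ) :
    chordVec e γ θ₀ θ₁ ∈ (e (γ θ₀)).source :=
  (e (γ θ₀)).map_target (B.normal.subset _ (B.mem θ₀) (B.mem θ₁))

theorem exp_chordVec (B : BilliardTable N W δ e m γ) (θ₀ θ₁ : ℝ) :
    e (γ θ₀) (chordVec e γ θ₀ θ₁) = γ θ₁ :=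
  (e (γ θ₀)).right_inv (B.normal.subset _ (B.mem θ₀) (B.mem θ₁))

theorem chordVec_ne_zero (B : BilliardTable N W δ e m γ) (h : θ₀ < θ₁) (h' : θ₁ < θ₀ + 2 * π) :
    chordVec e γ θ₀ θ₁ ≠ 0 := by
  intro h0
  have h1 := B.exp_chordVec θ₀ θ₁
  rw [h0, B.normal.exp_zero (B.mem θ₀)] at h1
  have := B.curve.eq_of_abs_sub_lt h1 (by rw [abs_lt]; constructor <;> linarith)
  exact h.ne this

theorem arrivalVec_ne_zero (B : BilliardTable N W δ e m γ) (h : θ₀ < θ₁) (h' : θ₁ < θ₀ + 2 * π) :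
    arrivalVec e γ θ₀ θ₁ ≠ 0 := fun h0 => B.chordVec_ne_zero h h'
  ((injective_iff_map_eq_zero _).1 (B.normal.injective_fderiv (B.mem θ₀)
    (B.chordVec_mem θ₀ θ₁)) _ h0)

theorem speed_arrivalVec (B : BilliardTable N W δ e m γ) (θ₀ θ₁ : ℝ) :
    N (γ θ₁) * ‖arrivalVec e γ θ₀ θ₁‖ = N (γ θ₀) * ‖chordVec e γ θ₀ θ₁‖ := by
  have := B.normal.speed_exp (B.mem θ₀) (B.chordVec_mem θ₀ θ₁) (right_mem_Icc.2 zero_le_one)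
  rwa [one_smul, B.exp_chordVec] at this

theorem im_chordVec_pos (B : BilliardTable N W δ e m γ) (h : IsChord e γ θ₀ θ₁) :
    0 < (chordVec e γ θ₀ θ₁ / deriv γ θ₀).im := by
  obtain ⟨c, s, hs, hI, hc, h0, h1, h2, h3⟩ :=
    B.normal.exists_geodesic (B.mem θ₀) (B.chordVec_mem θ₀ θ₁)
  rw [← h1]
  refine B.curve.im_pos_of_eventually_mem B.two_le B.normal.pos B.curvature_pos hs hc
    (hI (left_mem_Icc.2 zero_le_one)) h0 (by rw [h1]; exact B.chordVec_ne_zero h.lt h.lt_add) ?_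
  filter_upwards [Ioo_mem_nhdsGT zero_lt_one] with t ht
  rw [h2 t ⟨ht.1.le, ht.2.le⟩]
  exact h.mem_region t ht

theorem im_arrivalVec_neg (B : BilliardTable N W δ e m γ) (h : IsChord e γ θ₀ θ₁) :
    (arrivalVec e γ θ₀ θ₁ / deriv γ θ₁).im < 0 := by
  obtain ⟨c, s, hs, hI, hc, h0, h1, h2, h3⟩ :=
    B.normal.exists_geodesic (B.mem θ₀) (B.chordVec_mem θ₀ θ₁)
  have h11 := right_mem_Icc.2 (zero_le_one (α := ℝ))
  have h4 : deriv c 1 = arrivalVec e γ θ₀ θ₁ := by rw [h3 1 h11, one_smul, arrivalVec]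
  rw [← h4]
  refine B.curve.im_neg_of_eventually_mem B.two_le B.normal.pos B.curvature_pos hs hc
    (hI h11) (by rw [h2 1 h11, one_smul, B.exp_chordVec])
    (by rw [h4]; exact B.arrivalVec_ne_zero h.lt h.lt_add) ?_
  filter_upwards [Ioo_mem_nhdsLT zero_lt_one] with t ht
  rw [h2 t ⟨ht.1.le, ht.2.le⟩]
  exact h.mem_region t ht

theorem departureAngle_mem (B : BilliardTable N W δ e m γ) (h : IsChord e γ θ₀ θ₁) :
    departureAngle e γ θ₀ θ₁ ∈ Ioo 0 π := arg_mem_Ioo (B.im_chordVec_pos h)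

theorem arrivalAngle_mem (B : BilliardTable N W δ e m γ) (h : IsChord e γ θ₀ θ₁) :
    arrivalAngle e γ θ₀ θ₁ ∈ Ioo 0 π := neg_arg_mem_Ioo (B.im_arrivalVec_neg h)

theorem chordVec_eq (B : BilliardTable N W δ e m γ) (θ₀ θ₁ : ℝ) :
    chordVec e γ θ₀ θ₁ = (N (γ θ₀) * ‖chordVec e γ θ₀ θ₁‖) •
      direction N γ θ₀ (departureAngle e γ θ₀ θ₁) :=
  (smul_direction_arg γ B.normal.pos θ₀ (B.curve.regular θ₀) _).symm

theorem arrivalVec_eq (B : BilliardTable N W δ e m γ) (θ₀ θ₁ : ℝ) :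
    arrivalVec e γ θ₀ θ₁ = (N (γ θ₀) * ‖chordVec e γ θ₀ θ₁‖) •
      direction N γ θ₁ (-arrivalAngle e γ θ₀ θ₁) := by
  rw [← B.speed_arrivalVec, arrivalAngle, neg_neg]
  exact (smul_direction_arg γ B.normal.pos θ₁ (B.curve.regular θ₁) _).symm

theorem length_pos (B : BilliardTable N W δ e m γ) (h : θ₀ < θ₁) (h' : θ₁ < θ₀ + 2 * π) :
    0 < N (γ θ₀) * ‖chordVec e γ θ₀ θ₁‖ :=
  mul_pos (B.normal.pos _) (norm_pos_iff.2 (B.chordVec_ne_zero h h'))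

/-- The chord is parametrized by unit time. Dividing time by its length `L` gives the unit-speed
geodesic required by the billiard. -/
theorem nextImpact (B : BilliardTable N W δ e m γ) (h : IsChord e γ θ₀ θ₁) :
    NextImpact N γ θ₀ (departureAngle e γ θ₀ θ₁) θ₁ (arrivalAngle e γ θ₀ θ₁) := by
  obtain ⟨c, s, hs, hI, hc, h0, h1, h2, h3⟩ :=
    B.normal.exists_geodesic (B.mem θ₀) (B.chordVec_mem θ₀ θ₁)
  have h11 := right_mem_Icc.2 (zero_le_one (α := ℝ))
  set L := N (γ θ₀) * ‖chordVec e γ θ₀ θ₁‖ with hL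
  have hL0 : 0 < L := B.length_pos h.lt h.lt_add
  obtain ⟨hg, hd⟩ := hc.comp_affine hs L⁻¹ 0
  have hm : ∀ t ∈ Icc 0 L, L⁻¹ * t + 0 ∈ Icc (0 : ℝ) 1 := fun t ht => by
    rw [add_zero, inv_mul_eq_div]
    exact ⟨div_nonneg ht.1 hL0.le, (div_le_one hL0).2 ht.2⟩
  have hsub : Icc 0 L ⊆ (fun t => L⁻¹ * t + 0) ⁻¹' s := fun t ht => hI (hm t ht)
  refine ⟨fun t => c (L⁻¹ * t + 0), L, _, hL0, hs.preimage (by fun_prop), hsub, hg, ?_, ?_, ?_,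
    ?_, ?_⟩
  · simpa using h0
  · rw [hd 0 (hsub ⟨le_rfl, hL0.le⟩), mul_zero, zero_add, h1, B.chordVec_eq, ← hL, smul_smul,
      inv_mul_cancel₀ hL0.ne', one_smul]
  · intro t ht
    have h4 : L⁻¹ * t + 0 ∈ Ioo (0 : ℝ) 1 := by
      rw [add_zero, inv_mul_eq_div]
      exact ⟨div_pos ht.1 hL0, (div_lt_one hL0).2 ht.2⟩
    show c (L⁻¹ * t + 0) ∈ region γ
    rw [h2 _ ⟨h4.1.le, h4.2.le⟩]
    exact h.mem_region _ h4
  · simp only [inv_mul_cancel₀ hL0.ne', add_zero]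
    rw [h2 1 h11, one_smul, B.exp_chordVec]
  · rw [hd L (hsub ⟨hL0.le, le_rfl⟩), inv_mul_cancel₀ hL0.ne', add_zero, h3 1 h11, one_smul]
    have := B.arrivalVec_eq θ₀ θ₁
    rw [arrivalVec, ← hL] at this
    rw [this, smul_smul, inv_mul_cancel₀ hL0.ne', one_smul,
      reflection_smul_direction _ _ _ _ (B.curve.regular _), neg_neg]

/-- Geodesics leave the region before they reach the radius of the normal neighbourhood. -/
theorem exists_radius (B : BilliardTable N W δ e m γ) {q : ℂ} (hq : q ∈ W) :
    ∃ r < δ, ∀ v ∈ (e q).source, e q v ∈ region γ ∪ range γ → N q * ‖v‖ ≤ r := by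
  have hK := B.curve.isCompact_region_union
  have hKt : region γ ∪ range γ ⊆ (e q).target := B.subset.trans (B.normal.subset q hq)
  have hK' := hK.image_of_continuousOn ((e q).continuousOn_symm.mono hKt)
  -- The preimage of the closed region is compact in the open ball of radius `δ`. A maximum is
  -- attained there, and it is therefore strictly below `δ`.
  obtain ⟨v₀, ⟨p, hp, rfl⟩, hmax⟩ := hK'.exists_isMaxOn
    (f := fun v => N q * ‖v‖) (⟨_, _, Or.inr (mem_range_self 0), rfl⟩) (by fun_prop)
  refine ⟨N q * ‖(e q).symm p‖, (B.normal.mem_source hq).1 ((e q).map_target (hKt hp)), ?_⟩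
  intro v hv hvK
  exact hmax ⟨_, hvK, (e q).left_inv hv⟩

/-- Once the flight time is known to be below `δ`, the flight is the image of a ray in the normal
ball and injectivity of `exp` identifies its vector with the chord vector. Injectivity also excludes
a return to the starting point. -/
theorem isChord_of_nextImpact (B : BilliardTable N W δ e m γ) {α₀ α₁ : ℝ} (hα₀ : α₀ ∈ Ioo 0 π)
    (hα₁ : α₁ ∈ Ioo 0 π) (h : NextImpact N γ θ₀ α₀ θ₁ α₁) :
    ∃ j : ℤ, IsChord e γ θ₀ (θ₁ + j • (2 * π)) ∧
      departureAngle e γ θ₀ (θ₁ + j • (2 * π)) = α₀ ∧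
      arrivalAngle e γ θ₀ (θ₁ + j • (2 * π)) = α₁ := by
  obtain ⟨η, t₁, s, ht₁, hs, hI, hη, h0, h1, hin, h2, h3⟩ := h
  set u := direction N γ θ₀ α₀ with hu
  have hq := B.mem θ₀
  have hNu : N (γ θ₀) * ‖u‖ = 1 := norm_direction γ B.normal.pos θ₀ α₀ (B.curve.regular θ₀)
  have hsrc : ∀ t, 0 ≤ t → (t • u ∈ (e (γ θ₀)).source ↔ t < δ) := fun t ht => by
    rw [B.normal.mem_source hq, norm_smul, Real.norm_of_nonneg ht, mul_left_comm, hNu, mul_one]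
  obtain ⟨r, hr, hmax⟩ := B.exists_radius hq
  have hlt : t₁ < δ := by
    by_contra hle
    rw [not_lt] at hle
    have hδ := B.normal.radius_pos
    -- A time strictly between `r` and `δ`: a longer flight would still be in the region at this
    -- moment, against the radius bound.
    set t := (max r 0 + δ) / 2 with ht
    have hm : max r 0 < δ := max_lt hr hδ
    have ht0 : 0 < t := by have := le_max_right r 0; linarith
    have htr : r < t := by have := le_max_left r 0; linarith
    have htd : t < δ := by linarith
    have h4 : t • u ∈ (e (γ θ₀)).source := (hsrc t ht0.le).2 htd
    have h5 := B.normal.exp_smul hq hs hη h0 h1 ht0.le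
      ((Icc_subset_Icc_right (by linarith)).trans hI) h4
    have h6 := hmax _ h4 (Or.inl (by rw [h5]; exact hin t ⟨ht0, by linarith⟩))
    rw [norm_smul, Real.norm_of_nonneg ht0.le, mul_left_comm, hNu, mul_one] at h6
    linarith
  have h4 : t₁ • u ∈ (e (γ θ₀)).source := (hsrc t₁ ht₁.le).2 hlt
  have h5 := B.normal.exp_smul hq hs hη h0 h1 ht₁.le hI h4
  rw [h2] at h5
  have hu0 : t₁ • u ≠ 0 := by
    refine smul_ne_zero ht₁.ne' fun hu0 => ?_
    rw [hu0, norm_zero, mul_zero] at hNu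
    exact zero_ne_one hNu
  have hne : γ θ₁ ≠ γ θ₀ := by
    intro h6
    rw [h6, ← B.normal.exp_zero hq] at h5
    rw [B.normal.exp_zero hq] at h5
    exact hu0 ((e (γ θ₀)).injOn h4 (B.normal.zero_mem_source hq)
      (by rw [h5, B.normal.exp_zero hq]))
  have hmem := toIcoMod_mem_Ico two_pi_pos θ₀ θ₁
  have heq : toIcoMod two_pi_pos θ₀ θ₁ = θ₁ + (-toIcoDiv two_pi_pos θ₀ θ₁) • (2 * π) := by
    rw [toIcoMod, neg_smul, sub_eq_add_neg]
  have hγe : γ (toIcoMod two_pi_pos θ₀ θ₁) = γ θ₁ := by rw [heq, B.curve.periodic.zsmul]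
  have hγd : deriv γ (toIcoMod two_pi_pos θ₀ θ₁) = deriv γ θ₁ := by
    rw [heq, (periodic_deriv B.curve).zsmul]
  refine ⟨-toIcoDiv two_pi_pos θ₀ θ₁, ?_⟩
  rw [← heq]
  have hw : chordVec e γ θ₀ (toIcoMod two_pi_pos θ₀ θ₁) = t₁ • u := by
    rw [chordVec, hγe, ← h5, (e (γ θ₀)).left_inv h4]
  refine ⟨⟨lt_of_le_of_ne hmem.1 fun h6 => hne (by rw [← hγe, ← h6]), hmem.2, ?_⟩, ?_, ?_⟩
  · intro t ht
    have h6 : t * t₁ ∈ Ioo 0 t₁ := ⟨mul_pos ht.1 ht₁, mul_lt_of_lt_one_left ht₁ ht.2⟩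
    rw [hw, smul_smul, B.normal.exp_smul hq hs hη h0 h1 h6.1.le
      ((Icc_subset_Icc_right h6.2.le).trans hI) ((hsrc _ h6.1.le).2 (h6.2.trans hlt))]
    exact hin _ h6
  · rw [departureAngle, hw]
    exact arg_smul_direction_div γ B.normal.pos (B.curve.regular θ₀) ht₁
      ⟨by linarith [hα₀.1, pi_pos], hα₀.2.le⟩
  · have h6 : deriv η t₁ = direction N γ θ₁ (-α₁) := by
      rw [← Submodule.reflection_reflection (Submodule.span ℝ {deriv γ θ₁}) (deriv η t₁), h3,
        reflection_smul_direction _ _ _ _ (B.curve.regular _)]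
    have h7 := B.normal.deriv_eq hq hs hη h0 h1 ht₁ hI h4 (right_mem_Icc.2 ht₁.le)
    rw [arrivalAngle, arrivalVec, hw, map_smul, ← h7, h6, hγd,
      arg_smul_direction_div γ B.normal.pos (B.curve.regular θ₁) ht₁
        ⟨by linarith [hα₁.2], by linarith [hα₁.1, pi_pos]⟩, neg_neg]

/-- The ray enters the region by transversality and is outside the closed region at some time below
`δ`. The first exit lies on the curve. -/
theorem exists_isChord (B : BilliardTable N W δ e m γ) (θ₀ : ℝ) {α₀ : ℝ} (hα₀ : α₀ ∈ Ioo 0 π) :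
    ∃ θ₁, IsChord e γ θ₀ θ₁ ∧ departureAngle e γ θ₀ θ₁ = α₀ := by
  set u := direction N γ θ₀ α₀ with hu
  have hq := B.mem θ₀
  have hNu : N (γ θ₀) * ‖u‖ = 1 := norm_direction γ B.normal.pos θ₀ α₀ (B.curve.regular θ₀)
  have hsrc : ∀ t, 0 ≤ t → (t • u ∈ (e (γ θ₀)).source ↔ t < δ) := fun t ht => by
    rw [B.normal.mem_source hq, norm_smul, Real.norm_of_nonneg ht, mul_left_comm, hNu, mul_one]
  obtain ⟨r, hr, hmax⟩ := B.exists_radius hq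
  have hδ := B.normal.radius_pos
  set f : ℝ → ℂ := fun t => e (γ θ₀) (t • u) with hf
  have hfc : ContinuousOn f (Ico 0 δ) :=
    (e (γ θ₀)).continuousOn.comp (by fun_prop) fun t ht => (hsrc t ht.1).2 ht.2
  have hstart : ∀ᶠ t in 𝓝[>] (0 : ℝ), f t ∈ region γ := by
    have h1 : HasDerivAt f u 0 := by
      have h2 : HasFDerivAt (e (γ θ₀)) (ContinuousLinearMap.id ℝ ℂ) ((0 : ℝ) • u) := by
        rw [← B.normal.fderiv_exp_zero hq, zero_smul]
        exact B.normal.hasFDerivAt hq (B.normal.zero_mem_source hq)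
      have := h2.comp_hasDerivAt (0 : ℝ) ((hasDerivAt_id (0 : ℝ)).smul_const u)
      rw [one_smul] at this
      exact this
    refine (B.curve.eventually_mem_region (by have := B.two_le; omega) h1 ?_
      (im_direction_div_pos γ B.normal.pos (B.curve.regular θ₀) hα₀)).1
    rw [hf]
    simp only [zero_smul]
    exact B.normal.exp_zero hq
  obtain ⟨ε, hε0, hε⟩ := mem_nhdsGT_iff_exists_Ioo_subset.1 hstart
  set T := (max r 0 + δ) / 2 with hT
  have hm : max r 0 < δ := max_lt hr hδ
  have hT0 : 0 < T := by have := le_max_right r 0; linarith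
  have hrT : r < T := by have := le_max_left r 0; linarith
  have hTd : T < δ := by linarith
  have hfT : f T ∉ region γ ∪ range γ := by
    intro h
    have h6 := hmax _ ((hsrc T hT0.le).2 hTd) h
    rw [norm_smul, Real.norm_of_nonneg hT0.le, mul_left_comm, hNu, mul_one] at h6
    linarith
  have hεT : ε ≤ T := by
    by_contra h
    exact hfT (Or.inl (hε ⟨hT0, not_le.1 h⟩))
  have hε0' : 0 < ε := hε0
  have hcS : ContinuousOn f (Icc ε T) :=
    hfc.mono fun t ht => ⟨hε0'.le.trans ht.1, ht.2.trans_lt hTd⟩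
  -- Times before `ε` are left out: the starting point is itself outside the open region and would
  -- otherwise be the least element.
  have hS : IsCompact (Icc ε T ∩ f ⁻¹' (region γ)ᶜ) :=
    isCompact_Icc.of_isClosed_subset
      (hcS.preimage_isClosed_of_isClosed isClosed_Icc B.curve.isOpen_region.isClosed_compl)
      inter_subset_left
  obtain ⟨t₁, ⟨ht₁, hft₁⟩, hmin⟩ := hS.exists_isLeast
    ⟨T, right_mem_Icc.2 hεT, fun h => hfT (Or.inl h)⟩
  have ht0 : 0 < t₁ := hε0'.trans_le ht₁.1
  have htd : t₁ < δ := ht₁.2.trans_lt hTd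
  have hbefore : ∀ t ∈ Ioo 0 t₁, f t ∈ region γ := by
    intro t ht
    by_contra hnot
    by_cases hte : t < ε
    · exact hnot (hε ⟨ht.1, hte⟩)
    · exact absurd (hmin ⟨⟨not_lt.1 hte, ht.2.le.trans ht₁.2⟩, hnot⟩) (not_le.2 ht.2)
  have hrange : f t₁ ∈ range γ := by
    have h1 : f t₁ ∈ region γ ∪ range γ := by
      rw [← B.curve.isClosed_region_union.closure_eq]
      have h2 : ContinuousWithinAt f (Ioo 0 t₁) t₁ :=
        (hfc t₁ ⟨ht0.le, htd⟩).mono fun t ht => ⟨ht.1.le, ht.2.trans htd⟩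
      refine closure_mono subset_union_left (h2.mem_closure ?_ hbefore)
      rw [closure_Ioo ht0.ne]
      exact right_mem_Icc.2 ht0.le
    exact h1.resolve_left hft₁
  obtain ⟨θ', hθ'⟩ := hrange
  have h4 : t₁ • u ∈ (e (γ θ₀)).source := (hsrc t₁ ht0.le).2 htd
  have hu0 : t₁ • u ≠ 0 := by
    refine smul_ne_zero ht0.ne' fun hu0 => ?_
    rw [hu0, norm_zero, mul_zero] at hNu
    exact zero_ne_one hNu
  obtain ⟨θ₁, hθ₁, hθe⟩ := B.curve.periodic.exists_mem_Ico two_pi_pos θ' θ₀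
  have hγθ₁ : γ θ₁ = f t₁ := by rw [← hθe, hθ']
  have hw : chordVec e γ θ₀ θ₁ = t₁ • u := by
    rw [chordVec, hγθ₁, (e (γ θ₀)).left_inv h4]
  refine ⟨θ₁, ⟨lt_of_le_of_ne hθ₁.1 fun h => ?_, hθ₁.2, fun t ht => ?_⟩, ?_⟩
  · rw [← h] at hγθ₁
    have h5 : e (γ θ₀) (t₁ • u) = γ θ₀ := hγθ₁.symm
    exact hu0 ((e (γ θ₀)).injOn h4 (B.normal.zero_mem_source hq)
      (h5.trans (B.normal.exp_zero hq).symm))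
  · rw [hw, smul_smul]
    exact hbefore _ ⟨mul_pos ht.1 ht0, mul_lt_of_lt_one_left ht0 ht.2⟩
  · rw [departureAngle, hw]
    exact arg_smul_direction_div γ B.normal.pos (B.curve.regular θ₀) ht0
      ⟨by linarith [hα₀.1, pi_pos], hα₀.2.le⟩

/-- Two chords with the same start and angle lie on one ray. If their lengths differed, the end of
the shorter, a point of the curve, would be interior to the longer. -/
theorem chord_unique (B : BilliardTable N W δ e m γ) {θ₁' : ℝ} (h : IsChord e γ θ₀ θ₁)
    (h' : IsChord e γ θ₀ θ₁') (heq : departureAngle e γ θ₀ θ₁ = departureAngle e γ θ₀ θ₁') :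
    θ₁ = θ₁' := by
  have key : ∀ {a b : ℝ}, IsChord e γ θ₀ a → IsChord e γ θ₀ b →
      departureAngle e γ θ₀ a = departureAngle e γ θ₀ b →
      N (γ θ₀) * ‖chordVec e γ θ₀ b‖ ≤ N (γ θ₀) * ‖chordVec e γ θ₀ a‖ := by
    intro a b ha hb hab
    by_contra hlt
    rw [not_le] at hlt
    have hLa := B.length_pos ha.lt ha.lt_add
    have hLb := B.length_pos hb.lt hb.lt_add
    have hva := B.chordVec_eq θ₀ a
    have hvb := B.chordVec_eq θ₀ b
    set La := N (γ θ₀) * ‖chordVec e γ θ₀ a‖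
    set Lb := N (γ θ₀) * ‖chordVec e γ θ₀ b‖
    have h1 := hb.mem_region (La / Lb) ⟨div_pos hLa hLb, (div_lt_one hLb).2 hlt⟩
    rw [hvb, smul_smul, div_mul_cancel₀ _ hLb.ne', ← hab, ← hva, B.exp_chordVec] at h1
    exact h1.1 (mem_range_self a)
  have hL := le_antisymm (key h' h heq.symm) (key h h' heq)
  have hv : chordVec e γ θ₀ θ₁ = chordVec e γ θ₀ θ₁' := by
    rw [B.chordVec_eq θ₀ θ₁, B.chordVec_eq θ₀ θ₁', hL, heq]
  have hγe : γ θ₁ = γ θ₁' := by rw [← B.exp_chordVec θ₀ θ₁, hv, B.exp_chordVec]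
  exact B.curve.eq_of_abs_sub_lt hγe (by
    rw [abs_lt]; constructor <;> linarith [h.lt, h.lt_add, h'.lt, h'.lt_add])

end BilliardTable

end Chords

/-! ### Determinants, signs and arguments -/

section Determinants

theorem det_prod_real (L : ℝ × ℝ →L[ℝ] ℝ × ℝ) :
    L.det = (L (1, 0)).1 * (L (0, 1)).2 - (L (0, 1)).1 * (L (1, 0)).2 := by
  rw [ContinuousLinearMap.det, ← LinearMap.det_toMatrix (Module.Basis.finTwoProd ℝ),
    Matrix.det_fin_two]
  simp [LinearMap.toMatrix_apply]

/-- `Im (conj a * b)` is the area form of the plane. This carries the orientation of a pair of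
vectors across the derivative of `exp`. -/
theorem im_conj_mul_map (L : ℂ →L[ℝ] ℂ) (a b : ℂ) :
    ((starRingEnd ℂ) (L a) * L b).im = L.det * ((starRingEnd ℂ) a * b).im := by
  have hL : ∀ z : ℂ, L z = z.re • L 1 + z.im • L Complex.I := fun z => by
    rw [← map_smul, ← map_smul, ← map_add]
    congr 1
    simp [Complex.re_add_im]
  have hdet : L.det = (L 1).re * (L Complex.I).im - (L Complex.I).re * (L 1).im := by
    rw [ContinuousLinearMap.det, ← LinearMap.det_toMatrix Complex.basisOneI, Matrix.det_fin_two]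
    simp [LinearMap.toMatrix_apply]
  rw [hdet, hL a, hL b]
  simp
  ring

/-- A function which vanishes on a level of the last variable and increases strictly through it
has the expected sign nearby. -/
theorem eventually_sign_of_hasStrictFDerivAt {Z : Type*} [NormedAddCommGroup Z] [NormedSpace ℝ Z]
    {G : Z × ℝ → ℝ} {G' : Z × ℝ →L[ℝ] ℝ} {z : Z} {t : ℝ} (hG : HasStrictFDerivAt G G' (z, t))
    (hpos : 0 < G' (0, 1)) (h0 : ∀ᶠ z' in 𝓝 z, G (z', t) = 0) :
    ∀ᶠ p in 𝓝 (z, t), (t < p.2 → 0 < G p) ∧ (p.2 < t → G p < 0) := by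
  set d := G' (0, 1) with hd
  -- Strict differentiability allows each nearby `p` to be compared with `(p.1, t)`, where `G`
  -- vanishes, instead of with the base point. The tolerance of half the slope preserves the sign.
  have h1 := hG.isLittleO.def (half_pos hpos)
  have h2 : Tendsto (fun p : Z × ℝ => (p, (p.1, t))) (𝓝 (z, t)) (𝓝 ((z, t), (z, t))) := by
    have : ContinuousAt (fun p : Z × ℝ => (p, (p.1, t))) (z, t) := by fun_prop
    exact this
  have hfst : Tendsto (fun p : Z × ℝ => p.1) (𝓝 (z, t)) (𝓝 z) := continuous_fst.continuousAt
  have h3 : ∀ᶠ p in 𝓝 (z, t), G (p.1, t) = 0 := hfst.eventually h0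
  filter_upwards [h2.eventually h1, h3] with p hp hp0
  have h4 : p - (p.1, t) = (p.2 - t) • ((0 : Z), (1 : ℝ)) := by
    ext <;> simp
  have h5 : ‖(p.2 - t) • ((0 : Z), (1 : ℝ))‖ = |p.2 - t| := by
    rw [norm_smul, Prod.norm_mk, norm_zero, norm_one, max_eq_right zero_le_one, mul_one,
      Real.norm_eq_abs]
  rw [hp0, h4, h5, map_smul, ← hd, sub_zero, smul_eq_mul, Real.norm_eq_abs] at hp
  have h6 := abs_le.1 hp
  constructor
  · intro h
    rw [abs_of_pos (sub_pos.2 h)] at h6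
    nlinarith [h6.1, mul_pos hpos (sub_pos.2 h)]
  · intro h
    rw [abs_of_neg (sub_neg.2 h)] at h6
    nlinarith [h6.2, mul_pos hpos (sub_pos.2 h)]

theorem contDiffAt_arg {E : Type*} [NormedAddCommGroup E] [NormedSpace ℝ E] {n : WithTop ℕ∞}
    {f : E → ℂ} {x : E} (hf : ContDiffAt ℝ n f x) (h : (f x).im ≠ 0) :
    ContDiffAt ℝ n (fun x => (f x).arg) x := by
  have h1 : ContDiffAt ℝ n Complex.log (f x) :=
    (Complex.contDiffAt_log (Complex.mem_slitPlane_iff.2 (Or.inr h))).restrict_scalars ℝ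
  have h2 := Complex.imCLM.contDiff.contDiffAt.comp x (h1.comp x hf)
  exact h2.congr_of_eventuallyEq (Eventually.of_forall fun y => (Complex.log_im _).symm)

theorem contDiffAt_div_complex {E : Type*} [NormedAddCommGroup E] [NormedSpace ℝ E]
    {n : WithTop ℕ∞} {f g : E → ℂ} {x : E} (hf : ContDiffAt ℝ n f x) (hg : ContDiffAt ℝ n g x)
    (h : g x ≠ 0) : ContDiffAt ℝ n (fun x => f x / g x) x := by
  simp only [div_eq_mul_inv]
  exact hf.mul (hg.inv h)

end Determinants

/-! ### Regularity of the angles, monotonicity and the generating function -/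

section Smoothness

variable {N : ℂ → ℝ} {W : Set ℂ} {δ : ℝ} {e : ℂ → OpenPartialHomeomorph ℂ ℂ} {k : ℕ} {γ : ℝ → ℂ}
  {θ₀ θ₁ : ℝ}

namespace BilliardTable

theorem contDiff_deriv (B : BilliardTable N W δ e (k + 1) γ) : ContDiff ℝ k (deriv γ) := by
  have := B.curve.contDiff
  push_cast at this
  exact (contDiff_succ_iff_deriv.1 this).2.2

theorem contDiffAt_exp_curve (B : BilliardTable N W δ e (k + 1) γ) {E : Type*}
    [NormedAddCommGroup E] [NormedSpace ℝ E] {q v : E → ℂ} {x : E}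
    {n : ℕ} (hq : ContDiffAt ℝ n q x) (hv : ContDiffAt ℝ n v x) (hqW : q x ∈ W)
    (hvs : v x ∈ (e (q x)).source) : ContDiffAt ℝ n (fun x => e (q x) (v x)) x :=
  ((B.normal.contDiffAt_exp hqW hvs).of_le ENat.LEInfty.out).comp₂ hq hv

theorem contDiff_chordVec (B : BilliardTable N W δ e (k + 1) γ) :
    ContDiff ℝ (k + 1 : ℕ) (fun z : ℝ × ℝ => chordVec e γ z.1 z.2) := by
  rw [contDiff_iff_contDiffAt]
  intro z
  exact ((B.normal.contDiffAt_log (B.mem z.1) (B.mem z.2)).of_le ENat.LEInfty.out).comp₂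
    (B.curve.contDiff.comp contDiff_fst).contDiffAt (B.curve.contDiff.comp contDiff_snd).contDiffAt

theorem contDiff_arrivalVec (B : BilliardTable N W δ e (k + 1) γ) :
    ContDiff ℝ (k + 1 : ℕ) (fun z : ℝ × ℝ => arrivalVec e γ z.1 z.2) := by
  rw [contDiff_iff_contDiffAt]
  intro z
  have hw := B.contDiff_chordVec.contDiffAt (x := z)
  have h1 := (B.normal.contDiffAt_exp (B.mem z.1) (B.chordVec_mem z.1 z.2)).fderiv_right
    (m := ∞) (by simp)
  have h2 := (h1.of_le (m := ((k + 1 : ℕ) : WithTop ℕ∞)) ENat.LEInfty.out).comp₂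
    (B.curve.contDiff.comp contDiff_fst).contDiffAt hw
  have h3 := h2.clm_apply ((contDiffAt_const (c := (0 : ℂ))).prodMk hw)
  refine h3.congr_of_eventuallyEq (Eventually.of_forall fun y => ?_)
  exact (B.normal.fderiv_exp_snd (B.mem y.1) (B.chordVec_mem y.1 y.2) _).symm

/-- Chord vectors are as smooth as the curve; the one lost derivative comes from dividing by the
tangent. Transversality keeps the quotient off the branch cut of `arg`. -/
theorem contDiffAt_departureAngle (B : BilliardTable N W δ e (k + 1) γ) {z : ℝ × ℝ}
    (h : IsChord e γ z.1 z.2) :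
    ContDiffAt ℝ k (fun z : ℝ × ℝ => departureAngle e γ z.1 z.2) z := by
  exact contDiffAt_arg (f := fun z : ℝ × ℝ => chordVec e γ z.1 z.2 / deriv γ z.1)
    (contDiffAt_div_complex
      (B.contDiff_chordVec.of_le (Nat.cast_le.2 k.le_succ)).contDiffAt
      (B.contDiff_deriv.comp contDiff_fst).contDiffAt (B.curve.regular _))
    (B.im_chordVec_pos h).ne'

theorem contDiffAt_arrivalAngle (B : BilliardTable N W δ e (k + 1) γ) {z : ℝ × ℝ}
    (h : IsChord e γ z.1 z.2) :
    ContDiffAt ℝ k (fun z : ℝ × ℝ => arrivalAngle e γ z.1 z.2) z := by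
  exact (contDiffAt_arg (f := fun z : ℝ × ℝ => arrivalVec e γ z.1 z.2 / deriv γ z.2)
    (contDiffAt_div_complex
      (B.contDiff_arrivalVec.of_le (Nat.cast_le.2 k.le_succ)).contDiffAt
      (B.contDiff_deriv.comp contDiff_snd).contDiffAt (B.curve.regular _))
    (B.im_arrivalVec_neg h).ne).neg

/-- The chords form an open set. -/
theorem isOpen_chord (B : BilliardTable N W δ e (k + 1) γ) :
    IsOpen {z : ℝ × ℝ | IsChord e γ z.1 z.2} := by
  rw [isOpen_iff_mem_nhds]
  intro z hz
  have hk1 : ((k + 1 : ℕ) : WithTop ℕ∞) ≠ 0 := by exact_mod_cast k.succ_ne_zero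
  set f : (ℝ × ℝ) × ℝ → ℂ := fun p => e (γ p.1.1) (p.2 • chordVec e γ p.1.1 p.1.2) with hf
  have hw : ContDiff ℝ (k + 1 : ℕ) (fun p : (ℝ × ℝ) × ℝ => chordVec e γ p.1.1 p.1.2) :=
    B.contDiff_chordVec.comp contDiff_fst
  have hγ : ContDiff ℝ (k + 1 : ℕ) (fun p : (ℝ × ℝ) × ℝ => γ p.1.1) :=
    B.curve.contDiff.comp (contDiff_fst.comp contDiff_fst)
  have hfc : ∀ t ∈ Icc (0 : ℝ) 1, ContDiffAt ℝ (k + 1 : ℕ) f (z, t) := fun t ht =>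
    B.contDiffAt_exp_curve hγ.contDiffAt (contDiff_snd.smul hw).contDiffAt (B.mem _)
      (B.normal.smul_mem_source (B.mem _) (B.chordVec_mem _ _) ht)
  have hf0 : ∀ z' : ℝ × ℝ, f (z', 0) = γ z'.1 := fun z' => by
    simp only [hf, zero_smul]
    exact B.normal.exp_zero (B.mem _)
  have hf1 : ∀ z' : ℝ × ℝ, f (z', 1) = γ z'.2 := fun z' => by
    simp only [hf, one_smul]
    exact B.exp_chordVec _ _
  have hfd : ∀ t ∈ Icc (0 : ℝ) 1, fderiv ℝ f (z, t) (0, 1)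
      = fderiv ℝ (e (γ z.1)) (t • chordVec e γ z.1 z.2) (chordVec e γ z.1 z.2) := by
    intro t ht
    have h1 : HasDerivAt (fun t : ℝ => (z, t)) ((0 : ℝ × ℝ), (1 : ℝ)) t :=
      (hasDerivAt_const _ _).prodMk (hasDerivAt_id _)
    have h2 := ((hfc t ht).differentiableAt hk1).hasFDerivAt.comp_hasDerivAt
      (f := fun t : ℝ => (z, t)) t h1
    have h3 := (B.normal.hasFDerivAt (B.mem z.1) (B.normal.smul_mem_source (B.mem _)
      (B.chordVec_mem z.1 z.2) ht)).comp_hasDerivAt t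
        ((hasDerivAt_id t).smul_const (chordVec e γ z.1 z.2))
    rw [one_smul] at h3
    exact h2.unique h3
  have h01 := left_mem_Icc.2 (zero_le_one (α := ℝ))
  have h11 := right_mem_Icc.2 (zero_le_one (α := ℝ))
  -- In the open time interval the region is open. At `t = 0` and `t = 1` the point stays on the
  -- curve for every nearby pair, and transversality makes the defining function strictly monotone
  -- in time. Compactness of `[0, 1]` then gives one neighbourhood of `z`.
  have key : ∀ t ∈ Icc (0 : ℝ) 1, ∀ᶠ p in 𝓝 (z, t), p.2 ∈ Ioo (0 : ℝ) 1 → f p ∈ region γ := by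
    intro t ht
    rcases eq_or_lt_of_le ht.1 with rfl | h0
    · obtain ⟨φ, hφ, hφd, hφ0, hφr⟩ := B.curve.exists_defining_function k.succ_ne_zero z.1
      have hφ' : ContDiffAt ℝ (k + 1 : ℕ) φ (f (z, 0)) := by rw [hf0]; exact hφ
      have hG := (hφ'.comp (z, (0 : ℝ)) (hfc 0 h01)).hasStrictFDerivAt hk1
      have hd : 0 < fderiv ℝ (φ ∘ f) (z, (0 : ℝ)) (0, 1) := by
        rw [fderiv_comp _ (hφ'.differentiableAt hk1) ((hfc 0 h01).differentiableAt hk1),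
          ContinuousLinearMap.comp_apply, hfd 0 h01, hf0, hφd, zero_smul,
          B.normal.fderiv_exp_zero (B.mem _)]
        exact B.im_chordVec_pos hz
      have h3 := eventually_sign_of_hasStrictFDerivAt hG hd (by
        filter_upwards [(B.curve.contDiff.continuous.comp continuous_fst).continuousAt.eventually
          hφ0] with z' hz'
        rw [Function.comp_apply, hf0]
        exact hz'.1 (mem_range_self _))
      have h4 : ∀ᶠ p in 𝓝 (z, (0 : ℝ)), f p ∈ region γ ↔ 0 < φ (f p) :=
        (hfc 0 h01).continuousAt.eventually (by rw [hf0]; exact hφr)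
      filter_upwards [h3, h4] with p hp1 hp2 hp
      exact hp2.2 (hp1.1 hp.1)
    rcases eq_or_lt_of_le ht.2 with rfl | h1
    · obtain ⟨φ, hφ, hφd, hφ0, hφr⟩ := B.curve.exists_defining_function k.succ_ne_zero z.2
      have hφ' : ContDiffAt ℝ (k + 1 : ℕ) φ (f (z, 1)) := by rw [hf1]; exact hφ
      have hG := (hφ'.comp (z, (1 : ℝ)) (hfc 1 h11)).hasStrictFDerivAt hk1
      have hd : 0 < (-fderiv ℝ (φ ∘ f) (z, (1 : ℝ))) (0, 1) := by
        rw [fderiv_comp _ (hφ'.differentiableAt hk1) ((hfc 1 h11).differentiableAt hk1),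
          _root_.neg_apply,
          ContinuousLinearMap.comp_apply, hfd 1 h11, hf1, hφd, one_smul]
        have := B.im_arrivalVec_neg hz
        rw [arrivalVec] at this
        linarith
      have h3 := eventually_sign_of_hasStrictFDerivAt hG.neg hd (by
        filter_upwards [(B.curve.contDiff.continuous.comp continuous_snd).continuousAt.eventually
          hφ0] with z' hz'
        rw [Pi.neg_apply, Function.comp_apply, hf1, neg_eq_zero]
        exact hz'.1 (mem_range_self _))
      have h4 : ∀ᶠ p in 𝓝 (z, (1 : ℝ)), f p ∈ region γ ↔ 0 < φ (f p) :=
        (hfc 1 h11).continuousAt.eventually (by rw [hf1]; exact hφr)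
      filter_upwards [h3, h4] with p hp1 hp2 hp
      have h5 := hp1.2 hp.2
      rw [Pi.neg_apply, Function.comp_apply] at h5
      exact hp2.2 (by linarith)
    · filter_upwards [(hfc t ht).continuousAt.eventually
        (B.curve.isOpen_region.mem_nhds (hz.mem_region t ⟨h0, h1⟩))] with p hp _
      exact hp
  have h5 := isCompact_Icc.eventually_forall_of_forall_eventually
    (P := fun z t => t ∈ Ioo (0 : ℝ) 1 → f (z, t) ∈ region γ) key
  have h6 : ∀ᶠ z' : ℝ × ℝ in 𝓝 z, z'.1 < z'.2 :=
    (isOpen_lt continuous_fst continuous_snd).mem_nhds hz.lt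
  have h7 : ∀ᶠ z' : ℝ × ℝ in 𝓝 z, z'.2 < z'.1 + 2 * π :=
    (isOpen_lt continuous_snd (continuous_fst.add continuous_const)).mem_nhds hz.lt_add
  filter_upwards [h5, h6, h7] with z' h5 h6 h7
  exact ⟨h6, h7, fun t ht => h5 t ⟨ht.1.le, ht.2.le⟩ ht⟩

/-- The angle of departure increases with the end point of the chord. -/
theorem fderiv_departureAngle_pos (B : BilliardTable N W δ e (k + 1) γ) {z : ℝ × ℝ}
    (h : IsChord e γ z.1 z.2) :
    0 < fderiv ℝ (fun z : ℝ × ℝ => departureAngle e γ z.1 z.2) z (0, 1) := by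
  have hk : (k : WithTop ℕ∞) ≠ 0 := by
    have := B.two_le
    exact_mod_cast (show k ≠ 0 by omega)
  have hk1 : ((k + 1 : ℕ) : WithTop ℕ∞) ≠ 0 := by exact_mod_cast k.succ_ne_zero
  obtain ⟨x, y⟩ := z
  simp only at h
  have hl : HasDerivAt (fun t : ℝ => (x, t)) ((0 : ℝ), (1 : ℝ)) y :=
    (hasDerivAt_const _ _).prodMk (hasDerivAt_id _)
  have h1 := ((B.contDiffAt_departureAngle (z := (x, y)) h).differentiableAt hk).hasFDerivAt
    |>.comp_hasDerivAt (f := fun t : ℝ => (x, t)) y hl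
  set w := chordVec e γ x with hw
  obtain ⟨w', hw'⟩ : ∃ w', HasDerivAt w w' y :=
    ⟨_, ((B.contDiff_chordVec.differentiable hk1 (x, y)).hasFDerivAt.comp_hasDerivAt
      (f := fun t : ℝ => (x, t)) y hl)⟩
  have him := B.im_chordVec_pos h
  have hw0 : w y ≠ 0 := B.chordVec_ne_zero h.lt h.lt_add
  -- The argument is the imaginary part of the logarithm, and the constant divisor `γ' x` drops out
  -- of the logarithmic derivative.
  have h2 : HasDerivAt (fun t => departureAngle e γ x t) (w' / w y).im y := by
    have h3 := (hw'.div_const (deriv γ x)).clog_real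
      (Complex.mem_slitPlane_iff.2 (Or.inr him.ne'))
    have h4 := Complex.imCLM.hasFDerivAt.comp_hasDerivAt y h3
    rw [div_div_div_cancel_right₀ (B.curve.regular x)] at h4
    exact h4.congr_of_eventuallyEq (Eventually.of_forall fun t => (Complex.log_im _).symm)
  rw [h1.unique h2]
  set L := fderiv ℝ (e (γ x)) (w y) with hL
  -- Differentiation of `exp (w t) = γ t`. Since `L (w y)` is the arrival vector, the arrival
  -- inequality orients the image pair `L w, L w'`, and `det L > 0` transfers this to `w, w'`.
  have h3 : L w' = deriv γ y := by
    have h4 := (B.normal.hasFDerivAt (B.mem x) (B.chordVec_mem x y)).comp_hasDerivAt y hw'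
    have h5 : (e (γ x) ∘ w) = γ := funext fun t => B.exp_chordVec x t
    rw [h5] at h4
    exact h4.deriv.symm
  have hdet : 0 < L.det := B.normal.det_fderiv_pos (B.mem x) (B.chordVec_mem x y)
  have hcross := im_conj_mul_map L (w y) w'
  rw [h3] at hcross
  have harr := B.im_arrivalVec_neg h
  have hV : arrivalVec e γ x y = L (w y) := rfl
  rw [hV] at harr
  have hdiv : ∀ a b : ℂ, b ≠ 0 → (a / b).im * Complex.normSq b = ((starRingEnd ℂ) b * a).im := by
    intro a b hb
    have : Complex.normSq b ≠ 0 := (Complex.normSq_pos.2 hb).ne'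
    rw [Complex.div_im]
    field_simp
    simp
    ring
  have hp1 := Complex.normSq_pos.2 (B.curve.regular y)
  have hp2 := Complex.normSq_pos.2 hw0
  have e1 := hdiv (L (w y)) (deriv γ y) (B.curve.regular y)
  have e2 := hdiv w' (w y) hw0
  have e3 : ((starRingEnd ℂ) (L (w y)) * deriv γ y).im
      = -((starRingEnd ℂ) (deriv γ y) * L (w y)).im := by
    simp
    ring
  have h6 : 0 < L.det * ((starRingEnd ℂ) (w y) * w').im := by
    rw [← hcross, e3, ← e1]
    nlinarith
  rw [← e2] at h6
  exact (mul_pos_iff_of_pos_right hp2).1 ((mul_pos_iff_of_pos_left hdet).1 h6)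

theorem inner_eq_norm_mul_cos {a b : ℂ} (hb : b ≠ 0) :
    inner ℝ b a = ‖b‖ * ‖a‖ * Real.cos (a / b).arg := by
  have h0 : ‖b‖ ≠ 0 := norm_ne_zero_iff.2 hb
  have h1 : (a / b).re = ‖a‖ / ‖b‖ * Real.cos (a / b).arg := by
    rw [← norm_div, Complex.norm_mul_cos_arg]
  have h2 : (a / b).re = inner ℝ b a / ‖b‖ ^ 2 := by
    rw [Complex.div_re, Complex.normSq_eq_norm_sq, Complex.inner]
    simp
    ring
  have h3 := h1.symm.trans h2
  field_simp at h3
  linarith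

/-- The generating function: the differential of the length of the chords. -/
theorem hasFDerivAt_length (B : BilliardTable N W δ e (k + 1) γ) {z : ℝ × ℝ}
    (h : IsChord e γ z.1 z.2) :
    HasFDerivAt (fun z : ℝ × ℝ => √(N (γ z.1) ^ 2 * ‖chordVec e γ z.1 z.2‖ ^ 2))
      ((-(N (γ z.1) * ‖deriv γ z.1‖ * Real.cos (departureAngle e γ z.1 z.2))) •
          ContinuousLinearMap.fst ℝ ℝ ℝ
        + (N (γ z.2) * ‖deriv γ z.2‖ * Real.cos (arrivalAngle e γ z.1 z.2)) •
          ContinuousLinearMap.snd ℝ ℝ ℝ) z := by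
  have hk1 : ((k + 1 : ℕ) : WithTop ℕ∞) ≠ 0 := by exact_mod_cast k.succ_ne_zero
  have hLpos := B.length_pos h.lt h.lt_add
  set q := γ z.1 with hq
  set v := chordVec e γ z.1 z.2 with hv
  set L := N q * ‖v‖ with hL
  have hsq : N q ^ 2 * ‖v‖ ^ 2 = L ^ 2 := (mul_pow _ _ _).symm
  have hγd : ∀ t, HasDerivAt γ (deriv γ t) t := fun t =>
    (B.curve.contDiff.differentiable hk1 t).hasDerivAt
  have hm : HasFDerivAt (fun z : ℝ × ℝ => (γ z.1, chordVec e γ z.1 z.2))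
      (((ContinuousLinearMap.fst ℝ ℝ ℝ).smulRight (deriv γ z.1)).prod
        (fderiv ℝ (fun z : ℝ × ℝ => chordVec e γ z.1 z.2) z)) z := by
    refine HasFDerivAt.prodMk ?_ (B.contDiff_chordVec.differentiable hk1 z).hasFDerivAt
    have := (hγd z.1).hasFDerivAt.comp z (hasFDerivAt_fst (𝕜 := ℝ) (E := ℝ) (F := ℝ) (p := z))
    convert! this using 1
  have hE : HasFDerivAt (fun p : ℂ × ℂ => N p.1 ^ 2 * ‖p.2‖ ^ 2)
      (fderiv ℝ (fun p : ℂ × ℂ => N p.1 ^ 2 * ‖p.2‖ ^ 2) (q, v)) (q, v) := by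
    have : ContDiff ℝ ∞ (fun p : ℂ × ℂ => N p.1 ^ 2 * ‖p.2‖ ^ 2) :=
      ((B.normal.smooth.comp contDiff_fst).pow 2).mul (contDiff_snd.norm_sq ℝ)
    exact (this.differentiable (by simp) _).hasFDerivAt
  have h1 := (hE.comp z hm).sqrt (by
    simp only [Function.comp_apply]
    rw [← hq, ← hv, hsq]; positivity)
  refine h1.congr_fderiv ?_
  simp only [Function.comp_apply]
  rw [← hq, ← hv, hsq, Real.sqrt_sq hLpos.le]
  have hX : HasFDerivAt (fun p : ℂ × ℂ => e p.1 p.2)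
      (fderiv ℝ (fun p : ℂ × ℂ => e p.1 p.2) (q, v)) (q, v) :=
    ((B.normal.contDiffAt_exp (B.mem z.1) (B.chordVec_mem z.1 z.2)).differentiableAt
      (by simp)).hasFDerivAt
  -- The chord ends at `γ z.2` identically, so moving the end parameters moves the endpoint by `γ'
  -- z.2` only. The first variation formula then needs no explicit derivative of the chord vector.
  have hXm := hX.comp z hm
  have hXe : ((fun p : ℂ × ℂ => e p.1 p.2) ∘ fun z : ℝ × ℝ => (γ z.1, chordVec e γ z.1 z.2))
      = fun z : ℝ × ℝ => γ z.2 := funext fun z => B.exp_chordVec z.1 z.2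
  rw [hXe] at hXm
  have hXm' := hXm.unique ((hγd z.2).hasFDerivAt.comp z
    (hasFDerivAt_snd (𝕜 := ℝ) (E := ℝ) (F := ℝ) (p := z)))
  refine ContinuousLinearMap.ext fun ζ => ?_
  have hfv := B.normal.first_variation (B.mem z.1) (B.chordVec_mem z.1 z.2) (ζ.1 • deriv γ z.1)
    (fderiv ℝ (fun z : ℝ × ℝ => chordVec e γ z.1 z.2) z ζ)
  have hXζ := DFunLike.congr_fun hXm' ζ
  simp only [ContinuousLinearMap.comp_apply, ContinuousLinearMap.prod_apply,
    ContinuousLinearMap.smulRight_apply, ContinuousLinearMap.coe_fst',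
    ContinuousLinearMap.coe_snd', ContinuousLinearMap.toSpanSingleton_apply] at hXζ
  rw [← hv, ← hq] at hfv
  rw [hXζ, inner_smul_left, inner_smul_left] at hfv
  have hV : fderiv ℝ (e q) v v = arrivalVec e γ z.1 z.2 := rfl
  have hev : e q v = γ z.2 := B.exp_chordVec z.1 z.2
  rw [hV, hev, inner_eq_norm_mul_cos (B.curve.regular z.2),
    inner_eq_norm_mul_cos (B.curve.regular z.1)] at hfv
  have hcos : Real.cos (arrivalVec e γ z.1 z.2 / deriv γ z.2).arg
      = Real.cos (arrivalAngle e γ z.1 z.2) := by rw [arrivalAngle, Real.cos_neg]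
  have hcos' : Real.cos (v / deriv γ z.1).arg = Real.cos (departureAngle e γ z.1 z.2) := rfl
  have hspeed : N (γ z.2) * ‖arrivalVec e γ z.1 z.2‖ = L := B.speed_arrivalVec z.1 z.2
  rw [hcos, hcos'] at hfv
  simp only [ContinuousLinearMap.comp_apply, ContinuousLinearMap.prod_apply,
    ContinuousLinearMap.smulRight_apply, ContinuousLinearMap.coe_fst',
    ContinuousLinearMap.coe_snd', _root_.add_apply, _root_.smul_apply, smul_eq_mul]
  have e1 : 1 / (2 * L) * fderiv ℝ (fun p : ℂ × ℂ => N p.1 ^ 2 * ‖p.2‖ ^ 2) (q, v)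
      (ζ.1 • deriv γ z.1, fderiv ℝ (fun z : ℝ × ℝ => chordVec e γ z.1 z.2) z ζ)
      = 1 / L * (1 / 2 * fderiv ℝ (fun p : ℂ × ℂ => N p.1 ^ 2 * ‖p.2‖ ^ 2) (q, v)
      (ζ.1 • deriv γ z.1, fderiv ℝ (fun z : ℝ × ℝ => chordVec e γ z.1 z.2) z ζ)) := by
    field_simp
  rw [e1, ← hfv]
  simp only [conj_trivial]
  have e2 : N (γ z.2) ^ 2 * (ζ.2 * (‖deriv γ z.2‖ * ‖arrivalVec e γ z.1 z.2‖ *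
        Real.cos (arrivalAngle e γ z.1 z.2))) - N q ^ 2 * (ζ.1 * (‖deriv γ z.1‖ * ‖v‖ *
        Real.cos (departureAngle e γ z.1 z.2)))
      = L * (N (γ z.2) * ‖deriv γ z.2‖ * Real.cos (arrivalAngle e γ z.1 z.2) * ζ.2
        - N q * ‖deriv γ z.1‖ * Real.cos (departureAngle e γ z.1 z.2) * ζ.1) := by
    rw [mul_sub]
    nth_rewrite 1 [← hspeed]
    rw [hL]
    ring
  rw [e2, ← mul_assoc, one_div_mul_cancel hLpos.ne']
  ring

/-- The mixed second derivatives of the generating function agree. -/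
theorem sin_mul_fderiv_eq (B : BilliardTable N W δ e (k + 1) γ) {z : ℝ × ℝ}
    (h : IsChord e γ z.1 z.2) :
    N (γ z.1) * ‖deriv γ z.1‖ * Real.sin (departureAngle e γ z.1 z.2) *
        fderiv ℝ (fun z : ℝ × ℝ => departureAngle e γ z.1 z.2) z (0, 1)
      = -(N (γ z.2) * ‖deriv γ z.2‖ * Real.sin (arrivalAngle e γ z.1 z.2) *
        fderiv ℝ (fun z : ℝ × ℝ => arrivalAngle e γ z.1 z.2) z (1, 0)) := by
  have hk : (k : WithTop ℕ∞) ≠ 0 := by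
    have := B.two_le
    exact_mod_cast (show k ≠ 0 by omega)
  have hk1 : ((k + 1 : ℕ) : WithTop ℕ∞) ≠ 0 := by exact_mod_cast k.succ_ne_zero
  set a : ℝ → ℝ := fun θ => N (γ θ) * ‖deriv γ θ‖ with ha
  have had : ∀ t, HasDerivAt a (deriv a t) t := fun t => by
    have h1 : ContDiffAt ℝ k a t :=
      (((B.normal.smooth.of_le ENat.LEInfty.out).comp
        (B.curve.contDiff.of_le (Nat.cast_le.2 k.le_succ))).contDiffAt).mul
        (B.contDiff_deriv.contDiffAt.norm ℝ (B.curve.regular t))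
    exact (h1.differentiableAt hk).hasDerivAt
  have hA := ((B.contDiffAt_departureAngle h).differentiableAt hk).hasFDerivAt
  have hB := ((B.contDiffAt_arrivalAngle h).differentiableAt hk).hasFDerivAt
  have hP := (((had z.1).hasFDerivAt.comp z (hasFDerivAt_fst (𝕜 := ℝ) (E := ℝ) (F := ℝ)
    (p := z))).mul hA.cos).neg.smul_const (ContinuousLinearMap.fst ℝ ℝ ℝ)
  have hQ := (((had z.2).hasFDerivAt.comp z (hasFDerivAt_snd (𝕜 := ℝ) (E := ℝ) (F := ℝ)
    (p := z))).mul hB.cos).smul_const (ContinuousLinearMap.snd ℝ ℝ ℝ)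
  have hev : ∀ᶠ y in 𝓝 z, IsChord e γ y.1 y.2 := B.isOpen_chord.mem_nhds h
  -- The formula for the differential holds on the open set of chords, and its coefficients are
  -- differentiable because `k ≥ 1`. That suffices for symmetry of the second derivative at `z`.
  have hsymm := second_derivative_symmetric_of_eventually
    (hev.mono fun y hy => B.hasFDerivAt_length hy) (hP.add hQ) (1, 0) (0, 1)
  simp at hsymm
  simp only [ha] at hsymm
  linarith

end BilliardTable

end Smoothness

/-! ### The billiard map, its lift and its inverse -/

section Lift

/-- The parameter of the endpoint of the chord that leaves `γ θ` with angle `α`. -/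
noncomputable def nextParam (e : ℂ → OpenPartialHomeomorph ℂ ℂ) (γ : ℝ → ℂ) (θ α : ℝ) : ℝ :=
  open scoped Classical in
  -- The default is never reached on a billiard table for `α` in `(0, π)`, by `exists_isChord`.
  if h : ∃ θ₁, IsChord e γ θ θ₁ ∧ departureAngle e γ θ θ₁ = α then h.choose else 0

/-- The lift of the billiard map to the universal cover. -/
noncomputable def billiardLift (e : ℂ → OpenPartialHomeomorph ℂ ℂ) (γ : ℝ → ℂ) (p : ℝ × ℝ) :
    ℝ × ℝ :=
  (nextParam e γ p.1 p.2, arrivalAngle e γ p.1 (nextParam e γ p.1 p.2))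

variable {N : ℂ → ℝ} {W : Set ℂ} {δ : ℝ} {e : ℂ → OpenPartialHomeomorph ℂ ℂ} {m k : ℕ} {γ : ℝ → ℂ}

namespace BilliardTable

theorem nextParam_spec (B : BilliardTable N W δ e m γ) (θ : ℝ) {α : ℝ} (hα : α ∈ Ioo 0 π) :
    IsChord e γ θ (nextParam e γ θ α) ∧ departureAngle e γ θ (nextParam e γ θ α) = α := by
  have h := B.exists_isChord θ hα
  rw [nextParam, dif_pos h]
  exact h.choose_spec

theorem nextParam_departureAngle (B : BilliardTable N W δ e m γ) {θ₀ θ₁ : ℝ}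
    (h : IsChord e γ θ₀ θ₁) : nextParam e γ θ₀ (departureAngle e γ θ₀ θ₁) = θ₁ := by
  have := B.nextParam_spec θ₀ (B.departureAngle_mem h)
  exact B.chord_unique this.1 h this.2

theorem billiardLift_snd_mem (B : BilliardTable N W δ e m γ) (θ : ℝ) {α : ℝ} (hα : α ∈ Ioo 0 π) :
    (billiardLift e γ (θ, α)).2 ∈ Ioo 0 π :=
  B.arrivalAngle_mem (B.nextParam_spec θ hα).1

theorem ne_zero (B : BilliardTable N W δ e (k + 1) γ) : (k : WithTop ℕ∞) ≠ 0 := by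
  have := B.two_le
  exact_mod_cast (show k ≠ 0 by omega)

/-- This map inverts `(θ₀, θ₁) ↦ (θ₀, A)` on the open set of chords. That derivative is triangular
with diagonal entries `1` and `∂A/∂θ₁ > 0`. -/
theorem contDiffAt_nextParam_pair (B : BilliardTable N W δ e (k + 1) γ) {p : ℝ × ℝ}
    (hp : p.2 ∈ Ioo 0 π) :
    ContDiffAt ℝ k (fun p : ℝ × ℝ => (p.1, nextParam e γ p.1 p.2)) p := by
  obtain ⟨hc, ha⟩ := B.nextParam_spec p.1 hp
  set z : ℝ × ℝ := (p.1, nextParam e γ p.1 p.2) with hz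
  have hA : ContDiffAt ℝ k (fun z : ℝ × ℝ => departureAngle e γ z.1 z.2) z :=
    B.contDiffAt_departureAngle (z := z) hc
  have hd := (hA.differentiableAt B.ne_zero).hasFDerivAt
  have hS := (hasFDerivAt_fst (𝕜 := ℝ) (E := ℝ) (F := ℝ) (p := z)).prodMk hd
  have hpos := B.fderiv_departureAngle_pos (z := z) hc
  obtain ⟨L, hL⟩ := exists_equiv_of_injective (L := (ContinuousLinearMap.fst ℝ ℝ ℝ).prod
      (fderiv ℝ (fun z : ℝ × ℝ => departureAngle e γ z.1 z.2) z)) (by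
    rw [injective_iff_map_eq_zero]
    rintro ⟨x, y⟩ hxy
    simp only [ContinuousLinearMap.prod_apply, ContinuousLinearMap.coe_fst',
      Prod.mk_eq_zero] at hxy
    obtain ⟨rfl, h2⟩ := hxy
    have h3 : ((0 : ℝ), y) = y • ((0 : ℝ), (1 : ℝ)) := by simp
    rw [h3, map_smul, smul_eq_mul] at h2
    rw [(mul_eq_zero.1 h2).resolve_right hpos.ne']
    rfl)
  have := (contDiffAt_leftInverse (g := fun p : ℝ × ℝ => (p.1, nextParam e γ p.1 p.2))
    (f := fun z : ℝ × ℝ => (z.1, departureAngle e γ z.1 z.2)) B.ne_zero B.isOpen_chord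
    (fun y hy => Prod.ext rfl (B.nextParam_departureAngle hy)) (x := z) hc
    (contDiffAt_fst.prodMk hA) (L := L) (by rw [hL]; exact hS)).1
  have hzp : ((z.1, departureAngle e γ z.1 z.2) : ℝ × ℝ) = p := Prod.ext rfl ha
  rw [hzp] at this
  exact this

theorem contDiffAt_billiardLift (B : BilliardTable N W δ e (k + 1) γ) {p : ℝ × ℝ}
    (hp : p.2 ∈ Ioo 0 π) : ContDiffAt ℝ k (billiardLift e γ) p := by
  have hg := B.contDiffAt_nextParam_pair hp
  have h2 := ContDiffAt.comp (g := fun z : ℝ × ℝ => arrivalAngle e γ z.1 z.2) p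
    (B.contDiffAt_arrivalAngle (z := (p.1, nextParam e γ p.1 p.2)) (B.nextParam_spec p.1 hp).1) hg
  exact hg.snd.prodMk h2

theorem contDiffOn_billiardLift (B : BilliardTable N W δ e (k + 1) γ) :
    ContDiffOn ℝ k (billiardLift e γ) (univ ×ˢ Ioo 0 π) :=
  fun _ hp => (B.contDiffAt_billiardLift hp.2).contDiffWithinAt

/-- At fixed `θ` this derivative is the reciprocal of `∂A/∂θ₁`, which is positive. -/
theorem deriv_nextParam_pos (B : BilliardTable N W δ e (k + 1) γ) (θ : ℝ) {α : ℝ}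
    (hα : α ∈ Ioo 0 π) : 0 < deriv (fun a => nextParam e γ θ a) α := by
  have hc := (B.nextParam_spec θ hα).1
  have hg := ((B.contDiffAt_nextParam_pair (p := (θ, α)) hα).snd.differentiableAt
    B.ne_zero).hasFDerivAt
  have h1 := hg.comp_hasDerivAt (f := fun a => (θ, a)) α
    ((hasDerivAt_const α θ).prodMk (hasDerivAt_id α))
  have hg' : HasDerivAt (fun a => nextParam e γ θ a) (deriv (fun a => nextParam e γ θ a) α) α :=
    h1.differentiableAt.hasDerivAt
  have hA := ((B.contDiffAt_departureAngle (z := (θ, nextParam e γ θ α)) hc).differentiableAt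
    B.ne_zero).hasFDerivAt
  have hcomp := hA.comp_hasDerivAt (f := fun a => (θ, nextParam e γ θ a)) α
    ((hasDerivAt_const α θ).prodMk hg')
  have hid : HasDerivAt ((fun z : ℝ × ℝ => departureAngle e γ z.1 z.2) ∘
      fun a => (θ, nextParam e γ θ a)) 1 α :=
    (hasDerivAt_id α).congr_of_eventuallyEq
      (Filter.eventually_of_mem (isOpen_Ioo.mem_nhds hα) fun a ha => (B.nextParam_spec θ ha).2)
  have heq := hcomp.unique hid
  have h3 : ((0 : ℝ), deriv (fun a => nextParam e γ θ a) α)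
      = deriv (fun a => nextParam e γ θ a) α • ((0 : ℝ), (1 : ℝ)) := by simp
  rw [h3, map_smul, smul_eq_mul] at heq
  have hpos := B.fderiv_departureAngle_pos (z := (θ, nextParam e γ θ α)) hc
  exact pos_of_mul_pos_left (heq.symm ▸ one_pos) hpos.le

/-- The Jacobian determinant of the billiard map. -/
theorem exists_hasFDerivAt_billiardLift (B : BilliardTable N W δ e (k + 1) γ) {p : ℝ × ℝ}
    (hp : p.2 ∈ Ioo 0 π) : ∃ F' : ℝ × ℝ →L[ℝ] ℝ × ℝ, HasFDerivAt (billiardLift e γ) F' p ∧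
      N (γ (billiardLift e γ p).1) * ‖deriv γ (billiardLift e γ p).1‖ *
        Real.sin (billiardLift e γ p).2 * F'.det = N (γ p.1) * ‖deriv γ p.1‖ * Real.sin p.2 := by
  obtain ⟨hc, ha⟩ := B.nextParam_spec p.1 hp
  set z : ℝ × ℝ := (p.1, nextParam e γ p.1 p.2) with hz
  have hA := ((B.contDiffAt_departureAngle (z := z) hc).differentiableAt B.ne_zero).hasFDerivAt
  have hA' := ((B.contDiffAt_arrivalAngle (z := z) hc).differentiableAt B.ne_zero).hasFDerivAt
  have hS := (hasFDerivAt_fst (𝕜 := ℝ) (E := ℝ) (F := ℝ) (p := z)).prodMk hA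
  have hS' := (hasFDerivAt_snd (𝕜 := ℝ) (E := ℝ) (F := ℝ) (p := z)).prodMk hA'
  have hg := ((B.contDiffAt_nextParam_pair hp).differentiableAt B.ne_zero).hasFDerivAt
  have hgS := HasFDerivAt.comp (g := fun p : ℝ × ℝ => (p.1, nextParam e γ p.1 p.2))
    (f := fun z : ℝ × ℝ => (z.1, departureAngle e γ z.1 z.2)) z
    (by rw [show ((z.1, departureAngle e γ z.1 z.2) : ℝ × ℝ) = p from Prod.ext rfl ha]; exact hg) hS
  have hid : HasFDerivAt ((fun p : ℝ × ℝ => (p.1, nextParam e γ p.1 p.2)) ∘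
      fun z : ℝ × ℝ => (z.1, departureAngle e γ z.1 z.2)) (ContinuousLinearMap.id ℝ (ℝ × ℝ)) z :=
    (hasFDerivAt_id z).congr_of_eventuallyEq (Filter.eventually_of_mem
      (B.isOpen_chord.mem_nhds (x := z) hc) fun y hy => Prod.ext rfl (B.nextParam_departureAngle hy))
  -- The lift is `(θ₁, A')` after the inverse of `(θ₀, A)`. The two determinants are `-∂A'/∂θ₀` and
  -- the reciprocal of `∂A/∂θ₁`; the symmetry relation ties them together.
  have hdet := congrArg ContinuousLinearMap.det (hgS.unique hid)
  have hdc : ∀ L M : ℝ × ℝ →L[ℝ] ℝ × ℝ, (L.comp M).det = L.det * M.det := fun L M => by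
    exact LinearMap.det_comp (L : ℝ × ℝ →ₗ[ℝ] ℝ × ℝ) M
  rw [hdc, det_prod_real (ContinuousLinearMap.id ℝ _), det_prod_real (ContinuousLinearMap.prod _ _)]
    at hdet
  refine ⟨_, HasFDerivAt.comp (g := fun z : ℝ × ℝ => (z.2, arrivalAngle e γ z.1 z.2)) p hS' hg, ?_⟩
  rw [hdc, det_prod_real (ContinuousLinearMap.prod _ _)]
  have hgen := B.sin_mul_fderiv_eq (z := z) hc
  simp only [ContinuousLinearMap.prod_apply, ContinuousLinearMap.coe_fst',
    ContinuousLinearMap.coe_snd', ContinuousLinearMap.id_apply] at hdet ⊢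
  rw [show departureAngle e γ z.1 z.2 = p.2 from ha] at hgen
  set d := (fderiv ℝ (fun p : ℝ × ℝ => (p.1, nextParam e γ p.1 p.2)) p).det
  have hF : billiardLift e γ p = (z.2, arrivalAngle e γ z.1 z.2) := rfl
  rw [hF]
  linear_combination (-d) * hgen + (N (γ p.1) * ‖deriv γ p.1‖ * Real.sin p.2) * hdet

end BilliardTable

theorem coe_eq_coe_iff {a b : ℝ} :
    (a : AddCircle (2 * π)) = (b : AddCircle (2 * π)) ↔ ∃ j : ℤ, a = b + j • (2 * π) := by
  rw [← sub_eq_zero, ← AddCircle.coe_sub, AddCircle.coe_eq_zero_iff]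
  exact exists_congr fun j => by rw [eq_sub_iff_add_eq', eq_comm]

namespace BilliardTable

theorem nextImpact_iff (B : BilliardTable N W δ e m γ) {θ₀ θ₁ α₀ α₁ : ℝ} (hα₀ : α₀ ∈ Ioo 0 π)
    (hα₁ : α₁ ∈ Ioo 0 π) : NextImpact N γ θ₀ α₀ θ₁ α₁ ↔
      (((billiardLift e γ (θ₀, α₀)).1 : ℝ) : AddCircle (2 * π)) = (θ₁ : AddCircle (2 * π)) ∧
        (billiardLift e γ (θ₀, α₀)).2 = α₁ := by
  constructor
  · intro h
    obtain ⟨j, hc, h0, h1⟩ := B.isChord_of_nextImpact hα₀ hα₁ h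
    have hn : nextParam e γ θ₀ α₀ = θ₁ + j • (2 * π) := by
      rw [← h0]
      exact B.nextParam_departureAngle hc
    refine ⟨coe_eq_coe_iff.2 ⟨j, hn⟩, ?_⟩
    rw [← h1, ← hn]
    rfl
  · rintro ⟨h1, rfl⟩
    obtain ⟨hc, ha⟩ := B.nextParam_spec θ₀ hα₀
    obtain ⟨j, hj⟩ := coe_eq_coe_iff.1 h1
    have h2 := B.nextImpact hc
    rw [ha, show nextParam e γ θ₀ α₀ = θ₁ + j • (2 * π) from hj] at h2
    have h3 := B.curve.nextImpact_add_zsmul (N := N) (θ₀ := θ₀) (α₀ := α₀) (θ₁ := θ₁)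
      (α₁ := arrivalAngle e γ θ₀ (θ₁ + j • (2 * π))) 0 j
    rw [zero_smul, add_zero] at h3
    have h4 : (billiardLift e γ (θ₀, α₀)).2 = arrivalAngle e γ θ₀ (θ₁ + j • (2 * π)) := by
      rw [← hj]
      rfl
    rw [h4]
    exact h3.1 h2

/-- The billiard map. -/
noncomputable def billiardFun (B : BilliardTable N W δ e m γ) (z : Phase) : Phase :=
  (((billiardLift e γ (z.1.out, z.2)).1 : AddCircle (2 * π)),
    ⟨(billiardLift e γ (z.1.out, z.2)).2, B.billiardLift_snd_mem _ z.2.2⟩)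

/-- The definition uses a chosen representative of the circle variable. Independence of that choice
follows from the `2π`-invariance of the impact relation. -/
theorem billiardFun_coe (B : BilliardTable N W δ e m γ) (θ : ℝ) (α : Ioo 0 π) :
    B.billiardFun ((θ : AddCircle (2 * π)), α) =
      (((billiardLift e γ (θ, α)).1 : AddCircle (2 * π)),
        ⟨(billiardLift e γ (θ, α)).2, B.billiardLift_snd_mem _ α.2⟩) := by
  obtain ⟨i, hi⟩ := coe_eq_coe_iff.1 (QuotientAddGroup.out_eq' (θ : AddCircle (2 * π)))
  have h1 := (B.nextImpact_iff (θ₀ := θ) α.2 (B.billiardLift_snd_mem θ α.2)).2 ⟨rfl, rfl⟩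
  have h2 := (B.curve.nextImpact_add_zsmul i 0).2 h1
  rw [zero_smul, add_zero, ← hi] at h2
  obtain ⟨h3, h4⟩ := (B.nextImpact_iff α.2 (B.billiardLift_snd_mem θ α.2)).1 h2
  exact Prod.ext h3 (Subtype.ext h4)

theorem isBilliardMap_billiardFun (B : BilliardTable N W δ e m γ) :
    IsBilliardMap N γ B.billiardFun := by
  intro θ₀ θ₁ α₀ α₁
  rw [B.billiardFun_coe, B.nextImpact_iff α₀.2 α₁.2, Prod.ext_iff, Subtype.ext_iff]

end BilliardTable

/-- Reversal of the direction of motion. -/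
noncomputable def reversal (z : Phase) : Phase :=
  (z.1, ⟨π - z.2, by linarith [z.2.2.2], by linarith [z.2.2.1]⟩)

theorem reversal_reversal (z : Phase) : reversal (reversal z) = z :=
  Prod.ext rfl (Subtype.ext (sub_sub_cancel _ _))

namespace BilliardTable

/-- Running a flight backwards is again a flight. With `R` the reversal, `T R T = R` makes `R T R` a
two-sided inverse, with the same regularity. -/
theorem billiardFun_reversal_billiardFun (B : BilliardTable N W δ e m γ) (z : Phase) :
    B.billiardFun (reversal (B.billiardFun z)) = reversal z := by
  obtain ⟨x, α⟩ := z
  obtain ⟨θ, rfl⟩ := QuotientAddGroup.mk_surjective x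
  have h := (B.isBilliardMap_billiardFun θ (billiardLift e γ (θ, α)).1 α
    ⟨_, B.billiardLift_snd_mem θ α.2⟩).1 (B.billiardFun_coe θ α)
  have h' := (B.isBilliardMap_billiardFun _ _ (reversal ((θ : AddCircle (2 * π)),
    ⟨_, B.billiardLift_snd_mem θ α.2⟩)).2 (reversal ((θ : AddCircle (2 * π)), α)).2).2
    (h.reverse B.curve.regular)
  exact (congrArg (fun z => B.billiardFun (reversal z)) (B.billiardFun_coe θ α)).trans h'

/-- The billiard map as a bijection of the phase space. -/
noncomputable def billiardEquiv (B : BilliardTable N W δ e m γ) : Phase ≃ Phase where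
  toFun := B.billiardFun
  invFun z := reversal (B.billiardFun (reversal z))
  left_inv z := by
    change reversal (B.billiardFun (reversal (B.billiardFun z))) = z
    rw [B.billiardFun_reversal_billiardFun, reversal_reversal]
  right_inv z := by rw [B.billiardFun_reversal_billiardFun, reversal_reversal]

theorem isLift_billiardLift (B : BilliardTable N W δ e m γ) :
    IsLift (billiardLift e γ) B.billiardEquiv := by
  intro θ α
  have h : B.billiardEquiv ((θ : AddCircle (2 * π)), α) = _ := B.billiardFun_coe θ α
  rw [h]

theorem isCkDiffeo_billiardEquiv (B : BilliardTable N W δ e (k + 1) γ) :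
    IsCkDiffeo k B.billiardEquiv := by
  refine ⟨⟨_, B.isLift_billiardLift, B.contDiffOn_billiardLift⟩,
    fun p => ((billiardLift e γ (p.1, π - p.2)).1, π - (billiardLift e γ (p.1, π - p.2)).2), ?_, ?_⟩
  · intro θ α
    have h : B.billiardEquiv.symm ((θ : AddCircle (2 * π)), α)
        = reversal (B.billiardFun ((θ : AddCircle (2 * π)),
          (reversal ((θ : AddCircle (2 * π)), α)).2)) := rfl
    rw [h, B.billiardFun_coe]
    rfl
  · intro p hp
    have h : π - p.2 ∈ Ioo 0 π := ⟨by linarith [hp.2.2], by linarith [hp.2.1]⟩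
    have h2 := ContDiffAt.comp (g := billiardLift e γ) (f := fun p : ℝ × ℝ => (p.1, π - p.2)) p
      (B.contDiffAt_billiardLift (p := (p.1, π - p.2)) h)
      (contDiffAt_fst.prodMk (contDiffAt_const.sub contDiffAt_snd))
    exact (h2.fst.prodMk (contDiffAt_const.sub h2.snd)).contDiffWithinAt

theorem hasTwist_billiardEquiv (B : BilliardTable N W δ e (k + 1) γ) :
    HasTwist B.billiardEquiv := by
  refine ⟨_, B.isLift_billiardLift, B.contDiffOn_billiardLift.of_le ?_,
    fun θ α hα => B.deriv_nextParam_pos θ hα⟩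
  have := B.two_le
  exact_mod_cast (show 1 ≤ k by omega)

end BilliardTable

end Lift

/-! ### Invariance of the measure -/

section Measure

/-- The projection of the strip onto the phase space, extended arbitrarily to the plane. -/
noncomputable def toPhase (p : ℝ × ℝ) : Phase :=
  open scoped Classical in
  ((p.1 : AddCircle (2 * π)), ⟨if p.2 ∈ Ioo 0 π then p.2 else π / 2, by
    split_ifs with h
    · exact h
    · exact ⟨by positivity, by linarith [pi_pos]⟩⟩)

theorem toPhase_of_mem {p : ℝ × ℝ} (hp : p.2 ∈ Ioo 0 π) :
    toPhase p = ((p.1 : AddCircle (2 * π)), ⟨p.2, hp⟩) :=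
  Prod.ext rfl (Subtype.ext (if_pos hp))

theorem measurable_toPhase : Measurable toPhase := by
  classical
  refine (AddCircle.measurable_mk'.comp measurable_fst).prodMk (Measurable.subtype_mk ?_)
  exact Measurable.ite (measurable_snd measurableSet_Ioo) measurable_snd measurable_const

theorem exists_toPhase_eq (z : Phase) : ∃ p ∈ Ico 0 (2 * π) ×ˢ Ioo 0 π, toPhase p = z := by
  have : Fact (0 < 2 * π) := ⟨two_pi_pos⟩
  have h := (AddCircle.equivIco (2 * π) 0 z.1).2
  have h : (AddCircle.equivIco (2 * π) 0 z.1 : ℝ) ∈ Ico 0 (2 * π) := ⟨h.1, by simpa using h.2⟩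
  refine ⟨(AddCircle.equivIco (2 * π) 0 z.1, z.2), ⟨h, z.2.2⟩, ?_⟩
  rw [toPhase_of_mem z.2.2]
  exact Prod.ext AddCircle.coe_equivIco rfl

theorem injOn_toPhase : InjOn toPhase (Ico 0 (2 * π) ×ˢ Ioo 0 π) := by
  have : Fact (0 < 2 * π) := ⟨two_pi_pos⟩
  rintro p hp q hq h
  rw [toPhase_of_mem hp.2, toPhase_of_mem hq.2, Prod.ext_iff, Subtype.ext_iff] at h
  refine Prod.ext ?_ h.2
  exact (AddCircle.coe_eq_coe_iff_of_mem_Ico (a := 0) (by rw [zero_add]; exact hp.1)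
    (by rw [zero_add]; exact hq.1)).1 h.1

/-- The measure is moved to a fundamental domain in the plane, where the change of variables formula
is available. -/
theorem polarMeasure_apply (n ρ : ℝ → ℝ) {A : Set Phase} (hA : MeasurableSet A) :
    polarMeasure n ρ A = ∫⁻ p in Ico 0 (2 * π) ×ˢ Ioo 0 π ∩ toPhase ⁻¹' A,
      ENNReal.ofReal (n (ρ p.1) * √(deriv ρ p.1 ^ 2 + ρ p.1 ^ 2) * Real.sin p.2) := by
  have hm : Measurable fun z : ℝ × Ioo 0 π => ((z.1 : AddCircle (2 * π)), z.2) :=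
    (AddCircle.measurable_mk'.comp measurable_fst).prodMk measurable_snd
  have hι : MeasurableEmbedding (Prod.map id Subtype.val : ℝ × Ioo 0 π → ℝ × ℝ) :=
    MeasurableEmbedding.id.prodMap (MeasurableEmbedding.subtype_coe measurableSet_Ioo)
  have hpre : (fun z : ℝ × Ioo 0 π => ((z.1 : AddCircle (2 * π)), z.2)) ⁻¹' A
      = (Prod.map id Subtype.val : ℝ × Ioo 0 π → ℝ × ℝ) ⁻¹' (toPhase ⁻¹' A) := by
    ext z
    simp only [mem_preimage]
    rw [toPhase_of_mem (p := Prod.map id Subtype.val z) z.2.2]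
    rfl
  have hmap : (((volume : Measure ℝ).restrict (Ico 0 (2 * π))).prod
      ((volume : Measure ℝ).comap (fun α : Ioo (0 : ℝ) π => (α : ℝ)))).map
        (Prod.map id Subtype.val) = volume.restrict (Ico 0 (2 * π) ×ˢ Ioo 0 π) := by
    have : IsFiniteMeasure ((volume : Measure ℝ).comap (fun α : Ioo (0 : ℝ) π => (α : ℝ))) :=
      ⟨by
        rw [(MeasurableEmbedding.subtype_coe measurableSet_Ioo).comap_apply, image_univ,
          Subtype.range_coe, Real.volume_Ioo]
        exact ENNReal.ofReal_lt_top⟩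
    rw [← Measure.map_prod_map _ _ measurable_id measurable_subtype_coe, Measure.map_id,
      map_comap_subtype_coe measurableSet_Ioo, Measure.prod_restrict, ← Measure.volume_eq_prod]
  rw [polarMeasure, Measure.map_apply hm hA, withDensity_apply _ (hm hA), hpre,
    inter_comm, ← Measure.restrict_restrict (measurable_toPhase hA), ← hmap, hι.restrict_map,
    hι.lintegral_map]
  rfl

/-- A bijection of the phase space whose lift has the right Jacobian preserves the measure. -/
theorem measurePreserving_of_lift {n ρ : ℝ → ℝ} {F : ℝ × ℝ → ℝ × ℝ} {T : Phase ≃ Phase}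
    (hF : IsLift F T) {w : ℝ → ℝ} (hw : ∀ θ, n (ρ θ) * √(deriv ρ θ ^ 2 + ρ θ ^ 2) = w θ)
    (hper : Function.Periodic w (2 * π)) (hpos : ∀ θ, 0 ≤ w θ)
    (hJ : ∀ p : ℝ × ℝ, p.2 ∈ Ioo 0 π → ∃ F' : ℝ × ℝ →L[ℝ] ℝ × ℝ, HasFDerivAt F F' p ∧
      w (F p).1 * Real.sin (F p).2 * F'.det = w p.1 * Real.sin p.2) :
    MeasurePreserving T (polarMeasure n ρ) (polarMeasure n ρ) := by
  classical
  have : Fact (0 < 2 * π) := ⟨two_pi_pos⟩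
  set D : Set (ℝ × ℝ) := Ico 0 (2 * π) ×ˢ Ioo 0 π with hD
  have hDm : MeasurableSet D := measurableSet_Ico.prod measurableSet_Ioo
  have hstrip : MeasurableSet {p : ℝ × ℝ | p.2 ∈ Ioo 0 π} := measurable_snd measurableSet_Ioo
  choose! F' hF' hdet using hJ
  have hFm : Measurable ({p : ℝ × ℝ | p.2 ∈ Ioo 0 π}.piecewise F 0) :=
    ContinuousOn.measurable_piecewise
      (fun p hp => (hF' p hp).continuousAt.continuousWithinAt) continuous_zero.continuousOn hstrip
  have hF2 : ∀ p : ℝ × ℝ, p.2 ∈ Ioo 0 π → (F p).2 ∈ Ioo 0 π := fun p hp => by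
    have := congrArg Prod.snd (hF p.1 ⟨p.2, hp⟩)
    change (F p).2 = _ at this
    rw [this]
    exact Subtype.prop _
  have hlift : ∀ p : ℝ × ℝ, p.2 ∈ Ioo 0 π → toPhase (F p) = T (toPhase p) := fun p hp => by
    have := hF p.1 ⟨p.2, hp⟩
    rw [Prod.ext_iff] at this
    rw [toPhase_of_mem hp, toPhase_of_mem (hF2 p hp)]
    exact Prod.ext this.1 (Subtype.ext this.2)
  have hTm : Measurable T := by
    have h1 : (T : Phase → Phase) = fun z => toPhase ({p : ℝ × ℝ | p.2 ∈ Ioo 0 π}.piecewise F 0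
        ((AddCircle.measurableEquivIco (2 * π) 0 z.1 : ℝ), (z.2 : ℝ))) := by
      funext z
      have hz : ((AddCircle.measurableEquivIco (2 * π) 0 z.1 : ℝ), (z.2 : ℝ)) ∈
        {p : ℝ × ℝ | p.2 ∈ Ioo 0 π} := z.2.2
      rw [piecewise_eq_of_mem _ _ _ hz, hlift _ hz, toPhase_of_mem hz]
      exact congrArg T (Prod.ext AddCircle.coe_equivIco.symm rfl)
    rw [h1]
    exact measurable_toPhase.comp (hFm.comp ((measurable_subtype_coe.comp
      ((AddCircle.measurableEquivIco (2 * π) 0).measurable.comp measurable_fst)).prodMk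
        (measurable_subtype_coe.comp measurable_snd)))
  refine ⟨hTm, Measure.ext fun A hA => ?_⟩
  rw [Measure.map_apply hTm hA, polarMeasure_apply n ρ (hTm hA), polarMeasure_apply n ρ hA]
  set dens : ℝ × ℝ → ENNReal := fun p =>
    ENNReal.ofReal (n (ρ p.1) * √(deriv ρ p.1 ^ 2 + ρ p.1 ^ 2) * Real.sin p.2) with h_dens
  -- The lift need not map the fundamental domain into itself. The domain is cut according to the
  -- period `j` in which the image lands, and `f j` translates that image back.
  set S : ℤ → Set (ℝ × ℝ) := fun j => (D ∩ toPhase ⁻¹' (T ⁻¹' A)) ∩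
    (fun p => ({p : ℝ × ℝ | p.2 ∈ Ioo 0 π}.piecewise F 0 p).1) ⁻¹'
      Ico (0 + j • (2 * π)) (0 + (j + 1) • (2 * π)) with hS
  set f : ℤ → ℝ × ℝ → ℝ × ℝ := fun j p => F p - (j • (2 * π), 0) with hf
  have hSD : ∀ {j p}, p ∈ S j → p ∈ D := fun hp => hp.1.1
  have hSmem : ∀ {j p}, p ∈ S j →
      (F p).1 ∈ Ico (0 + j • (2 * π)) (0 + (j + 1) • (2 * π)) := fun {j p} hp => by
    have := hp.2
    rwa [mem_preimage, piecewise_eq_of_mem {p : ℝ × ℝ | p.2 ∈ Ioo 0 π} _ _ (hSD hp).2] at this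
  have hdisjI := pairwise_disjoint_Ico_add_zsmul (0 : ℝ) (2 * π)
  have hSm : ∀ j, MeasurableSet (S j) := fun j =>
    (hDm.inter (measurable_toPhase (hTm hA))).inter ((measurable_fst.comp hFm) measurableSet_Ico)
  have hSdisj : Pairwise (Function.onFun Disjoint S) := fun i j hij =>
    Disjoint.mono inter_subset_right inter_subset_right ((hdisjI hij).preimage _)
  have hSU : ⋃ j, S j = D ∩ toPhase ⁻¹' (T ⁻¹' A) := by
    rw [hS, ← inter_iUnion, ← preimage_iUnion, iUnion_Ico_add_zsmul two_pi_pos, preimage_univ,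
      inter_univ]
  have hfD : ∀ {j p}, p ∈ S j → f j p ∈ D := fun {j p} hp => by
    have h1 := hSmem hp
    have h2 := hF2 p (hSD hp).2
    rw [add_smul, one_smul] at h1
    refine ⟨⟨?_, ?_⟩, ?_⟩
    · simp only [hf, Prod.fst_sub]
      linarith [h1.1]
    · simp only [hf, Prod.fst_sub]
      linarith [h1.2]
    · simpa [hf] using h2
  have hfT : ∀ {j p}, p ∈ S j → toPhase (f j p) = T (toPhase p) := fun {j p} hp => by
    rw [← hlift p (hSD hp).2, toPhase_of_mem (hfD hp).2, toPhase_of_mem (hF2 p (hSD hp).2)]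
    refine Prod.ext (coe_eq_coe_iff.2 ⟨-j, ?_⟩) (Subtype.ext ?_)
    · simp only [hf, Prod.fst_sub, neg_smul]
      ring
    · simp [hf]
  have hfinj : ∀ {i j p q}, p ∈ S i → q ∈ S j → f i p = f j q → p = q := fun hp hq h => by
    refine injOn_toPhase (hSD hp) (hSD hq) (T.injective ?_)
    rw [← hfT hp, ← hfT hq, h]
  have hfderiv : ∀ j, ∀ p ∈ S j, HasFDerivWithinAt (f j) (F' p) (S j) p := fun j p hp =>
    ((hF' p (hSD hp).2).sub_const _).hasFDerivWithinAt
  have hfi : ∀ j, InjOn (f j) (S j) := fun j p hp q hq h => hfinj hp hq h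
  -- Surjectivity of `T` makes the translated images cover the target; injectivity, below, makes
  -- them disjoint.
  have himU : ⋃ j, f j '' S j = D ∩ toPhase ⁻¹' A := by
    ext q
    simp only [mem_iUnion, mem_image]
    constructor
    · rintro ⟨j, p, hp, rfl⟩
      refine ⟨hfD hp, ?_⟩
      rw [mem_preimage, hfT hp]
      exact hp.1.2
    · rintro ⟨hqD, hqA⟩
      obtain ⟨p, hpD, hp⟩ := exists_toPhase_eq (T.symm (toPhase q))
      have hpS : p ∈ ⋃ j, S j := by
        rw [hSU]
        refine ⟨hpD, ?_⟩
        rw [mem_preimage, hp, mem_preimage, Equiv.apply_symm_apply]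
        exact hqA
      obtain ⟨j, hj⟩ := mem_iUnion.1 hpS
      refine ⟨j, p, hj, injOn_toPhase (hfD hj) hqD ?_⟩
      rw [hfT hj, hp, Equiv.apply_symm_apply]
  have himdisj : Pairwise (Function.onFun Disjoint fun j => f j '' S j) := fun i j hij => by
    refine disjoint_left.2 ?_
    rintro _ ⟨p, hp, rfl⟩ ⟨q, hq, h⟩
    have := hfinj hq hp h
    subst this
    exact disjoint_left.1 (hSdisj hij) hp hq
  -- Absolute values are taken in the Jacobian identity. Both weights are nonnegative, so the sign
  -- of the determinant is not needed; periodicity of `w` absorbs the translation.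
  have hdens : ∀ j, ∀ p ∈ S j, dens p = ENNReal.ofReal |(F' p).det| * dens (f j p) := fun j p hp => by
    have hw' : w (f j p).1 = w (F p).1 := by
      simp only [hf, Prod.fst_sub]
      exact hper.sub_zsmul_eq j
    have h2 : (f j p).2 = (F p).2 := by simp [hf]
    simp only [h_dens, hw]
    rw [← ENNReal.ofReal_mul (abs_nonneg _), hw', h2]
    congr 1
    have hs : 0 ≤ Real.sin (F p).2 := (sin_pos_of_mem_Ioo (hF2 p (hSD hp).2)).le
    have hs' : 0 ≤ Real.sin p.2 := (sin_pos_of_mem_Ioo (hSD hp).2).le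
    rw [← abs_of_nonneg (mul_nonneg (hpos p.1) hs'), ← hdet p (hSD hp).2, abs_mul,
      abs_of_nonneg (mul_nonneg (hpos _) hs)]
    ring
  rw [← hSU, ← himU, lintegral_iUnion hSm hSdisj, lintegral_iUnion
    (fun j => measurable_image_of_fderivWithin (hSm j) (hfderiv j) (hfi j)) himdisj]
  refine tsum_congr fun j => ?_
  rw [lintegral_image_eq_lintegral_abs_det_fderiv_mul volume (hSm j) (hfderiv j) (hfi j)]
  exact setLIntegral_congr_fun (hSm j) (hdens j)

end Measure

/-- The speed of a curve in polar coordinates. -/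
theorem norm_deriv_polar {γ : ℝ → ℂ} {ρ : ℝ → ℝ} (hρ : ∀ θ, 0 < ρ θ)
    (hγ : ∀ θ : ℝ, γ θ = ρ θ * Complex.exp (θ * Complex.I)) (hd : Differentiable ℝ γ)
    (h0 : ∀ θ, γ θ ≠ 0) (θ : ℝ) :
    ‖γ θ‖ = ρ θ ∧ ‖deriv γ θ‖ = √(deriv ρ θ ^ 2 + ρ θ ^ 2) := by
  have hn : ∀ θ, ‖γ θ‖ = ρ θ := fun θ => by
    rw [hγ, norm_mul, Complex.norm_exp_ofReal_mul_I, mul_one, Complex.norm_real,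
      Real.norm_of_nonneg (hρ θ).le]
  refine ⟨hn θ, ?_⟩
  -- Differentiability of `ρ` is not assumed: it is inherited from `‖γ‖`, since the curve avoids the
  -- origin.
  have hρd : HasDerivAt ρ (deriv ρ θ) θ := by
    have h1 : DifferentiableAt ℝ (fun t => ‖γ t‖) θ := (hd θ).norm ℝ (h0 θ)
    rw [funext hn] at h1
    exact h1.hasDerivAt
  have hexp : HasDerivAt (fun t : ℝ => Complex.exp (t * Complex.I))
      (Complex.exp (θ * Complex.I) * Complex.I) θ := by
    have h2 : HasDerivAt (fun t : ℝ => (t : ℂ) * Complex.I) Complex.I θ := by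
      simpa using (Complex.ofRealCLM.hasDerivAt (x := θ)).mul_const Complex.I
    exact h2.cexp
  have hm := hρd.ofReal_comp.mul hexp
  have hγ' : γ = fun t => ((ρ t : ℝ) : ℂ) * Complex.exp (t * Complex.I) := funext hγ
  have hder : deriv γ θ = (deriv ρ θ + ρ θ * Complex.I) * Complex.exp (θ * Complex.I) := by
    rw [hγ']
    refine hm.deriv.trans ?_
    ring
  rw [hder, norm_mul, Complex.norm_exp_ofReal_mul_I, mul_one, Complex.norm_add_mul_I]

end OpticalBilliard

theorem mainTheorem1 (k : ℕ) (hk : 1 ≤ k)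
    (n : ℝ → ℝ) (hn_smooth : ContDiff ℝ ∞ (OpticalBilliard.planeIndex n))
    (hn_pos : ∀ r, 0 ≤ r → 0 < n r)
    (γ : ℝ → ℂ) (hγ : OpticalBilliard.IsSimpleClosedCurve (k + 1) γ)
    (W : Set ℂ) (hW : OpticalBilliard.IsTotallyNormal (OpticalBilliard.planeIndex n) W)
    (hγW : OpticalBilliard.region γ ∪ range γ ⊆ W)
    (hcurv : ∀ θ, 0 < OpticalBilliard.geodesicCurvature (OpticalBilliard.planeIndex n) γ θ) :
    ∃ T : OpticalBilliard.Phase ≃ OpticalBilliard.Phase,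
      OpticalBilliard.IsBilliardMap (OpticalBilliard.planeIndex n) γ T ∧
      OpticalBilliard.IsCkDiffeo k T ∧
      OpticalBilliard.HasTwist T ∧
      ∀ ρ : ℝ → ℝ, (∀ θ, 0 < ρ θ) → (∀ θ : ℝ, γ θ = ρ θ * Complex.exp (θ * Complex.I)) →
        MeasurePreserving T (OpticalBilliard.polarMeasure n ρ)
          (OpticalBilliard.polarMeasure n ρ) := by
  have hpos : ∀ x, 0 < OpticalBilliard.planeIndex n x := fun x => hn_pos _ (norm_nonneg x)
  obtain ⟨δ, e, hδ⟩ := OpticalBilliard.IsTotallyNormal.exists_normalData hn_smooth hpos hW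
  have B : OpticalBilliard.BilliardTable (OpticalBilliard.planeIndex n) W δ e (k + 1) γ :=
    ⟨hδ, hγ, by omega, hγW, hcurv⟩
  refine ⟨B.billiardEquiv, B.isBilliardMap_billiardFun, B.isCkDiffeo_billiardEquiv,
    B.hasTwist_billiardEquiv, fun ρ hρ hγρ => ?_⟩
  have h0 : ∀ θ, γ θ ≠ 0 := fun θ => by
    rw [hγρ]
    exact mul_ne_zero (Complex.ofReal_ne_zero.2 (hρ θ).ne') (Complex.exp_ne_zero _)
  have hd : Differentiable ℝ γ := hγ.contDiff.differentiable (by exact_mod_cast k.succ_ne_zero)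
  -- The weight `N(γ)|γ'|` is the one produced by the generating function. It is periodic, and in
  -- polar coordinates it equals the stated density without `sin α`.
  refine OpticalBilliard.measurePreserving_of_lift B.isLift_billiardLift
    (w := fun θ => OpticalBilliard.planeIndex n (γ θ) * ‖deriv γ θ‖) (fun θ => ?_) (fun θ => ?_)
    (fun θ => mul_nonneg (hpos _).le (norm_nonneg _)) (fun p hp => ?_)
  · obtain ⟨h1, h2⟩ := OpticalBilliard.norm_deriv_polar hρ hγρ hd h0 θ
    simp only [OpticalBilliard.planeIndex, h1, h2]
  · simp only [hγ.periodic θ, OpticalBilliard.periodic_deriv hγ θ]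
  · exact B.exists_hasFDerivAt_billiardLift hp
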